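/- Fix the following conventions. A search problem assigns to every instance (encoded as a bit string) a set of bit strings, its solutions. A problem $A$ reduces to $B$ if there are polynomial-time computable maps $f, g$ such that $f$ maps instances of $A$ to instances of $B$ and, for every instance $x$ of $A$ and every solution $y$ of $f(x)$, $g(x,y)$ is a solution of $x$. Collision: given a Boolean circuit $C:\{0,1\}^n\to\{0,1\}^n$, find $x$ with $C(x)=0^n$, or $x\neq y$ with $C(x)=C(y)$. PPP is the class of problems in TFNP that reduce to Collision, and a problem is PPP-hard if every problem in PPP reduces to it. Long Choice: given $n$ and $n-1$ predicates $P_0,\dots,P_{n-2}$, where $P_i : U^{i+2}\to\{0,1\}$ with $U=\{0,1\}^n$ is given by a Boolean circuit of size $\mathrm{poly}(n)$, find a certificate, that is, a sequence of $n+1$ distinct elements $a_0,\dots,a_n\in U$ such that, for every $0\le i\le n-2$, the value $P_i(a_0,\dots,a_i,a_j)$ is the same for all $j>i$. **Theorem 2.** Long Choice is PPP-hard. More precisely: 1. There is a polynomial $q$ such that Long Choice, restricted to instances whose circuits have at most $q(n)$ gates, is PPP-hard. 2. Collision reduces to Long Choice (without a fixed bound on the circuit sizes) by a reduction that maps a circuit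 $C:\{0,1\}^n\to\{0,1\}^n$ to an instance with the same $n$ (so that $U$ is the domain of $C$), whose circuits have size polynomial in $n$ and the size of $C$, and such that every certificate $a_0,\dots,a_n$ of this instance contains a collision of $C$ (some $i\ne j$ with $C(a_i)=C(a_j)$) or an element $a_i$ with $C(a_i)=0^n$. -/

import Mathlib

/-! ### Boolean circuits -/

/-- A gate of a circuit with `n` input bits. The natural numbers are positions of other gates in
the list of gates of the circuit. -/
inductive BoolGate (n : ℕ) : Type
  | input (i : Fin n)
  | const (b : Bool)
  | not (j : ℕ)
  | and (j k : ℕ)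
  | or (j k : ℕ)

namespace BoolGate

variable {n : ℕ}

/-- The gates whose values are read by a gate. -/
def refs : BoolGate n → List ℕ
  | input _ => []
  | const _ => []
  | not j => [j]
  | and j k => [j, k]
  | or j k => [j, k]

/-- The value of a gate, where `x` is the input and `v` lists the values of the earlier gates. -/
def eval (x : Fin n → Bool) (v : List Bool) : BoolGate n → Bool
  | input i => x i
  | const b => b
  | not j => !(v.getD j false)
  | and j k => v.getD j false && v.getD k false
  | or j k => v.getD j false || v.getD k false

/-- A gate is described by a tag and two arguments. -/
def toNats : BoolGate n → List ℕ
  | input i => [0, i, 0]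
  | const b => [1, b.toNat, 0]
  | not j => [2, j, 0]
  | and j k => [3, j, k]
  | or j k => [4, j, k]

theorem length_toNats (g : BoolGate n) : g.toNats.length = 3 := by
  cases g <;> rfl

theorem toNats_injective : Function.Injective (toNats (n := n)) := by
  intro g h e
  cases g <;> cases h <;> simp_all [toNats, Fin.ext_iff]
  rename_i b c
  cases b <;> cases c <;> simp_all

end BoolGate

/-- A Boolean circuit with `n` input bits and `m` output bits: a list of gates, each of which
reads only earlier gates, and for every output bit the position of the gate that computes it. -/
structure BoolCircuit (n m : ℕ) where
  gates : List (BoolGate n)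
  out : Fin m → ℕ
  refs_lt : ∀ (k : ℕ) (hk : k < gates.length), ∀ r ∈ gates[k].refs, r < k
  out_lt : ∀ o, out o < gates.length

namespace BoolCircuit

variable {n m : ℕ}

/-- The size of a circuit is its number of gates. -/
def size (C : BoolCircuit n m) : ℕ := C.gates.length

/-- The values of all gates, in order. -/
def values (C : BoolCircuit n m) (x : Fin n → Bool) : List Bool :=
  C.gates.foldl (fun v g => v ++ [g.eval x v]) []

/-- The function computed by a circuit. -/
def eval (C : BoolCircuit n m) (x : Fin n → Bool) : Fin m → Bool :=
  fun o => (C.values x).getD (C.out o) false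

/-- Description of a circuit by natural numbers: the number of gates, the gates, the outputs. -/
def toNats (C : BoolCircuit n m) : List ℕ :=
  C.gates.length :: ((C.gates.map BoolGate.toNats).flatten ++ List.ofFn C.out)

theorem gates_toNats_inj : ∀ (l₁ l₂ : List (BoolGate n)) (s₁ s₂ : List ℕ),
    l₁.length = l₂.length →
    (l₁.map BoolGate.toNats).flatten ++ s₁ = (l₂.map BoolGate.toNats).flatten ++ s₂ →
    l₁ = l₂ ∧ s₁ = s₂
  | [], [], _, _, _, h => ⟨rfl, by simpa using h⟩
  | [], _ :: _, _, _, hl, _ => by simp at hl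
  | _ :: _, [], _, _, hl, _ => by simp at hl
  | g₁ :: l₁, g₂ :: l₂, s₁, s₂, hl, h => by
    simp only [List.map_cons, List.flatten_cons, List.append_assoc] at h
    have h' := List.append_inj h (by simp [BoolGate.length_toNats])
    have ih := gates_toNats_inj l₁ l₂ s₁ s₂ (by simpa using hl) h'.2
    exact ⟨by rw [BoolGate.toNats_injective h'.1, ih.1], ih.2⟩

/-- Descriptions of circuits of a known format are self-delimiting. -/
theorem toNats_append_inj {C D : BoolCircuit n m} {s t : List ℕ}
    (h : C.toNats ++ s = D.toNats ++ t) : C = D ∧ s = t := by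
  simp only [toNats, List.cons_append, List.append_assoc, List.cons.injEq] at h
  obtain ⟨hg, h'⟩ := gates_toNats_inj _ _ _ _ h.1 h.2
  obtain ⟨ho, hs⟩ := List.append_inj h' (by simp)
  refine ⟨?_, hs⟩
  cases C
  cases D
  have ho' := List.ofFn_injective ho
  simp_all

end BoolCircuit

/-! ### Strings, polynomial time and search problems -/

/-- A list of natural numbers as a bit string; the number `k` is written as `k` ones followed by
a zero. -/
def natsToBits (l : List ℕ) : List Bool :=
  (l.map fun k => List.replicate k true ++ [false]).flatten

theorem natsToBits_injective : Function.Injective natsToBits := by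
  have key : ∀ (a b : ℕ) (s t : List Bool),
      List.replicate a true ++ false :: s = List.replicate b true ++ false :: t →
      a = b ∧ s = t := by
    intro a
    induction a with
    | zero =>
      intro b s t h
      cases b with
      | zero => simpa using h
      | succ b => simp [List.replicate_succ] at h
    | succ a ih =>
      intro b s t h
      cases b with
      | zero => simp [List.replicate_succ] at h
      | succ b =>
        simp only [List.replicate_succ, List.cons_append, List.cons.injEq, true_and] at h
        obtain ⟨h1, h2⟩ := ih b s t h
        exact ⟨by rw [h1], h2⟩
  intro l₁
  induction l₁ with
  | nil =>
    intro l₂ h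
    cases l₂ with
    | nil => rfl
    | cons b l₂ => simp [natsToBits] at h
  | cons a l₁ ih =>
    intro l₂ h
    cases l₂ with
    | nil => simp [natsToBits] at h
    | cons b l₂ =>
      simp only [natsToBits, List.map_cons, List.flatten_cons, List.append_assoc,
        List.cons_append, List.nil_append] at h
      obtain ⟨h1, h2⟩ := key _ _ _ _ h
      rw [h1, ih h2]

/-- `f` is computable in polynomial time, where `ea` and `eb` encode its arguments and values as
strings over finite alphabets. -/
def PolyTime {α β Γ Δ : Type} (ea : α → List Γ) (eb : β → List Δ) (f : α → β) : Prop :=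
  Nonempty (Turing.TM2ComputableInPolyTime ea eb f)

/-- A pair of bit strings as one string over two disjoint copies of the bits. -/
def pairBits (x y : List Bool) : List (Bool ⊕ Bool) :=
  x.map Sum.inl ++ y.map Sum.inr

/-- A search problem: a type of instances with an encoding by bit strings, and for every instance
the bit strings that solve it. -/
structure SearchProblem where
  Inst : Type
  encode : Inst → List Bool
  encode_injective : Function.Injective encode
  IsSol : Inst → List Bool → Prop

namespace SearchProblem

/-- The search problem of a binary relation on bit strings. -/
def ofRel (R : List Bool → List Bool → Prop) : SearchProblem where
  Inst := List Bool
  encode := id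
  encode_injective := Function.injective_id
  IsSol := R

/-- `f` maps instances of `A` to instances of `B` in polynomial time, and some polynomial-time `g`
maps every solution `y` of `f x`, together with `x`, to a solution of `x`. -/
def ReducesVia (A B : SearchProblem) (f : A.Inst → B.Inst) : Prop :=
  PolyTime A.encode B.encode f ∧
    ∃ g : A.Inst → List Bool → List Bool,
      PolyTime (α := {p : A.Inst × List Bool // B.IsSol (f p.1) p.2})
        (fun p => pairBits (A.encode p.1.1) p.1.2) id (fun p => g p.1.1 p.1.2) ∧
      ∀ x y, B.IsSol (f x) y → A.IsSol x (g x y)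

/-- Polynomial-time many-one reducibility of search problems. -/
def Reduces (A B : SearchProblem) : Prop :=
  ∃ f : A.Inst → B.Inst, A.ReducesVia B f

end SearchProblem

/-- The class TFNP: relations that are decidable in polynomial time, whose solutions have
polynomially bounded length, and which are total. -/
def InTFNP (R : List Bool → List Bool → Prop) : Prop :=
  (∃ v : List Bool × List Bool → Bool,
    PolyTime (fun p => pairBits p.1 p.2) Computability.encodeBool v ∧
      ∀ x y, v (x, y) = true ↔ R x y) ∧
  (∃ q : Polynomial ℕ, ∀ x y, R x y → y.length ≤ q.eval x.length) ∧
  ∀ x, ∃ y, R x y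

/-! ### Collision and the class PPP -/

/-- The problem Collision: given a circuit with `n` input and `n` output bits, find an input that
is mapped to the all-zero string, or two distinct inputs that are mapped to the same string. -/
def collision : SearchProblem where
  Inst := Σ n : ℕ, BoolCircuit n n
  encode C := natsToBits (C.1 :: C.2.toNats)
  encode_injective := by
    rintro ⟨n, C⟩ ⟨m, D⟩ h
    have h' := natsToBits_injective h
    simp only [List.cons.injEq] at h'
    obtain ⟨rfl, h2⟩ := h'
    have h3 : C.toNats ++ [] = D.toNats ++ [] := by simpa using h2
    rw [(BoolCircuit.toNats_append_inj h3).1]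
  IsSol C s :=
    (∃ x : Fin C.1 → Bool, (C.2.eval x = fun _ => false) ∧ s = List.ofFn x) ∨
    (∃ x y : Fin C.1 → Bool, x ≠ y ∧ C.2.eval x = C.2.eval y ∧
      s = List.ofFn x ++ List.ofFn y)

/-- The class PPP: the problems in TFNP that reduce to Collision. -/
def InPPP (R : List Bool → List Bool → Prop) : Prop :=
  InTFNP R ∧ (SearchProblem.ofRel R).Reduces collision

/-- A search problem is PPP-hard if all problems in PPP reduce to it. -/
def PPPHard (A : SearchProblem) : Prop :=
  ∀ R : List Bool → List Bool → Prop, InPPP R → (SearchProblem.ofRel R).Reduces A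

/-! ### Long Choice -/

/-- An instance of Long Choice over the universe of all `n`-bit strings: circuits for predicates
`P₀, …, Pₙ₋₂`, where `Pᵢ` has `i + 2` arguments from the universe. -/
def LongChoiceInstance (n : ℕ) : Type :=
  (i : Fin (n - 1)) → BoolCircuit ((i.val + 2) * n) 1

namespace LongChoiceInstance

variable {n : ℕ}

/-- The predicate `Pᵢ`; its circuit reads the arguments one after the other. -/
def pred (P : LongChoiceInstance n) (i : Fin (n - 1)) (w : Fin (i.val + 2) → Fin n → Bool) :
    Bool :=
  (P i).eval (fun t => w t.divNat t.modNat) 0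

/-- The tuple `(a₀, …, aᵢ, aⱼ)`. -/
def args (a : Fin (n + 1) → Fin n → Bool) (i : Fin (n - 1)) (j : Fin (n + 1)) :
    Fin (i.val + 2) → Fin n → Bool :=
  Fin.snoc (α := fun _ => Fin n → Bool) (fun k : Fin (i.val + 1) => a ⟨k.val, by omega⟩) (a j)

/-- A certificate is a sequence of distinct elements `a₀, …, aₙ` of the universe such that, for
every `i ≤ n - 2`, the value `Pᵢ(a₀, …, aᵢ, aⱼ)` is the same for all `j > i`. -/
def IsCertificate (P : LongChoiceInstance n) (a : Fin (n + 1) → Fin n → Bool) : Prop :=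
  Function.Injective a ∧
    ∀ (i : Fin (n - 1)) (j k : Fin (n + 1)), i.val < j.val → i.val < k.val →
      P.pred i (args a i j) = P.pred i (args a i k)

/-- The size of the instance is at most `s` if each of its circuits has at most `s` gates. -/
def SizeLE (P : LongChoiceInstance n) (s : ℕ) : Prop :=
  ∀ i, (P i).size ≤ s

theorem flatten_toNats_inj : ∀ {r : ℕ} {d : Fin r → ℕ} (P Q : (i : Fin r) → BoolCircuit (d i) 1),
    (List.ofFn fun i => (P i).toNats).flatten = (List.ofFn fun i => (Q i).toNats).flatten →
    P = Q
  | 0, _, _, _, _ => funext fun i => i.elim0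
  | r + 1, d, P, Q, h => by
    simp only [List.ofFn_succ, List.flatten_cons] at h
    obtain ⟨h0, h1⟩ := BoolCircuit.toNats_append_inj h
    have ih := flatten_toNats_inj (fun i => P i.succ) (fun i => Q i.succ) h1
    funext i
    refine Fin.cases h0 (fun j => ?_) i
    exact congrFun ih j

end LongChoiceInstance

/-- The problem Long Choice: given `n` and the predicates, find a certificate. -/
def longChoice : SearchProblem where
  Inst := Σ n : ℕ, LongChoiceInstance n
  encode P := natsToBits (P.1 :: (List.ofFn fun i => (P.2 i).toNats).flatten)
  encode_injective := by
    rintro ⟨n, P⟩ ⟨m, Q⟩ h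
    have h' := natsToBits_injective h
    simp only [List.cons.injEq] at h'
    obtain ⟨rfl, h2⟩ := h'
    rw [LongChoiceInstance.flatten_toNats_inj P Q h2]
  IsSol P s :=
    ∃ a, P.2.IsCertificate a ∧ s = (List.ofFn fun i => List.ofFn (a i)).flatten

/-- Long Choice, restricted to the instances whose circuits have at most `q n` gates. -/
def longChoiceOfSize (q : Polynomial ℕ) : SearchProblem where
  Inst := {P : longChoice.Inst // P.2.SizeLE (q.eval P.1)}
  encode P := longChoice.encode P.1
  encode_injective := longChoice.encode_injective.comp Subtype.val_injective
  IsSol P := longChoice.IsSol P.1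

/-! ### Structured stack programs and their compilation to `TM2` machines -/

/-! Regard the strings `c_j = C(a_j)` as vectors over the field with two elements. The predicates
perform Gaussian elimination on them. Step `t` takes the current vector number `t` as pivot, with
leading position `p`, and adds it to those later vectors that have a one at `p`. The predicate
`P_t(a_0, …, a_t, a_j)` is the bit at `p` of the current vector number `j`, that is, the coefficient
of the pivot. By `elim_congr` this bit depends only on `c_0, …, c_t` and `c_j`, so it is a
legitimate predicate.

In a certificate the coefficient is the same for all `j > t`, so a step adds one and the same vector
(zero or the pivot) to all later vectors. Hence distinct vectors stay distinct. Nonzero vectors stay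
nonzero, since a vector plus the pivot is the difference of two distinct vectors. Moreover all later
vectors now vanish at `p`. If no `c_j` were zero and no two of them equal, then after `n - 1` steps
two distinct nonzero vectors would be supported on a single position, which is impossible. This is
`not_injective`, and `exists_collision_of_isCertificate` applies it to certificates.

The circuit for `P_i` consists of `i + 2` copies of `C` and twelve gates for every step, vector and
bit; `values_cell` and `pred_circuit` show that it computes the coefficient. Its size is polynomial
in `n` and the size of `C`, but not in `n` alone. For a fixed bound `q(n)`, `padCircuit` first adds
as many input bits as `C` has gates and passes them through unchanged. The size becomes linear in
the number of inputs, and zeros and collisions of the padded circuit restrict to those of `C`.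

It remains to show that the reductions run in polynomial time on `TM2` machines. Structured programs
(`Prog`) with calls to other machines are compiled to such machines, with correctness in
`reachesIn_code`. They give closure of polynomial time under composition, pairing, case distinction
and iteration with bounded size. From there on (`PT`), polynomial time is verified for functions of
numbers and lists, and the descriptions of the circuits, as well as the search for a collision in a
certificate, are expressed by such functions. -/

open Turing

/-- `b` is reached from `a` after exactly `n` applications of the partial function `f`. -/
def ReachesIn {σ : Type} (f : σ → Option σ) (n : ℕ) (a b : σ) : Prop :=
  (flip bind f)^[n] (some a) = some b

namespace ReachesIn

variable {σ : Type} {f : σ → Option σ} {a b c : σ} {m n : ℕ}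

theorem refl (a : σ) : ReachesIn f 0 a a := rfl

theorem head (h : f a = some b) (hbc : ReachesIn f n b c) : ReachesIn f (n + 1) a c := by
  unfold ReachesIn at *
  rw [Function.iterate_succ_apply]
  change (flip bind f)^[n] (f a) = _
  rw [h, hbc]

theorem trans (hab : ReachesIn f m a b) (hbc : ReachesIn f n b c) : ReachesIn f (m + n) a c := by
  unfold ReachesIn at *
  rw [Nat.add_comm, Function.iterate_add_apply, hab, hbc]

theorem exists_of_succ (h : ReachesIn f (n + 1) a c) : ∃ b, f a = some b ∧ ReachesIn f n b c := by
  unfold ReachesIn at *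
  rw [Function.iterate_succ_apply] at h
  change (flip bind f)^[n] (f a) = _ at h
  cases hb : f a with
  | some b => exact ⟨b, rfl, by rw [← h, hb]⟩
  | none =>
    rw [hb] at h
    have hn : ∀ k, (flip bind f)^[k] none = none := by
      intro k
      induction k with
      | zero => rfl
      | succ k ih => rw [Function.iterate_succ_apply]; exact ih
    rw [hn] at h
    cases h

end ReachesIn

/-- Programs over stacks with alphabets `Γ k` that call the machines `tm i`. Branching and
iteration pop the symbol that they inspect. -/
inductive Prog {K ι : Type} (Γ : K → Type) (tm : ι → FinTM2) : Type
  | nop : Prog Γ tm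
  | push (k : K) (a : Γ k) : Prog Γ tm
  | seq (p q : Prog Γ tm) : Prog Γ tm
  | case (k : K) (f : Option (Γ k) → Prog Γ tm) : Prog Γ tm
  | loop (k : K) (f : Γ k → Prog Γ tm) : Prog Γ tm
  | call (i : ι) (k k' : K) (f : Γ k → (tm i).Γ (tm i).k₀) (g : (tm i).Γ (tm i).k₁ → Γ k') :
      Prog Γ tm

namespace Prog

variable {K ι : Type} {Γ : K → Type} {tm : ι → FinTM2}

/-- The labels of a compiled program. -/
@[reducible] def Lab : Prog Γ tm → Type
  | nop => Unit
  | push _ _ => Unit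
  | seq p q => Lab p ⊕ Lab q
  | case _ f => Option (Σ o, Lab (f o))
  | loop _ f => Option (Σ a, Lab (f a))
  | call i k k' _ _ => Option (Γ k) ⊕ (tm i).Λ ⊕ Option (Γ k')

/-- The label at which a compiled program starts. -/
def entry : (p : Prog Γ tm) → Lab p
  | nop => ()
  | push _ _ => ()
  | seq p _ => Sum.inl (entry p)
  | case _ _ => none
  | loop _ _ => none
  | call _ _ _ _ _ => Sum.inl none

noncomputable instance fintypeLab [∀ k, Fintype (Γ k)] : (p : Prog Γ tm) → Fintype (Lab p)
  | nop => inferInstanceAs (Fintype Unit)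
  | push _ _ => inferInstanceAs (Fintype Unit)
  | seq p q =>
    have := fintypeLab p
    have := fintypeLab q
    inferInstanceAs (Fintype (Lab p ⊕ Lab q))
  | case _ f =>
    have := fun o => fintypeLab (f o)
    inferInstanceAs (Fintype (Option (Σ o, Lab (f o))))
  | loop _ f =>
    have := fun a => fintypeLab (f a)
    inferInstanceAs (Fintype (Option (Σ a, Lab (f a))))
  | call i k k' _ _ =>
    have := (tm i).ΛFin
    inferInstanceAs (Fintype (Option (Γ k) ⊕ (tm i).Λ ⊕ Option (Γ k')))

variable (Γ tm) in
/-- The stack alphabets of a compiled program. -/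
@[reducible] def Alph : K ⊕ (Σ i, (tm i).K) → Type
  | .inl k => Γ k
  | .inr x => (tm x.1).Γ x.2

variable (Γ tm) in
/-- The internal states of a compiled program: the symbols popped last and the states of the
machines that can be called. -/
abbrev Reg : Type := (∀ k, Option (Γ k)) × (∀ i, (tm i).σ)

/-- A store of the program together with stores of the machines. -/
def comb (S : ∀ k, List (Γ k)) (T : ∀ i, ∀ k, List ((tm i).Γ k)) : ∀ x, List (Alph Γ tm x)
  | .inl k => S k
  | .inr x => T x.1 x.2

variable [DecidableEq K] [DecidableEq ι]

theorem update_comb_inl (S : ∀ k, List (Γ k)) (T : ∀ i, ∀ k, List ((tm i).Γ k)) (k : K)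
    (v : List (Γ k)) :
    Function.update (comb S T) (.inl k) v = comb (Function.update S k v) T := by
  funext x
  rcases x with j | x
  · by_cases h : j = k
    · subst h
      exact (Function.update_self _ _ _).trans (Function.update_self j v S).symm
    · refine (Function.update_of_ne (by simpa using h) _ _).trans ?_
      change S j = Function.update S k v j
      rw [Function.update_of_ne h]
  · exact Function.update_of_ne (by simp) _ _

theorem update_comb_inr (S : ∀ k, List (Γ k)) (T : ∀ i, ∀ k, List ((tm i).Γ k)) (i : ι)
    (k : (tm i).K) (v : List ((tm i).Γ k)) :
    Function.update (comb S T) (.inr ⟨i, k⟩) v =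
      comb S (Function.update T i (Function.update (T i) k v)) := by
  funext x
  rcases x with j | ⟨j, l⟩
  · exact Function.update_of_ne (by simp) _ _
  · by_cases h : j = i
    · subst h
      by_cases h' : l = k
      · subst h'
        refine (Function.update_self _ _ _).trans ?_
        change v = Function.update T j (Function.update (T j) l v) j l
        simp
      · refine (Function.update_of_ne (by simpa using h') _ _).trans ?_
        change T j l = Function.update T j (Function.update (T j) k v) j l
        simp [h']
    · refine (Function.update_of_ne (by simp [h]) _ _).trans ?_
      change T j l = Function.update T i (Function.update (T i) k v) j l
      rw [Function.update_of_ne h]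

/-- The statements of a machine that is called, as statements of the calling program. -/
def embed {Λ : Type} (i : ι) (run : (tm i).Λ → Λ) (ret : Λ) :
    TM2.Stmt (tm i).Γ (tm i).Λ (tm i).σ → TM2.Stmt (Alph Γ tm) Λ (Reg Γ tm)
  | .push k f q => .push (.inr ⟨i, k⟩) (fun s => f (s.2 i)) (embed i run ret q)
  | .peek k f q => .peek (.inr ⟨i, k⟩) (fun s o => (s.1, Function.update s.2 i (f (s.2 i) o)))
      (embed i run ret q)
  | .pop k f q => .pop (.inr ⟨i, k⟩) (fun s o => (s.1, Function.update s.2 i (f (s.2 i) o)))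
      (embed i run ret q)
  | .load f q => .load (fun s => (s.1, Function.update s.2 i (f (s.2 i)))) (embed i run ret q)
  | .branch f q₁ q₂ => .branch (fun s => f (s.2 i)) (embed i run ret q₁) (embed i run ret q₂)
  | .goto f => .goto fun s => run (f (s.2 i))
  | .halt => .goto fun _ => ret

/-- The compiled program. The labels of a subprogram are embedded into the labels of the whole
program, and control is passed to the label `exit` at the end. -/
def code {Λ : Type} : (p : Prog Γ tm) → (Lab p → Λ) → Λ → Lab p →
    TM2.Stmt (Alph Γ tm) Λ (Reg Γ tm)
  | nop, _, exit, _ => .goto fun _ => exit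
  | push k a, _, exit, _ => .push (.inl k) (fun _ => a) (.goto fun _ => exit)
  | seq p q, emb, _, .inl l => code p (fun l => emb (.inl l)) (emb (.inr (entry q))) l
  | seq _ q, emb, exit, .inr l => code q (fun l => emb (.inr l)) exit l
  | case k f, emb, _, none => .pop (.inl k) (fun s o => (Function.update s.1 k o, s.2))
      (.goto fun s => emb (some ⟨s.1 k, entry (f (s.1 k))⟩))
  | case _ f, emb, exit, some ⟨o, l⟩ => code (f o) (fun l => emb (some ⟨o, l⟩)) exit l
  | loop k f, emb, exit, none => .pop (.inl k) (fun s o => (Function.update s.1 k o, s.2))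
      (.goto fun s => (s.1 k).elim exit fun a => emb (some ⟨a, entry (f a)⟩))
  | loop _ f, emb, _, some ⟨a, l⟩ => code (f a) (fun l => emb (some ⟨a, l⟩)) (emb none) l
  | call i k _ _ _, emb, _, .inl none =>
      .pop (.inl k) (fun s o => (Function.update s.1 k o, s.2))
        (.goto fun s => (s.1 k).elim (emb (.inr (.inl (tm i).main))) fun a => emb (.inl (some a)))
  | call i _ _ f _, emb, _, .inl (some a) =>
      .push (.inr ⟨i, (tm i).k₀⟩) (fun _ => f a) (.goto fun _ => emb (.inl none))
  | call i _ _ _ _, emb, _, .inr (.inl l) =>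
      embed i (fun l => emb (.inr (.inl l))) (emb (.inr (.inr none))) ((tm i).m l)
  | call i _ k' _ g, emb, exit, .inr (.inr none) =>
      .pop (.inr ⟨i, (tm i).k₁⟩) (fun s o => (Function.update s.1 k' (o.map g), s.2))
        (.goto fun s => (s.1 k').elim exit fun b => emb (.inr (.inr (some b))))
  | call _ _ k' _ _, emb, _, .inr (.inr (some b)) =>
      .push (.inl k') (fun _ => b) (.goto fun _ => emb (.inr (.inr none)))

/-- Big-step semantics: the program turns the store `S` into `S'` within the given time. -/
inductive Exec : Prog Γ tm → (∀ k, List (Γ k)) → (∀ k, List (Γ k)) → ℕ → Prop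
  | nop (S) : Exec nop S S 1
  | push (S) (k a) : Exec (push k a) S (Function.update S k (a :: S k)) 1
  | seq {p q S S' S'' t t'} : Exec p S S' t → Exec q S' S'' t' → Exec (seq p q) S S'' (t + t')
  | case {k f S S' t} : Exec (f (S k).head?) (Function.update S k (S k).tail) S' t →
      Exec (case k f) S S' (t + 1)
  | loop_nil {k f S} : S k = [] → Exec (loop k f) S S 1
  | loop_cons {k f S S' S'' a l t t'} : S k = a :: l → Exec (f a) (Function.update S k l) S' t →
      Exec (loop k f) S' S'' t' → Exec (loop k f) S S'' (t + t' + 1)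
  -- Each symbol that is passed to or from the machine costs a pop and a push, and each of the two
  -- transfers ends with a pop from an empty stack. Both transfers reverse the string.
  | call {i k k' f g S w t} :
      Nonempty (TM2OutputsInTime (tm i) ((S k).reverse.map f) (some w) t) →
      Exec (call i k k' f g) S
        (Function.update (Function.update S k []) k'
          ((w.map g).reverse ++ Function.update S k [] k'))
        (2 * (S k).length + t + 2 * w.length + 2)

end Prog

/-! ### Correctness of the compilation -/

open Turing

namespace Prog

variable {K ι : Type} {Γ : K → Type} {tm : ι → FinTM2} [DecidableEq K] [DecidableEq ι]

section stepAux

variable {Λ : Type} (s : Reg Γ tm) (S : ∀ k, List (Γ k)) (T : ∀ i, ∀ k, List ((tm i).Γ k))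
  (q : TM2.Stmt (Alph Γ tm) Λ (Reg Γ tm))

theorem stepAux_push_inl (k : K) (f : Reg Γ tm → Γ k) :
    TM2.stepAux (.push (.inl k) f q) s (comb S T) =
      TM2.stepAux q s (comb (Function.update S k (f s :: S k)) T) :=
  congrArg (TM2.stepAux q s) (update_comb_inl S T k _)

theorem stepAux_pop_inl (k : K) (f : Reg Γ tm → Option (Γ k) → Reg Γ tm) :
    TM2.stepAux (.pop (.inl k) f q) s (comb S T) =
      TM2.stepAux q (f s (S k).head?) (comb (Function.update S k (S k).tail) T) :=
  congrArg (TM2.stepAux q (f s (S k).head?)) (update_comb_inl S T k _)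

theorem stepAux_push_inr (i : ι) (k : (tm i).K) (f : Reg Γ tm → (tm i).Γ k) :
    TM2.stepAux (.push (.inr ⟨i, k⟩) f q) s (comb S T) =
      TM2.stepAux q s (comb S (Function.update T i (Function.update (T i) k (f s :: T i k)))) :=
  congrArg (TM2.stepAux q s) (update_comb_inr S T i k _)

theorem stepAux_pop_inr (i : ι) (k : (tm i).K)
    (f : Reg Γ tm → Option ((tm i).Γ k) → Reg Γ tm) :
    TM2.stepAux (.pop (.inr ⟨i, k⟩) f q) s (comb S T) =
      TM2.stepAux q (f s (T i k).head?)
        (comb S (Function.update T i (Function.update (T i) k (T i k).tail))) :=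
  congrArg (TM2.stepAux q (f s (T i k).head?)) (update_comb_inr S T i k _)

theorem stepAux_peek_inr (i : ι) (k : (tm i).K)
    (f : Reg Γ tm → Option ((tm i).Γ k) → Reg Γ tm) :
    TM2.stepAux (.peek (.inr ⟨i, k⟩) f q) s (comb S T) =
      TM2.stepAux q (f s (T i k).head?) (comb S T) :=
  rfl

end stepAux

variable (tm) in
/-- The states of the machines when they are not running. -/
def idle : ∀ i, (tm i).σ := fun i => (tm i).initialState

variable (tm) in
/-- The stacks of the machines when they are not running. -/
def clean : ∀ i, ∀ k, List ((tm i).Γ k) := fun _ _ => []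

/-- A configuration of a machine that is called, as a configuration of the caller. -/
def liftCfg {Λ : Type} (i : ι) (run : (tm i).Λ → Λ) (ret : Λ) (r : ∀ k, Option (Γ k))
    (S : ∀ k, List (Γ k)) (c : TM2.Cfg (tm i).Γ (tm i).Λ (tm i).σ) : TM2.Cfg (Alph Γ tm) Λ (Reg Γ tm) :=
  ⟨some (c.l.elim ret run), (r, Function.update (idle tm) i c.var),
    comb S (Function.update (clean tm) i c.stk)⟩

theorem stepAux_embed {Λ : Type} (i : ι) (run : (tm i).Λ → Λ) (ret : Λ) (r : ∀ k, Option (Γ k))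
    (S : ∀ k, List (Γ k)) (q : TM2.Stmt (tm i).Γ (tm i).Λ (tm i).σ) :
    ∀ (v : (tm i).σ) (T : ∀ k, List ((tm i).Γ k)),
    TM2.stepAux (embed (Γ := Γ) i run ret q) (r, Function.update (idle tm) i v)
        (comb S (Function.update (clean tm) i T)) =
      liftCfg i run ret r S (TM2.stepAux q v T) := by
  induction q with
  | push k f q ih =>
    intro v T
    rw [embed, stepAux_push_inr, TM2.stepAux, ← ih]
    simp only [Function.update_self, Function.update_idem]
  | peek k f q ih =>
    intro v T
    rw [embed, stepAux_peek_inr, TM2.stepAux, ← ih]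
    simp only [Function.update_self, Function.update_idem]
  | pop k f q ih =>
    intro v T
    rw [embed, stepAux_pop_inr, TM2.stepAux, ← ih]
    simp only [Function.update_self, Function.update_idem]
  | load f q ih =>
    intro v T
    rw [embed, TM2.stepAux, TM2.stepAux, ← ih]
    simp only [Function.update_self, Function.update_idem]
  | branch f q₁ q₂ ih₁ ih₂ =>
    intro v T
    rw [embed, TM2.stepAux, TM2.stepAux, ih₁, ih₂]
    simp only [Function.update_self]
    cases f v <;> rfl
  | goto f =>
    intro v T
    simp [embed, TM2.stepAux, liftCfg]
  | halt =>
    intro v T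
    simp [embed, TM2.stepAux, liftCfg]

/-- Since `embed` replaces halting by a jump to `ret`, one step of the called machine is exactly one
step of the caller, and the number of steps is preserved. -/
theorem reachesIn_liftCfg {Λ : Type} {N : Λ → TM2.Stmt (Alph Γ tm) Λ (Reg Γ tm)} {i : ι}
    {run : (tm i).Λ → Λ} {ret : Λ} (hN : ∀ l, N (run l) = embed i run ret ((tm i).m l))
    (r : ∀ k, Option (Γ k)) (S : ∀ k, List (Γ k)) {n : ℕ} :
    ∀ {c c' : (tm i).Cfg}, ReachesIn (tm i).step n c c' →
      ReachesIn (TM2.step N) n (liftCfg i run ret r S c) (liftCfg i run ret r S c') := by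
  induction n with
  | zero =>
    intro c c' h
    cases h
    exact .refl _
  | succ n ih =>
    intro c c' h
    obtain ⟨b, hb, h'⟩ := h.exists_of_succ
    refine .head ?_ (ih h')
    obtain ⟨l, v, T⟩ := c
    cases l with
    | none => cases hb
    | some l =>
      have hb' : TM2.stepAux ((tm i).m l) v T = b := Option.some.inj hb
      rw [← hb', ← stepAux_embed, ← hN]
      rfl

/-- The configuration of a compiled program in which no machine is running. -/
def cfg {Λ : Type} (l : Λ) (r : ∀ k, Option (Γ k)) (S : ∀ k, List (Γ k)) :
    TM2.Cfg (Alph Γ tm) Λ (Reg Γ tm) :=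
  ⟨some l, (r, idle tm), comb S (clean tm)⟩

theorem initList_stk (M : FinTM2) (s : List (M.Γ M.k₀)) :
    initList M s = ⟨some M.main, M.initialState, Function.update (fun _ => []) M.k₀ s⟩ := by
  unfold initList
  congr 1
  funext k
  by_cases h : k = M.k₀
  · subst h
    simp
  · simp [h]

/-- A machine halts in its initial state, with all stacks empty except the output stack. Once the
output has been fetched, it is ready for the next call. -/
theorem haltList_stk (M : FinTM2) (s : List (M.Γ M.k₁)) :
    haltList M s = ⟨none, M.initialState, Function.update (fun _ => []) M.k₁ s⟩ := by
  unfold haltList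
  congr 1
  funext k
  by_cases h : k = M.k₁
  · subst h
    simp
  · simp [h]

omit [DecidableEq K] in
theorem liftCfg_initList {Λ : Type} (i : ι) (run : (tm i).Λ → Λ) (ret : Λ)
    (r : ∀ k, Option (Γ k)) (S : ∀ k, List (Γ k)) (s : List ((tm i).Γ (tm i).k₀)) :
    liftCfg i run ret r S (initList (tm i) s) = ⟨some (run (tm i).main), (r, idle tm),
      comb S (Function.update (clean tm) i (Function.update (clean tm i) (tm i).k₀ s))⟩ := by
  rw [initList_stk]
  unfold liftCfg
  congr 2
  funext j
  by_cases h : j = i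
  · subst h
    simp [idle]
  · simp [h]

omit [DecidableEq K] in
theorem liftCfg_haltList {Λ : Type} (i : ι) (run : (tm i).Λ → Λ) (ret : Λ)
    (r : ∀ k, Option (Γ k)) (S : ∀ k, List (Γ k)) (s : List ((tm i).Γ (tm i).k₁)) :
    liftCfg i run ret r S (haltList (tm i) s) = ⟨some ret, (r, idle tm),
      comb S (Function.update (clean tm) i (Function.update (clean tm i) (tm i).k₁ s))⟩ := by
  rw [haltList_stk]
  unfold liftCfg
  congr 2
  funext j
  by_cases h : j = i
  · subst h
    simp [idle]
  · simp [h]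

theorem update_clean (i : ι) (k : (tm i).K) :
    Function.update (clean tm) i (Function.update (clean tm i) k []) = clean tm := by
  have h : Function.update (clean tm i) k [] = clean tm i := by
    funext l
    by_cases h : l = k
    · subst h
      simp [clean]
    · simp [h]
  rw [h, Function.update_eq_self]

section call

variable {Λ : Type} {N : Λ → TM2.Stmt (Alph Γ tm) Λ (Reg Γ tm)} {i : ι} {k k' : K}
  {f : Γ k → (tm i).Γ (tm i).k₀} {g : (tm i).Γ (tm i).k₁ → Γ k'}
  {emb : Lab (call i k k' f g) → Λ} {exit : Λ}

theorem reachesIn_feed (hN : ∀ l, N (emb l) = code (call i k k' f g) emb exit l)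
    (s : List (Γ k)) : ∀ (r : ∀ k, Option (Γ k)) (S : ∀ k, List (Γ k))
    (w : List ((tm i).Γ (tm i).k₀)), S k = s → ∃ r',
    ReachesIn (TM2.step N) (2 * s.length + 1)
      ⟨some (emb (.inl none)), (r, idle tm),
        comb S (Function.update (clean tm) i (Function.update (clean tm i) (tm i).k₀ w))⟩
      ⟨some (emb (.inr (.inl (tm i).main))), (r', idle tm),
        comb (Function.update S k []) (Function.update (clean tm) i
          (Function.update (clean tm i) (tm i).k₀ (s.reverse.map f ++ w)))⟩ := by
  induction s with
  | nil =>
    intro r S w hS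
    refine ⟨Function.update r k none, .head ?_ (.refl _)⟩
    rw [TM2.step, hN, code, stepAux_pop_inl, TM2.stepAux]
    simp [hS]
  | cons a s ih =>
    intro r S w hS
    obtain ⟨r', h⟩ := ih (Function.update r k (some a)) (Function.update S k s) (f a :: w)
      (by simp)
    refine ⟨r', .head (b := ⟨some (emb (.inl (some a))), (Function.update r k (some a), idle tm),
        comb (Function.update S k s) (Function.update (clean tm) i
          (Function.update (clean tm i) (tm i).k₀ w))⟩) ?_ (.head (b := ⟨some (emb (.inl none)),
        (Function.update r k (some a), idle tm), comb (Function.update S k s)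
        (Function.update (clean tm) i (Function.update (clean tm i) (tm i).k₀ (f a :: w)))⟩)
        ?_ ?_)⟩
    · rw [TM2.step, hN, code, stepAux_pop_inl, TM2.stepAux]
      simp [hS]
    · rw [TM2.step, hN, code, stepAux_push_inr, TM2.stepAux]
      simp
    · simpa using h

theorem reachesIn_fetch (hN : ∀ l, N (emb l) = code (call i k k' f g) emb exit l)
    (w : List ((tm i).Γ (tm i).k₁)) : ∀ (r : ∀ k, Option (Γ k)) (S : ∀ k, List (Γ k)), ∃ r',
    ReachesIn (TM2.step N) (2 * w.length + 1)
      ⟨some (emb (.inr (.inr none))), (r, idle tm),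
        comb S (Function.update (clean tm) i (Function.update (clean tm i) (tm i).k₁ w))⟩
      (cfg exit r' (Function.update S k' ((w.map g).reverse ++ S k'))) := by
  induction w with
  | nil =>
    intro r S
    refine ⟨Function.update r k' none, .head ?_ (.refl _)⟩
    rw [TM2.step, hN, code, stepAux_pop_inr, TM2.stepAux]
    simp [cfg, update_clean]
  | cons b w ih =>
    intro r S
    obtain ⟨r', h⟩ := ih (Function.update r k' (some (g b)))
      (Function.update S k' (g b :: S k'))
    refine ⟨r', .head (b := ⟨some (emb (.inr (.inr (some (g b))))),
        (Function.update r k' (some (g b)), idle tm), comb S (Function.update (clean tm) i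
          (Function.update (clean tm i) (tm i).k₁ w))⟩) ?_ (.head (b :=
        ⟨some (emb (.inr (.inr none))), (Function.update r k' (some (g b)), idle tm),
        comb (Function.update S k' (g b :: S k')) (Function.update (clean tm) i
          (Function.update (clean tm i) (tm i).k₁ w))⟩) ?_ ?_)⟩
    · rw [TM2.step, hN, code, stepAux_pop_inr, TM2.stepAux]
      simp
    · rw [TM2.step, hN, code, stepAux_push_inl, TM2.stepAux]
    · simpa using h

end call

/-- The ambient machine `N` and the embedding of labels are arbitrary, so that the induction
hypothesis applies to subprograms inside a larger program. The final registers `r'` are left open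
because a popped symbol is used only right after its pop. The number of steps is only bounded by
`t`, because for calls only a bound on the running time is known. -/
theorem reachesIn_code {p : Prog Γ tm} {S S' : ∀ k, List (Γ k)} {t : ℕ} (h : Exec p S S' t) :
    ∀ {Λ : Type} {N : Λ → TM2.Stmt (Alph Γ tm) Λ (Reg Γ tm)} {emb : Lab p → Λ} {exit : Λ},
    (∀ l, N (emb l) = code p emb exit l) → ∀ r, ∃ r', ∃ n ≤ t,
      ReachesIn (TM2.step N) n (cfg (emb (entry p)) r S) (cfg exit r' S') := by
  induction h with
  | nop S =>
    intro Λ N emb exit hN r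
    refine ⟨r, 1, le_rfl, .head ?_ (.refl _)⟩
    rw [cfg, TM2.step, hN]
    rfl
  | push S k a =>
    intro Λ N emb exit hN r
    refine ⟨r, 1, le_rfl, .head ?_ (.refl _)⟩
    rw [cfg, TM2.step, hN, cfg, code, stepAux_push_inl, TM2.stepAux]
  | seq _ _ ih₁ ih₂ =>
    intro Λ N emb exit hN r
    obtain ⟨r₁, n₁, hn₁, h₁⟩ := ih₁ (fun l => hN (.inl l)) r
    obtain ⟨r₂, n₂, hn₂, h₂⟩ := ih₂ (fun l => hN (.inr l)) r₁
    exact ⟨r₂, n₁ + n₂, by omega, h₁.trans h₂⟩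
  | @case k f S S' t _ ih =>
    intro Λ N emb exit hN r
    obtain ⟨r', n, hn, h⟩ := ih (fun l => hN (some ⟨_, l⟩)) (Function.update r k (S k).head?)
    refine ⟨r', n + 1, by omega, .head ?_ h⟩
    rw [cfg, TM2.step, entry, hN, cfg, code, stepAux_pop_inl, TM2.stepAux]
    simp only
    rw [show Function.update r k (S k).head? k = (S k).head? from Function.update_self ..]
  | @loop_nil k f S hS =>
    intro Λ N emb exit hN r
    refine ⟨Function.update r k none, 1, le_rfl, .head ?_ (.refl _)⟩
    rw [cfg, TM2.step, entry, hN, cfg, code, stepAux_pop_inl, TM2.stepAux]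
    have : Function.update S k [] = S := by rw [← hS, Function.update_eq_self]
    simp [hS, this]
  | @loop_cons k f S S' S'' a l t t' hS _ _ ih₁ ih₂ =>
    intro Λ N emb exit hN r
    obtain ⟨r₁, n₁, hn₁, h₁⟩ := ih₁ (fun l => hN (some ⟨_, l⟩)) (Function.update r k (some a))
    obtain ⟨r₂, n₂, hn₂, h₂⟩ := ih₂ hN r₁
    refine ⟨r₂, n₁ + n₂ + 1, by omega, .head ?_ (h₁.trans h₂)⟩
    rw [cfg, TM2.step, entry, hN, cfg, code, stepAux_pop_inl, TM2.stepAux]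
    simp [hS]
  | @call i k k' f g S w t h =>
    intro Λ N emb exit hN r
    obtain ⟨⟨⟨n, hn⟩, hnt⟩⟩ := h
    obtain ⟨r₁, h₁⟩ := reachesIn_feed hN (S k) r S [] rfl
    obtain ⟨r₂, h₂⟩ := reachesIn_fetch hN w r₁ (Function.update S k [])
    have h' := reachesIn_liftCfg (N := N) (i := i) (run := fun l => emb (.inr (.inl l)))
      (ret := emb (.inr (.inr none))) (fun l => hN (.inr (.inl l))) r₁ (Function.update S k []) hn
    rw [liftCfg_initList, liftCfg_haltList] at h'
    rw [update_clean, List.append_nil] at h₁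
    exact ⟨r₂, _, by simp only at hnt; omega, (h₁.trans h').trans h₂⟩

variable [Fintype K] [Fintype ι] [∀ k, Fintype (Γ k)]

/-- The machine that executes a program, with given input and output stacks. -/
noncomputable def machine (p : Prog Γ tm) (k₀ k₁ : K) : FinTM2 :=
  have : ∀ i, Fintype (tm i).K := fun i => (tm i).kFin
  have : ∀ i, Fintype (tm i).σ := fun i => (tm i).σFin
  { K := K ⊕ (Σ i, (tm i).K)
    k₀ := .inl k₀
    k₁ := .inl k₁
    Γ := Alph Γ tm
    Λ := Option (Lab p)
    main := some (entry p)
    σ := Reg Γ tm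
    initialState := (fun _ => none, idle tm)
    Γk₀Fin := inferInstanceAs (Fintype (Γ k₀))
    m := fun l => match l with
      | some l => code p some none l
      -- The required halting configuration has the initial state, so the registers are reset before
      -- the machine halts.
      | none => .load (fun _ => (fun _ => none, idle tm)) .halt }

omit [DecidableEq ι] [Fintype K] [Fintype ι] [∀ k, Fintype (Γ k)] in
theorem comb_clean_update [DecidableEq ι] (k : K) (s : List (Γ k)) :
    comb (Function.update (fun _ => []) k s) (clean tm) =
      Function.update (β := fun x => List (Alph Γ tm x)) (fun _ => []) (.inl k) s := by
  rw [← update_comb_inl]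
  congr 1
  funext x
  rcases x with j | j <;> rfl

/-- A function is computable in polynomial time if a program computes it in polynomial time. -/
theorem polyTime (p : Prog Γ tm) (k₀ k₁ : K) {α β : Type} {ea : α → List (Γ k₀)}
    {eb : β → List (Γ k₁)} {f : α → β} (T : Polynomial ℕ)
    (h : ∀ a, ∃ t ≤ T.eval (ea a).length, Exec p (Function.update (fun _ => []) k₀ (ea a))
      (Function.update (fun _ => []) k₁ (eb (f a))) t) : PolyTime ea eb f := by
  -- The additional step is the one at the label `none`, which resets the registers and halts.
  refine ⟨⟨⟨machine p k₀ k₁, Equiv.refl _, Equiv.refl _⟩, T + 1, fun a => ?_⟩⟩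
  apply Classical.choice
  obtain ⟨t, ht, hp⟩ := h a
  obtain ⟨r, n, hn, hr⟩ := reachesIn_code hp (N := (machine p k₀ k₁).m) (emb := some)
    (exit := none) (fun _ => rfl) fun _ => none
  have hr' := hr.trans (.head (f := TM2.step (machine p k₀ k₁).m) rfl (.refl _))
  have h₀ : initList (machine p k₀ k₁) ((ea a).map (Equiv.refl _).invFun) =
      cfg (some (entry p)) (fun _ => none) (Function.update (fun _ => []) k₀ (ea a)) := by
    refine (congrArg (initList (machine p k₀ k₁)) (List.map_id _)).trans ((initList_stk _ _).trans ?_)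
    rw [cfg, comb_clean_update]
    rfl
  have h₁ : haltList (machine p k₀ k₁) ((eb (f a)).map (Equiv.refl _).invFun) =
      ⟨none, (fun _ => none, idle tm),
        comb (Function.update (fun _ => []) k₁ (eb (f a))) (clean tm)⟩ := by
    refine (congrArg (haltList (machine p k₀ k₁)) (List.map_id _)).trans ((haltList_stk _ _).trans ?_)
    rw [comb_clean_update]
    rfl
  refine ⟨⟨⟨n + 1, ?_⟩, by simp; omega⟩⟩
  refine Eq.trans (congrArg _ (congrArg _ h₀)) (Eq.trans (show _ = _ from hr') ?_)
  exact congrArg some h₁.symm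

end Prog

open Turing

/-! ### Polynomial bounds and output lengths -/

theorem Polynomial.eval_nat_mono (p : Polynomial ℕ) {m n : ℕ} (h : m ≤ n) :
    p.eval m ≤ p.eval n := by
  induction p using Polynomial.induction_on' with
  | add p q hp hq => simpa using Nat.add_le_add hp hq
  | monomial k a => simpa using Nat.mul_le_mul_left a (Nat.pow_le_pow_left h k)

/-- The function `b` is bounded by a polynomial. -/
def PolyBdd (b : ℕ → ℕ) : Prop := ∃ p : Polynomial ℕ, ∀ n, b n ≤ p.eval n

namespace PolyBdd

variable {a b : ℕ → ℕ}

theorem const (c : ℕ) : PolyBdd fun _ => c := ⟨Polynomial.C c, fun n => by simp⟩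

theorem id : PolyBdd fun n => n := ⟨Polynomial.X, fun n => by simp⟩

theorem add : PolyBdd a → PolyBdd b → PolyBdd fun n => a n + b n :=
  fun ⟨p, hp⟩ ⟨q, hq⟩ => ⟨p + q, fun n => by simpa using Nat.add_le_add (hp n) (hq n)⟩

theorem mul : PolyBdd a → PolyBdd b → PolyBdd fun n => a n * b n :=
  fun ⟨p, hp⟩ ⟨q, hq⟩ => ⟨p * q, fun n => by simpa using Nat.mul_le_mul (hp n) (hq n)⟩

theorem eval (p : Polynomial ℕ) : PolyBdd b → PolyBdd fun n => p.eval (b n) :=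
  fun ⟨q, hq⟩ => ⟨p.comp q, fun n => by simpa using p.eval_nat_mono (hq n)⟩

end PolyBdd

/-! ### Growth of the stacks during a computation -/

namespace Turing.TM2

variable {K : Type} [DecidableEq K] {Γ : K → Type} {Λ σ : Type}

/-- The number of symbols that a statement can push. -/
def Stmt.pushes : Stmt Γ Λ σ → ℕ
  | .push _ _ q => q.pushes + 1
  | .peek _ _ q => q.pushes
  | .pop _ _ q => q.pushes
  | .load _ q => q.pushes
  | .branch _ q₁ q₂ => q₁.pushes + q₂.pushes
  | .goto _ => 0
  | .halt => 0

theorem length_stepAux_le (k : K) (q : Stmt Γ Λ σ) : ∀ (v : σ) (S : ∀ k, List (Γ k)),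
    ((stepAux q v S).stk k).length ≤ (S k).length + q.pushes := by
  induction q with
  | push j f q ih =>
    intro v S
    rw [stepAux, Stmt.pushes]
    refine (ih _ _).trans ?_
    by_cases h : k = j
    · subst h
      simp
      omega
    · simp [h]
  | peek j f q ih => intro v S; exact ih _ _
  | pop j f q ih =>
    intro v S
    rw [stepAux, Stmt.pushes]
    refine (ih _ _).trans ?_
    by_cases h : k = j
    · subst h
      simp
    · simp [h]
  | load f q ih => intro v S; exact ih _ _
  | branch f q₁ q₂ ih₁ ih₂ =>
    intro v S
    rw [stepAux, Stmt.pushes]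
    have h₁ := ih₁ v S
    have h₂ := ih₂ v S
    cases f v
    · simp only [cond_false]
      omega
    · simp only [cond_true]
      omega
  | goto f => intro v S; exact Nat.le_add_right _ _
  | halt => intro v S; exact Nat.le_add_right _ _

theorem length_stk_le_of_reachesIn {N : Λ → Stmt Γ Λ σ} {c : ℕ} (hc : ∀ l, (N l).pushes ≤ c)
    (k : K) {n : ℕ} : ∀ {x y : Cfg Γ Λ σ}, ReachesIn (step N) n x y →
    (y.stk k).length ≤ (x.stk k).length + n * c := by
  induction n with
  | zero =>
    intro x y h
    cases h
    omega
  | succ n ih =>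
    intro x y h
    obtain ⟨z, hz, h'⟩ := h.exists_of_succ
    refine (ih h').trans ?_
    obtain ⟨l, v, S⟩ := x
    cases l with
    | none => cases hz
    | some l =>
      have hz' : stepAux (N l) v S = z := Option.some.inj hz
      rw [← hz']
      have := length_stepAux_le k (N l) v S
      have := hc l
      simp only [Nat.succ_mul]
      omega

end Turing.TM2

/-- The machine `M`, with inputs and outputs translated by `i` and `o`, computes `f`. The
polynomial `T` bounds the time and the length of the output. -/
def Turing.FinTM2.Computes (M : FinTM2) {Γ₀ Γ₁ α β : Type} (i : Γ₀ → M.Γ M.k₀)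
    (o : M.Γ M.k₁ → Γ₁) (ea : α → List Γ₀) (eb : β → List Γ₁) (f : α → β)
    (T : Polynomial ℕ) : Prop :=
  ∀ a, (∃ w, w.map o = eb (f a) ∧
    Nonempty (TM2OutputsInTime M ((ea a).map i) (some w) (T.eval (ea a).length))) ∧
    (eb (f a)).length ≤ T.eval (ea a).length

/-- Every statement pushes at most `c` symbols, so the output is no longer than the input plus `c`
times the running time. The bound on the output is what controls the time of a machine that is run
on it. -/
theorem PolyTime.exists_computes {α β Γ₀ Γ₁ : Type} {ea : α → List Γ₀} {eb : β → List Γ₁}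
    {f : α → β} (h : PolyTime ea eb f) :
    ∃ (M : FinTM2) (i : Γ₀ → M.Γ M.k₀) (o : M.Γ M.k₁ → Γ₁) (T : Polynomial ℕ),
      M.Computes i o ea eb f T := by
  obtain ⟨⟨⟨M, i, o⟩, T, hT⟩⟩ := h
  have := M.ΛFin
  let c : ℕ := Finset.univ.sup fun l => (M.m l).pushes
  have hc : ∀ l, (M.m l).pushes ≤ c := fun l =>
    Finset.le_sup (f := fun l => (M.m l).pushes) (Finset.mem_univ l)
  refine ⟨M, i.invFun, o, T + (Polynomial.X + T * Polynomial.C c), fun a => ⟨⟨(eb (f a)).map o.invFun, ?_, ?_⟩, ?_⟩⟩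
  · simp
  · obtain ⟨⟨n, hn⟩, hm⟩ := hT a
    exact ⟨⟨n, hn⟩, hm.trans (by simp)⟩
  · obtain ⟨⟨n, hn⟩, hm⟩ := hT a
    have h := TM2.length_stk_le_of_reachesIn (N := M.m) hc M.k₁ hn
    rw [Prog.initList_stk, Prog.haltList_stk] at h
    simp only [Function.update_self, List.length_map] at h
    have h' : (Function.update (fun _ => []) M.k₀ ((ea a).map i.invFun) M.k₁ :
        List (M.Γ M.k₁)).length ≤ (ea a).length := by
      by_cases e : M.k₁ = M.k₀
      -- The alphabet of a stack depends on its name, so the equation of the two names is used for a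
      -- variable `k`.
      · have : ∀ (k : M.K), k = M.k₀ → (Function.update (fun _ => []) M.k₀
          ((ea a).map i.invFun) k : List (M.Γ k)).length ≤ (ea a).length := by
          rintro k rfl
          simp
        exact this _ e
      · simp [e]
    have hm' := Nat.mul_le_mul_right c hm
    simp only at hm hm'
    simp
    omega

/-! ### Programs with five stacks and three callable machines -/

/-- The names of five stacks. -/
inductive Five : Type
  | x | y | z | u | v
  deriving DecidableEq

instance : Fintype Five := ⟨{.x, .y, .z, .u, .v}, fun k => by cases k <;> decide⟩

/-- The names of three machines. -/
inductive Three : Type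
  | a | b | c
  deriving DecidableEq

instance : Fintype Three := ⟨{.a, .b, .c}, fun k => by cases k <;> decide⟩

/-- A family of three machines. -/
@[reducible] def Three.fam (A B C : FinTM2) : Three → FinTM2
  | .a => A
  | .b => B
  | .c => C

namespace Five

variable {A B C D E : Type}

/-- A family of five alphabets. -/
@[reducible] def fam (A B C D E : Type) : Five → Type
  | .x => A
  | .y => B
  | .z => C
  | .u => D
  | .v => E

instance [Fintype A] [Fintype B] [Fintype C] [Fintype D] [Fintype E] :
    ∀ k, Fintype (fam A B C D E k)
  | .x => inferInstanceAs (Fintype A)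
  | .y => inferInstanceAs (Fintype B)
  | .z => inferInstanceAs (Fintype C)
  | .u => inferInstanceAs (Fintype D)
  | .v => inferInstanceAs (Fintype E)

/-- A store with the given stacks. -/
def store (x : List A) (y : List B) (z : List C) (u : List D) (v : List E) :
    ∀ k, List (fam A B C D E k)
  | .x => x
  | .y => y
  | .z => z
  | .u => u
  | .v => v

variable (x l : List A) (y l' : List B) (z l'' : List C) (u m : List D) (v m' : List E)

@[simp] theorem store_x : store x y z u v .x = x := rfl
@[simp] theorem store_y : store x y z u v .y = y := rfl
@[simp] theorem store_z : store x y z u v .z = z := rfl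
@[simp] theorem store_u : store x y z u v .u = u := rfl
@[simp] theorem store_v : store x y z u v .v = v := rfl

@[simp] theorem update_x : Function.update (store x y z u v) .x l = store l y z u v := by
  funext k; cases k <;> rfl
@[simp] theorem update_y : Function.update (store x y z u v) .y l' = store x l' z u v := by
  funext k; cases k <;> rfl
@[simp] theorem update_z : Function.update (store x y z u v) .z l'' = store x y l'' u v := by
  funext k; cases k <;> rfl
@[simp] theorem update_u : Function.update (store x y z u v) .u m = store x y z m v := by
  funext k; cases k <;> rfl
@[simp] theorem update_v : Function.update (store x y z u v) .v m' = store x y z u m' := by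
  funext k; cases k <;> rfl

theorem store_nil : (fun _ => [] : ∀ k, List (fam A B C D E k)) = store [] [] [] [] [] := by
  funext k; cases k <;> rfl

end Five

/-! ### Running times of programs -/

namespace Prog

variable {K ι : Type} {Γ : K → Type} {tm : ι → FinTM2} [DecidableEq K]

/-- The program turns `S` into `S'` within time `t`. -/
def Runs (p : Prog Γ tm) (S S' : ∀ k, List (Γ k)) (t : ℕ) : Prop := ∃ t' ≤ t, Exec p S S' t'

namespace Runs

variable {p q : Prog Γ tm} {S S' S'' : ∀ k, List (Γ k)} {t t' : ℕ}

theorem mono (h : Runs p S S' t) (ht : t ≤ t') : Runs p S S' t' :=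
  h.imp fun _ h => ⟨h.1.trans ht, h.2⟩

theorem nop (S : ∀ k, List (Γ k)) : Runs (nop : Prog Γ tm) S S 1 := ⟨1, le_rfl, .nop S⟩

theorem push (k : K) (a : Γ k) (h : Function.update S k (a :: S k) = S') :
    Runs (push k a : Prog Γ tm) S S' 1 := ⟨1, le_rfl, h ▸ .push S k a⟩

theorem push₂ (k k' : K) (a : Γ k) (b : Γ k') (h : Function.update (Function.update S k (a :: S k)) k'
      (b :: Function.update S k (a :: S k) k') = S') :
    Runs (.seq (.push k a) (.push k' b) : Prog Γ tm) S S' 2 :=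
  ⟨2, le_rfl, h ▸ .seq (.push S k a) (.push _ k' b)⟩

theorem seq (h : Runs p S S' t) (h' : Runs q S' S'' t') : Runs (seq p q) S S'' (t + t') := by
  obtain ⟨m, hm, e⟩ := h
  obtain ⟨m', hm', e'⟩ := h'
  exact ⟨m + m', by omega, .seq e e'⟩

theorem case {k : K} {f : Option (Γ k) → Prog Γ tm} (o : Option (Γ k)) (ho : (S k).head? = o)
    (h : Runs (f o) (Function.update S k (S k).tail) S' t) : Runs (case k f) S S' (t + 1) := by
  subst ho
  obtain ⟨m, hm, e⟩ := h
  exact ⟨m + 1, by omega, .case e⟩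

theorem case_nil {k : K} {f : Γ k → Prog Γ tm} (hS : S k = []) (h : Runs p S S' t) :
    Runs (Prog.case k fun o => o.elim p f) S S' (t + 1) := by
  refine case none (by simp [hS]) ?_
  have : Function.update S k (S k).tail = S := by
    rw [hS, List.tail_nil, ← hS, Function.update_eq_self]
  rwa [this]

theorem case_cons {k : K} {f : Γ k → Prog Γ tm} (a : Γ k) (l : List (Γ k)) (hS : S k = a :: l)
    (h : Runs (f a) (Function.update S k l) S' t) :
    Runs (Prog.case k fun o => o.elim p f) S S' (t + 1) :=
  case (some a) (by simp [hS]) (by simpa [hS] using h)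

theorem loop_nil {k : K} {f : Γ k → Prog Γ tm} (h : S k = []) : Runs (Prog.loop k f) S S 1 :=
  ⟨1, le_rfl, .loop_nil h⟩

theorem loop_cons {k : K} {f : Γ k → Prog Γ tm} (a : Γ k) (l : List (Γ k)) (hS : S k = a :: l)
    (h : Runs (f a) (Function.update S k l) S' t) (h' : Runs (Prog.loop k f) S' S'' t') :
    Runs (Prog.loop k f) S S'' (t + t' + 1) := by
  obtain ⟨m, hm, e⟩ := h
  obtain ⟨m', hm', e'⟩ := h'
  exact ⟨m + m' + 1, by omega, .loop_cons hS e e'⟩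

/-- Here `I d l` is the store when the symbols `d` have been popped, the last one first, and the
symbols `l` remain. -/
theorem loop {k : K} {f : Γ k → Prog Γ tm} {c : ℕ} (s : List (Γ k))
    (I : List (Γ k) → List (Γ k) → ∀ k, List (Γ k)) (hI : ∀ d l, I d l k = l)
    (h : ∀ d a l, d.reverse ++ a :: l = s →
      Runs (f a) (Function.update (I d (a :: l)) k l) (I (a :: d) l) c)
    (h₀ : I [] s = S) (h₁ : I s.reverse [] = S') :
    Runs (loop k f) S S' (s.length * (c + 1) + 1) := by
  subst h₀ h₁
  suffices H : ∀ l d, d.reverse ++ l = s →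
      Runs (Prog.loop k f) (I d l) (I s.reverse []) (l.length * (c + 1) + 1) from H s [] rfl
  intro l
  induction l with
  | nil =>
    intro d hd
    have : s.reverse = d := by rw [← hd]; simp
    rw [this]
    exact ⟨1, by simp, .loop_nil (hI _ _)⟩
  | cons a l ih =>
    intro d hd
    obtain ⟨m, hm, e⟩ := h d a l hd
    obtain ⟨m', hm', e'⟩ := ih (a :: d) (by simpa using hd)
    exact ⟨m + m' + 1, by simp [Nat.succ_mul]; omega, .loop_cons (hI _ _) e e'⟩

/-- The input has to lie reversed on its stack, since feeding it to the machine reverses it, and the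
output arrives reversed. Of the summand `3 * T`, one part is the run of the machine and two parts
are the transfer of an output of length at most `T`. -/
theorem call {i : ι} {k k' : K} {f : Γ k → (tm i).Γ (tm i).k₀} {g : (tm i).Γ (tm i).k₁ → Γ k'}
    {α β : Type} {ea : α → List (Γ k)} {eb : β → List (Γ k')} {F : α → β} {T : Polynomial ℕ}
    (hM : (tm i).Computes f g ea eb F T) (a : α) (hS : S k = (ea a).reverse)
    (hS' : Function.update (Function.update S k []) k'
      ((eb (F a)).reverse ++ Function.update S k [] k') = S') :
    Runs (call i k k' f g) S S'
      (2 * (ea a).length + 3 * T.eval (ea a).length + 2) := by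
  subst hS'
  obtain ⟨⟨w, hw, h⟩, hl⟩ := hM a
  have e := Exec.call (i := i) (k := k) (k' := k') (f := f) (g := g) (S := S) (w := w)
    (t := T.eval (ea a).length) (by rwa [hS, List.reverse_reverse])
  rw [hw] at e
  refine ⟨_, ?_, e⟩
  have : w.length = (eb (F a)).length := by rw [← hw, List.length_map]
  rw [hS, List.length_reverse, this]
  omega

/-- Moving a stack onto another one reverses it. -/
theorem move {k k' : K} (f : Γ k → Γ k') (hk : k' ≠ k)
    (h : Function.update (Function.update S k []) k' (((S k).reverse.map f) ++ S k') = S') :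
    Runs (.loop k fun a => .push k' (f a) : Prog Γ tm) S S' ((S k).length * 2 + 1) := by
  refine loop (S k) (fun d l => Function.update (Function.update S k l) k' (d.map f ++ S k'))
    (fun d l => by simp [hk.symm]) (fun d a l _ => push _ _ ?_) ?_ h
  · rw [Function.update_comm hk, Function.update_idem, Function.update_self,
      Function.update_idem, List.map_cons, List.cons_append]
  · simp

end Runs

/-- Push the symbols of a list one after the other. -/
def pushAll (k : K) : List (Γ k) → Prog Γ tm
  | [] => nop
  | a :: l => seq (push k a) (pushAll k l)

theorem Runs.pushAll {k : K} (l : List (Γ k)) : ∀ {S S' : ∀ k, List (Γ k)},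
    Function.update S k (l.reverse ++ S k) = S' →
    Runs (pushAll k l : Prog Γ tm) S S' (l.length + 1) := by
  induction l with
  | nil =>
    intro S S' h
    have : S = S' := by simpa using h
    exact this ▸ Runs.nop S
  | cons a l ih =>
    intro S S' h
    refine (Runs.seq (Runs.push k a rfl) (ih ?_)).mono (by simp; omega)
    simpa using h

/-- A program with five stacks whose running time is polynomial. -/
theorem polyTime_five {A B C D E : Type} [Fintype A] [Fintype B] [Fintype C] [Fintype D]
    [Fintype E] {M : Three → FinTM2} (p : Prog (Five.fam A B C D E) M)
    {α β : Type} {ea : α → List A} {eb : β → List E} {f : α → β} {b : ℕ → ℕ} (hb : PolyBdd b)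
    (h : ∀ a, Runs p (Five.store (ea a) [] [] [] []) (Five.store [] [] [] [] (eb (f a)))
      (b (ea a).length)) : PolyTime ea eb f := by
  obtain ⟨T, hT⟩ := hb
  refine polyTime p .x .v T fun a => ?_
  obtain ⟨t, ht, e⟩ := h a
  refine ⟨t, ht.trans (hT _), ?_⟩
  rw [Five.store_nil]
  simpa using e

end Prog

open Turing

/-! ### Closure properties of polynomial time -/

namespace Prog.Runs

open Five

variable {ι A B C D E : Type} {tm : ι → FinTM2}

/-- Both copies come out reversed, which is the form in which a call expects its input. -/
theorem duplicate (s : List A) :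
    Runs (.loop .x fun a => .seq (.push .y a) (.push .z a) : Prog (fam A A A D E) tm)
      (store s [] [] [] []) (store [] s.reverse s.reverse [] []) (s.length * 3 + 1) :=
  loop (k := .x) s (fun d l => store l d d [] []) (fun _ _ => rfl)
    (fun _ _ _ _ => push₂ _ _ _ _ (by simp)) rfl rfl

theorem discard (s : List A) :
    Runs (.loop .x fun _ => .nop : Prog (fam A B C D E) tm)
      (store s [] [] [] []) (store [] [] [] [] []) (s.length * 2 + 1) :=
  loop (k := .x) s (fun _ l => store l [] [] [] []) (fun _ _ => rfl)
    (fun _ _ _ _ => by simpa using nop _) rfl rfl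

end Prog.Runs

namespace PolyTime

open Prog Five

variable {α β γ δ Γ₀ Γ₁ Γ₂ : Type} [Fintype Γ₀] [Fintype Γ₁] [Fintype Γ₂]
  {ea : α → List Γ₀} {eb : β → List Γ₁} {ec : γ → List Γ₂}

-- `PolyTime` only concerns the strings that encode arguments and values. A change of representation
-- can therefore be stated as polynomial time of the identity map with two different encodings.
omit [Fintype Γ₀] [Fintype Γ₁] in
theorem reindex {α' β' : Type} {ea' : α' → List Γ₀} {eb' : β' → List Γ₁} {f : α → β} {f' : α' → β'}
    (h : PolyTime ea eb f) (i : α' → α) (hea : ∀ x, ea (i x) = ea' x)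
    (heb : ∀ x, eb (f (i x)) = eb' (f' x)) : PolyTime ea' eb' f' := by
  obtain ⟨⟨M, T, hT⟩⟩ := h
  refine ⟨⟨M, T, fun x => ?_⟩⟩
  rw [← hea, ← heb]
  exact hT (i x)

/-- The second machine runs on a string of length at most `T.eval n`, so its time is at most
`T'.eval (T.eval n)`. -/
theorem comp {f : α → β} {g : β → γ} (hg : PolyTime eb ec g) (hf : PolyTime ea eb f) :
    PolyTime ea ec (fun a => g (f a)) := by
  obtain ⟨M, i, o, T, hM⟩ := hf.exists_computes
  obtain ⟨M', i', o', T', hM'⟩ := hg.exists_computes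
  refine polyTime_five (A := Γ₀) (B := Γ₀) (C := Γ₁) (D := Γ₂) (E := Γ₂) (M := Three.fam M M' M)
    (b := fun n => n * 2 + 1 + (2 * n + 3 * T.eval n + 2) +
      (2 * T.eval n + 3 * T'.eval (T.eval n) + 2) + (T'.eval (T.eval n) * 2 + 1))
    (seq (seq (seq
      (loop .x fun a => push .y a)
      (call .a .y .z i o))
      (call .b .z .u i' o'))
      (loop .u fun a => push .v a)) ?_ fun a => ?_
  · repeat' first
      | exact PolyBdd.id | exact PolyBdd.const _ | apply PolyBdd.eval | apply PolyBdd.add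
      | apply PolyBdd.mul
  have h₁ := (hM a).2
  have h₂ := T'.eval_nat_mono h₁
  have h₃ := (hM' (f a)).2
  refine (((Runs.move (S' := store [] (ea a).reverse [] [] []) _ (by simp) (by simp)).seq
    (Runs.call (S' := store [] [] (eb (f a)).reverse [] []) hM a (by simp) (by simp))).seq
    (Runs.call (S' := store [] [] [] (ec (g (f a))).reverse []) hM' (f a) (by simp) (by simp))).seq
    (Runs.move _ (by simp) (by simp)) |>.mono ?_
  simp
  omega

/-- A pair of bit strings as a bit string. -/
def _root_.joinBits (s t : List Bool) : List Bool := s.flatMap (fun b => [true, b]) ++ false :: t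

/-- The output stack is filled from its bottom: first the second component, then the separator
`false`, then the bits of the first component in reverse order, each covered by a marker `true`. -/
theorem join {ea : α → List Γ₀} {eb : β → List Bool} {ec : γ → List Bool} {f : α → β} {g : α → γ}
    (hf : PolyTime ea eb f) (hg : PolyTime ea ec g) :
    PolyTime ea (fun p : β × γ => joinBits (eb p.1) (ec p.2)) (fun a => (f a, g a)) := by
  obtain ⟨M, i, o, T, hM⟩ := hf.exists_computes
  obtain ⟨M', i', o', T', hM'⟩ := hg.exists_computes
  refine polyTime_five (A := Γ₀) (B := Γ₀) (C := Γ₀) (D := Bool) (E := Bool)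
    (M := Three.fam M M' M)
    (b := fun n => (n * 3 + 1) + (2 * n + 3 * T'.eval n + 2) + (T'.eval n * 2 + 1) + 1 +
      (2 * n + 3 * T.eval n + 2) + (T.eval n * 3 + 1))
    (seq (seq (seq (seq (seq
      (loop .x fun a => seq (push .y a) (push .z a))
      (call .b .z .u i' o'))
      (loop .u fun a => push .v a))
      (push .v false))
      (call .a .y .u i o))
      (loop .u fun a => seq (push .v a) (push .v true))) ?_ fun a => ?_
  · repeat' first
      | exact PolyBdd.id | exact PolyBdd.const _ | apply PolyBdd.eval | apply PolyBdd.add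
      | apply PolyBdd.mul
  have h₁ := (hM a).2
  have h₃ := (hM' a).2
  have r₁ := Runs.duplicate (tm := Three.fam M M' M) (D := Bool) (E := Bool) (ea a)
  have r₂ := Runs.loop (tm := Three.fam M M' M)
    (f := fun a => (.seq (.push .v a) (.push .v true) : Prog (fam Γ₀ Γ₀ Γ₀ Bool Bool) _))
    (k := .u) (S := store [] [] [] (eb (f a)).reverse (false :: ec (g a)))
    (S' := store [] [] [] [] (joinBits (eb (f a)) (ec (g a))))
    (eb (f a)).reverse (fun d l => store [] [] [] l (joinBits d (ec (g a))))
    (fun _ _ => rfl) (fun d b l _ => Runs.push₂ _ _ _ _ (by simp [joinBits])) rfl (by simp)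
  refine (((((r₁.seq
    (Runs.call (S' := store [] (ea a).reverse [] (ec (g a)).reverse []) hM' a
      (by simp) (by simp))).seq
    (Runs.move (S' := store [] (ea a).reverse [] [] (ec (g a))) _ (by simp) (by simp))).seq
    (Runs.push _ _ rfl)).seq
    (Runs.call (S' := store [] [] [] (eb (f a)).reverse (false :: ec (g a))) hM a
      (by simp) (by simp))).seq r₂).mono ?_
  simp
  omega

theorem const (c : β) : PolyTime ea eb (fun _ => c) := by
  refine polyTime_five (A := Γ₀) (B := Γ₀) (C := Γ₀) (D := Γ₀) (E := Γ₁)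
    (M := fun _ => default) (b := fun n => (n * 2 + 1) + ((eb c).length + 1))
    (seq (loop .x fun _ => nop) (pushAll .v (eb c).reverse)) ?_ fun a => ?_
  · repeat' first
      | exact PolyBdd.id | exact PolyBdd.const _ | apply PolyBdd.eval | apply PolyBdd.add
  refine ((Runs.discard (ea a)).seq (Runs.pushAll _ (by simp))).mono ?_
  simp

/-- The image of a string under a homomorphism of free monoids. -/
theorem flatMap_encode (h : Γ₀ → List Γ₁) : PolyTime ea (fun a => (ea a).flatMap h) (fun a => a) := by
  refine polyTime_five (A := Γ₀) (B := Γ₀) (C := Γ₀) (D := Γ₀) (E := Γ₁)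
    (M := fun _ => default)
    (b := fun n => (n * 2 + 1) + (n * ((∑ a, (h a).length) + 1 + 1) + 1))
    (seq (loop .x fun a => push .y a) (loop .y fun a => pushAll .v (h a).reverse)) ?_ fun a => ?_
  · repeat' first
      | exact PolyBdd.id | exact PolyBdd.const _ | apply PolyBdd.eval | apply PolyBdd.add
      | apply PolyBdd.mul
  refine ((Runs.move (S' := store [] (ea a).reverse [] [] []) _ (by simp) (by simp)).seq
    (Runs.loop (ea a).reverse (fun d l => store [] l [] [] (d.flatMap h))
    (by simp) (fun d b l _ => (Runs.pushAll _ (by simp)).mono (t' := (∑ a, (h a).length) + 1) ?_)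
    (by simp) (by simp))).mono ?_
  · simpa using Finset.single_le_sum (f := fun a => (h a).length) (by simp) (Finset.mem_univ b)
  · simp

/-- The image of a pair of strings under two homomorphisms of free monoids. -/
theorem flatMap_join {eb : β → List Bool} {ec : γ → List Bool} (f g : Bool → List Γ₁) :
    PolyTime (fun p : β × γ => joinBits (eb p.1) (ec p.2))
      (fun p => (eb p.1).flatMap f ++ (ec p.2).flatMap g) (fun p => p) := by
  set c := (∑ a, (f a).length) + ∑ a, (g a).length with hc
  have hf : ∀ b, (f b).length ≤ c := fun b =>
    (Finset.single_le_sum (f := fun a => (f a).length) (by simp) (Finset.mem_univ b)).trans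
      (Nat.le_add_right _ _)
  have hg : ∀ b, (g b).length ≤ c := fun b =>
    (Finset.single_le_sum (f := fun a => (g a).length) (by simp) (Finset.mem_univ b)).trans
      (Nat.le_add_left _ _)
  -- A marker `true` announces a bit of the first string. The separator `false` starts an inner loop
  -- that consumes the whole second string, after which the outer loop finds its stack empty.
  let p : Prog (fam Bool Γ₁ Γ₁ Γ₁ Γ₁) (fun _ : Three => default) := loop .x fun b => match b with
    | true => case .x fun o => o.elim nop fun a => pushAll .y (f a)
    | false => loop .x fun a => pushAll .y (g a)
  have hp : ∀ (s t : List Bool) (d : List Γ₁), Runs p (store (joinBits s t) d [] [] [])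
      (store [] ((s.flatMap f ++ t.flatMap g).reverse ++ d) [] [] [])
      ((s.length + t.length) * (c + 3) + 3) := by
    intro s t
    induction s with
    | nil =>
      intro d
      refine (Runs.loop_cons false t (by simp [joinBits]) (Runs.loop
        (S' := store [] ((t.flatMap g).reverse ++ d) [] [] []) t
        (fun e l => store l ((e.reverse.flatMap g).reverse ++ d) [] [] []) (by simp)
        (fun e a l _ => (Runs.pushAll _ (by simp)).mono (t' := c + 1) (by simpa using hg a))
        (by simp) (by simp)) (Runs.loop_nil (by simp))).mono ?_
      simp
      ring_nf
      omega
    | cons a s ih =>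
      intro d
      have r : Runs (.case .x fun o => o.elim nop fun a => pushAll .y (f a) :
          Prog (fam Bool Γ₁ Γ₁ Γ₁ Γ₁) (fun _ : Three => default))
          (store (a :: joinBits s t) d [] [] []) (store (joinBits s t) ((f a).reverse ++ d) [] [] [])
          (((f a).length + 1) + 1) :=
        by
        have r := Runs.pushAll (tm := fun _ : Three => default) (k := .y)
          (S := store (joinBits s t) d ([] : List Γ₁) ([] : List Γ₁) ([] : List Γ₁)) (f a) (Five.update_y _ _ _ _ _ _)
        exact Runs.case_cons a (joinBits s t) rfl (by simpa using r)
      have r' := Runs.loop_cons (S := store (joinBits (a :: s) t) d [] [] []) true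
        (a :: joinBits s t) (by simp [joinBits]) (by simpa using r) (ih ((f a).reverse ++ d))
      simp only [List.flatMap_cons, List.append_assoc, List.reverse_append] at r' ⊢
      refine r'.mono ?_
      have := hf a
      simp
      ring_nf
      omega
  refine polyTime_five
    (b := fun n => (n * (c + 3) + 3) + (n * c * 2 + 1))
    (seq p (loop .y fun a => push .v a)) ?_ fun a => ?_
  · repeat' first
      | exact PolyBdd.id | exact PolyBdd.const _ | apply PolyBdd.eval | apply PolyBdd.add
      | apply PolyBdd.mul
  have hs : ∀ h : Bool → List Γ₁, (∀ b, (h b).length ≤ c) → ∀ s : List Bool,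
      (s.flatMap h).length ≤ s.length * c := by
    intro h hh s
    induction s with
    | nil => simp
    | cons b s ih =>
      have := hh b
      rw [List.flatMap_cons, List.length_append, List.length_cons, Nat.succ_mul]
      omega
  have h₁ := hs f hf (eb a.1)
  have h₂ := hs g hg (ec a.2)
  have h₃ : (eb a.1).length + (ec a.2).length ≤ (joinBits (eb a.1) (ec a.2)).length := by
    simp [joinBits]
    omega
  have h₄ := Nat.mul_le_mul_right c h₃
  refine ((hp _ _ _).seq (Runs.move (S' := store [] [] [] []
    ((eb a.1).flatMap f ++ (ec a.2).flatMap g)) _ (by simp) (by simp))).mono ?_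
  simp only [List.append_nil, List.length_reverse, List.length_append, store_y, Nat.mul_add,
    Nat.add_mul] at h₄ ⊢
  omega

theorem fst_join {eb : β → List Bool} {ec : γ → List Bool} :
    PolyTime (fun p : β × γ => joinBits (eb p.1) (ec p.2)) eb Prod.fst :=
  (flatMap_join (fun b => [b]) fun _ => []).reindex id (fun _ => rfl) fun p => by
    simp

theorem snd_join {eb : β → List Bool} {ec : γ → List Bool} :
    PolyTime (fun p : β × γ => joinBits (eb p.1) (ec p.2)) ec Prod.snd :=
  (flatMap_join (fun _ => []) fun b => [b]).reindex id (fun _ => rfl) fun p => by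
    simp

theorem tail_encode : PolyTime ea (fun a => (ea a).tail) (fun a => a) := by
  refine polyTime_five (A := Γ₀) (B := Γ₀) (C := Γ₀) (D := Γ₀) (E := Γ₀)
    (M := fun _ => default) (b := fun n => (1 + 1) + (n * 2 + 1) + (n * 2 + 1))
    (seq (seq (case .x fun _ => nop) (loop .x fun a => push .y a)) (loop .y fun a => push .v a))
    ?_ fun a => ?_
  · repeat' first
      | exact PolyBdd.id | exact PolyBdd.const _ | apply PolyBdd.eval | apply PolyBdd.add
  refine (((Runs.case _ rfl (Runs.nop _)).seq
    (Runs.move (S' := store [] (ea a).tail.reverse [] [] []) _ (by simp) (by simp))).seq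
    (Runs.move _ (by simp) (by simp))).mono ?_
  simp
  omega

theorem cons_encode (b : Γ₀) : PolyTime ea (fun a => b :: ea a) (fun a => a) := by
  refine polyTime_five (A := Γ₀) (B := Γ₀) (C := Γ₀) (D := Γ₀) (E := Γ₀)
    (M := fun _ => default) (b := fun n => (n * 2 + 1) + (n * 2 + 1) + 1)
    (seq (seq (loop .x fun a => push .y a) (loop .y fun a => push .v a)) (push .v b))
    ?_ fun a => ?_
  · repeat' first
      | exact PolyBdd.id | exact PolyBdd.const _ | apply PolyBdd.eval | apply PolyBdd.add
  refine (((Runs.move (S' := store [] (ea a).reverse [] [] []) _ (by simp) (by simp)).seq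
    (Runs.move (S' := store [] [] [] [] (ea a)) _ (by simp) (by simp))).seq
    (Runs.push _ _ (by simp))).mono ?_
  simp

/-- A truth value as a bit string. -/
def _root_.boolBits (b : Bool) : List Bool := if b then [true] else []

theorem isEmpty_encode : PolyTime ea boolBits (fun a => !(ea a).isEmpty) := by
  refine polyTime_five (A := Γ₀) (B := Γ₀) (C := Γ₀) (D := Γ₀) (E := Bool)
    (M := fun _ => default) (b := fun n => ((n * 2 + 1) + 1) + 1)
    (case .x fun o => o.elim nop fun _ => seq (loop .x fun _ => nop) (push .v true))
    ?_ fun a => ?_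
  · repeat' first
      | exact PolyBdd.id | exact PolyBdd.const _ | apply PolyBdd.eval | apply PolyBdd.add
  cases h : ea a with
  | nil =>
    exact (Runs.case_nil rfl (Runs.nop _)).mono (by simp)
  | cons b l =>
    have r := (Runs.discard (tm := fun _ : Three => default) (B := Γ₀) (C := Γ₀) (D := Γ₀)
      (E := Bool) l).seq (Runs.push .v true (Five.update_v _ _ _ _ _ _))
    refine (Runs.case_cons b l rfl (by simpa [boolBits] using r)).mono ?_
    simp

/-- Each branch has to be computable only on the arguments that reach it. This allows a branch to
decode its argument under the assumption that it is, say, a nonempty list. -/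
theorem cond {eb : β → List Bool} {c : α → Bool} {f g : α → β} (hc : PolyTime ea boolBits c)
    (hf : PolyTime (fun a : {a // c a = true} => ea a.1) eb (fun a => f a.1))
    (hg : PolyTime (fun a : {a // c a = false} => ea a.1) eb (fun a => g a.1)) :
    PolyTime ea eb (fun a => if c a then f a else g a) := by
  obtain ⟨M, i, o, T, hM⟩ := hc.exists_computes
  obtain ⟨M₁, i₁, o₁, T₁, hM₁⟩ := hf.exists_computes
  obtain ⟨M₂, i₂, o₂, T₂, hM₂⟩ := hg.exists_computes
  let p : Prog (fam Γ₀ Γ₀ Γ₀ Bool Bool) (Three.fam M M₁ M₂) :=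
    .case .u fun b => b.elim (.call .c .z .u i₂ o₂) fun _ => .call .b .z .u i₁ o₁
  refine polyTime_five
    (b := fun n => (n * 3 + 1) + (2 * n + 3 * T.eval n + 2) +
      ((2 * n + 3 * (T₁.eval n + T₂.eval n) + 2) + 1) + ((T₁.eval n + T₂.eval n) * 2 + 1))
    (seq (seq (seq
      (loop .x fun a => seq (push .y a) (push .z a))
      (call .a .y .u i o)) p)
      (loop .u fun a => push .v a)) ?_ fun a => ?_
  · repeat' first
      | exact PolyBdd.id | exact PolyBdd.const _ | apply PolyBdd.eval | apply PolyBdd.add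
      | apply PolyBdd.mul
  have r₁ := Runs.duplicate (tm := Three.fam M M₁ M₂) (D := Bool) (E := Bool) (ea a)
  have r₂ := r₁.seq (Runs.call (i := .a) (k := .y) (k' := .u)
    (S' := store [] [] (ea a).reverse (boolBits (c a)).reverse []) hM a (by simp) (by simp))
  have r₃ : Runs p (store [] [] (ea a).reverse (boolBits (c a)).reverse [])
      (store [] [] [] (eb (if c a then f a else g a)).reverse [])
      (2 * (ea a).length + 3 * (T₁.eval (ea a).length + T₂.eval (ea a).length) + 2 + 1) := by
    cases h : c a with
    | true =>
      have r := Runs.call (Γ := fam Γ₀ Γ₀ Γ₀ Bool Bool) (tm := Three.fam M M₁ M₂) (i := .b) (k := .z) (k' := .u)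
        (S := store [] [] (ea a).reverse [] []) (S' := store [] [] [] (eb (f a)).reverse [])
        hM₁ ⟨a, h⟩ rfl (by simp)
      refine (Runs.case_cons true [] rfl (by simpa [h, boolBits] using r)).mono ?_
      omega
    | false =>
      have r := Runs.call (Γ := fam Γ₀ Γ₀ Γ₀ Bool Bool) (tm := Three.fam M M₁ M₂) (i := .c) (k := .z) (k' := .u)
        (S := store [] [] (ea a).reverse [] []) (S' := store [] [] [] (eb (g a)).reverse [])
        hM₂ ⟨a, h⟩ rfl (by simp)
      refine (Runs.case_nil rfl (by simpa [h, boolBits] using r)).mono ?_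
      omega
  have h : (eb (if c a then f a else g a)).length ≤ T₁.eval (ea a).length + T₂.eval (ea a).length := by
    cases h : c a with
    | true => exact (hM₁ ⟨a, h⟩).2.trans (Nat.le_add_right _ _)
    | false => exact (hM₂ ⟨a, h⟩).2.trans (Nat.le_add_left _ _)
  refine ((r₂.seq r₃).seq (Runs.move _ (by simp) (by simp))).mono ?_
  simp
  omega

/-- A natural number as a bit string. -/
def _root_.natBits (n : ℕ) : List Bool := List.replicate n true

/-- Iteration of a function whose iterates have polynomially bounded length. -/
theorem iterate {es : β → List Bool} {n : α → ℕ} {f : α → β} {s : β → β} (q : Polynomial ℕ)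
    (hq : ∀ a, ∀ k ≤ n a, (es (s^[k] (f a))).length ≤ q.eval (ea a).length)
    (hn : PolyTime ea natBits n) (hf : PolyTime ea es f) (hs : PolyTime es es s) :
    PolyTime ea es (fun a => s^[n a] (f a)) := by
  obtain ⟨M, i, o, T, hM⟩ := hn.exists_computes
  obtain ⟨M₁, i₁, o₁, T₁, hM₁⟩ := hf.exists_computes
  obtain ⟨M₂, i₂, o₂, T₂, hM₂⟩ := hs.exists_computes
  refine polyTime_five (A := Γ₀) (B := Γ₀) (C := Γ₀) (D := Bool) (E := Bool)
    (M := Three.fam M M₁ M₂)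
    (b := fun n => (n * 3 + 1) + (2 * n + 3 * T.eval n + 2) + (2 * n + 3 * T₁.eval n + 2) +
      (T.eval n * ((2 * q.eval n + 3 * T₂.eval (q.eval n) + 2) + 1) + 1) + (q.eval n * 2 + 1))
    (seq (seq (seq (seq
      (loop .x fun a => seq (push .y a) (push .z a))
      (call .a .y .v i o)) (call .b .z .u i₁ o₁))
      (loop .v fun _ => call .c .u .u i₂ o₂))
      (loop .u fun a => push .v a)) ?_ fun a => ?_
  · repeat' first
      | exact PolyBdd.id | exact PolyBdd.const _ | apply PolyBdd.eval | apply PolyBdd.add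
      | apply PolyBdd.mul
  have r₁ := Runs.duplicate (tm := Three.fam M M₁ M₂) (D := Bool) (E := Bool) (ea a)
  have r₂ := r₁.seq (Runs.call (i := .a) (k := .y) (k' := .v)
    (S' := store [] [] (ea a).reverse [] (natBits (n a)).reverse) hM a (by simp) (by simp))
  have r₃ := r₂.seq (Runs.call (i := .b) (k := .z) (k' := .u)
    (S' := store [] [] [] (es (f a)).reverse (natBits (n a)).reverse) hM₁ a (by simp) (by simp))
  have r₄ := Runs.loop (tm := Three.fam M M₁ M₂)
    (f := fun _ => (.call .c .u .u i₂ o₂ : Prog (fam Γ₀ Γ₀ Γ₀ Bool Bool) _))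
    (k := .v) (c := 2 * q.eval (ea a).length + 3 * T₂.eval (q.eval (ea a).length) + 2)
    (S := store [] [] [] (es (f a)).reverse (natBits (n a)).reverse)
    (S' := store [] [] [] (es (s^[n a] (f a))).reverse [])
    (natBits (n a)).reverse (fun d l => store [] [] [] (es (s^[d.length] (f a))).reverse l)
    (fun _ _ => rfl) (fun d b l h => by
      have hl : d.length + (l.length + 1) = n a := by simpa [natBits] using congrArg List.length h
      have h₁ := hq a d.length (by omega)
      have h₂ := T₂.eval_nat_mono h₁
      have r := Runs.call (Γ := fam Γ₀ Γ₀ Γ₀ Bool Bool) (tm := Three.fam M M₁ M₂) (i := .c)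
        (k := .u) (k' := .u) (S := store [] [] [] (es (s^[d.length] (f a))).reverse l)
        (S' := store [] [] [] (es (s^[d.length + 1] (f a))).reverse l)
        hM₂ (s^[d.length] (f a)) rfl (by simp [Function.iterate_succ_apply'])
      rw [Five.update_v]
      refine r.mono ?_
      omega) rfl (by simp [natBits])
  have h₁ := hq a _ le_rfl
  have h₂ := (hM a).2
  have h₃ := Nat.mul_le_mul_right
    (2 * q.eval (ea a).length + 3 * T₂.eval (q.eval (ea a).length) + 2 + 1) h₂
  refine ((r₃.seq r₄).seq (Runs.move _ (by simp) (by simp))).mono ?_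
  simp only [List.length_reverse, store_u]
  omega

end PolyTime

/-! ### Polynomial time on encoded data -/

/-- An encoding of data by bit strings. -/
class Enc (α : Type) where
  bits : α → List Bool

namespace Enc

variable {α β : Type}

instance : Enc ℕ := ⟨natBits⟩

instance : Enc Bool := ⟨boolBits⟩

instance [Enc α] [Enc β] : Enc (α × β) := ⟨fun p => joinBits (bits p.1) (bits p.2)⟩

instance [Enc α] : Enc (List α) := ⟨fun l => l.flatMap fun a => joinBits (bits a) []⟩

/-- The length of the encoding. -/
def size [Enc α] (a : α) : ℕ := (bits a).length

variable [Enc α] [Enc β]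

theorem length_joinBits (s t : List Bool) : (joinBits s t).length = 2 * s.length + 1 + t.length := by
  have : (s.flatMap fun b => [true, b]).length = 2 * s.length := by
    induction s with
    | nil => rfl
    | cons b s ih => rw [List.flatMap_cons, List.length_append, ih]; simp; omega
  rw [joinBits, List.length_append, this, List.length_cons]
  omega

/-- A nonempty list is encoded like the pair of its head and tail, so the programs for pairs also
build and take apart lists. -/
theorem bits_cons (a : α) (l : List α) : bits (a :: l) = joinBits (bits a) (bits l) := by
  change joinBits (bits a) [] ++ bits l = _
  simp [joinBits]

theorem bits_append (l m : List α) : bits (l ++ m) = bits l ++ bits m :=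
  List.flatMap_append

theorem isEmpty_bits (l : List α) : (bits l).isEmpty = l.isEmpty := by
  cases l with
  | nil => rfl
  | cons a l => simp [bits_cons, joinBits]

@[simp] theorem size_nat (n : ℕ) : size n = n := List.length_replicate

theorem size_bool_le (b : Bool) : size b ≤ 1 := by cases b <;> simp [size, bits, boolBits]

@[simp] theorem size_pair (a : α) (b : β) : size (a, b) = 2 * size a + 1 + size b :=
  length_joinBits _ _

@[simp] theorem size_nil : size ([] : List α) = 0 := rfl

@[simp] theorem size_cons (a : α) (l : List α) : size (a :: l) = 2 * size a + 1 + size l := by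
  rw [size, bits_cons, length_joinBits, size, size]

@[simp] theorem size_append (l m : List α) : size (l ++ m) = size l + size m := by
  rw [size, bits_append, List.length_append, size, size]

theorem size_reverse (l : List α) : size l.reverse = size l := by
  induction l with
  | nil => rfl
  | cons a l ih => simp [ih]; omega

theorem size_le_of_prefix {l m : List α} (h : l <+: m) : size l ≤ size m := by
  obtain ⟨t, rfl⟩ := h
  simp

theorem size_le_of_mem {a : α} {l : List α} (h : a ∈ l) : size a ≤ size l := by
  obtain ⟨s, t, rfl⟩ := List.append_of_mem h
  simp
  omega

theorem length_le_size (l : List α) : l.length ≤ size l := by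
  induction l with
  | nil => simp
  | cons a l ih => simp; omega

end Enc

open Enc

/-- The function `m` is bounded by a polynomial of the size of its argument. -/
def SizeBdd {α : Type} [Enc α] (m : α → ℕ) : Prop :=
  ∃ p : Polynomial ℕ, ∀ a, m a ≤ p.eval (size a)

/-- `f` is computable in polynomial time with respect to the encodings of its argument and
value. -/
def PT {α β : Type} [Enc α] [Enc β] (f : α → β) : Prop :=
  PolyTime (bits : α → List Bool) (bits : β → List Bool) f

namespace SizeBdd

variable {α β : Type} [Enc α] [Enc β] {m m' : α → ℕ}

theorem const (c : ℕ) : SizeBdd fun _ : α => c := ⟨Polynomial.C c, fun n => by simp⟩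

theorem add : SizeBdd m → SizeBdd m' → SizeBdd fun a => m a + m' a :=
  fun ⟨p, hp⟩ ⟨q, hq⟩ => ⟨p + q, fun n => by simpa using Nat.add_le_add (hp n) (hq n)⟩

theorem mul : SizeBdd m → SizeBdd m' → SizeBdd fun a => m a * m' a :=
  fun ⟨p, hp⟩ ⟨q, hq⟩ => ⟨p * q, fun n => by simpa using Nat.mul_le_mul (hp n) (hq n)⟩

theorem eval (p : Polynomial ℕ) : SizeBdd m → SizeBdd fun a => p.eval (m a) :=
  fun ⟨q, hq⟩ => ⟨p.comp q, fun n => by simpa using p.eval_nat_mono (hq n)⟩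

theorem self : SizeBdd fun a : α => size a := ⟨Polynomial.X, fun n => by simp⟩

end SizeBdd

/-! ### Polynomial-time functions of truth values, numbers and lists -/

namespace PT

variable {α β γ δ : Type} [Enc α] [Enc β] [Enc γ] [Enc δ]

theorem exists_size_le {f : α → β} (h : PT f) : ∃ p : Polynomial ℕ, ∀ a, size (f a) ≤ p.eval (size a) := by
  obtain ⟨M, i, o, T, hM⟩ := PolyTime.exists_computes h
  exact ⟨T, fun a => (hM a).2⟩

theorem sizeBdd {f : α → β} (h : PT f) : SizeBdd fun a => size (f a) := h.exists_size_le

theorem sizeBdd_nat {f : α → ℕ} (h : PT f) : SizeBdd f := by simpa using h.sizeBdd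

theorem of_bits {f : α → β} {g : α → γ} (h : PT f) (hb : ∀ a, bits (f a) = bits (g a)) : PT g :=
  PolyTime.reindex h (fun a => a) (fun _ => rfl) hb

theorem comp {f : α → β} {g : β → γ} (hg : PT g) (hf : PT f) : PT fun a => g (f a) :=
  PolyTime.comp hg hf

theorem id : PT fun a : α => a := ⟨Turing.idComputableInPolyTime _⟩

theorem const (c : β) : PT fun _ : α => c := PolyTime.const c

theorem pair {f : α → β} {g : α → γ} (hf : PT f) (hg : PT g) : PT fun a => (f a, g a) :=
  PolyTime.join hf hg

theorem fst {f : α → β × γ} (hf : PT f) : PT fun a => (f a).1 :=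
  PolyTime.comp PolyTime.fst_join hf

theorem snd {f : α → β × γ} (hf : PT f) : PT fun a => (f a).2 :=
  PolyTime.comp PolyTime.snd_join hf

theorem ite_bool {c : α → Bool} {f g : α → β} (hc : PT c) (hf : PT f) (hg : PT g) :
    PT fun a => if c a then f a else g a :=
  PolyTime.cond hc (PolyTime.reindex hf Subtype.val (fun _ => rfl) fun _ => rfl)
    (PolyTime.reindex hg Subtype.val (fun _ => rfl) fun _ => rfl)

theorem ite {c : α → Prop} [DecidablePred c] {f g : α → β} (hc : PT fun a => decide (c a))
    (hf : PT f) (hg : PT g) : PT fun a => if c a then f a else g a := by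
  simpa using hc.ite_bool hf hg

/-! #### Truth values -/

theorem not {c : α → Bool} (hc : PT c) : PT fun a => !c a := by
  have h := hc.ite_bool (PT.const false) (PT.const true)
  convert h using 2 with a
  cases c a <;> rfl

theorem and {c d : α → Bool} (hc : PT c) (hd : PT d) : PT fun a => c a && d a := by
  have h := hc.ite_bool hd (PT.const false)
  convert h using 2 with a
  cases c a <;> rfl

theorem or {c d : α → Bool} (hc : PT c) (hd : PT d) : PT fun a => c a || d a := by
  have h := hc.ite_bool (PT.const true) hd
  convert h using 2 with a
  cases c a <;> rfl

theorem beq {c d : α → Bool} (hc : PT c) (hd : PT d) : PT fun a => c a == d a := by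
  have h := hc.ite_bool hd hd.not
  convert h using 2 with a
  cases c a <;> simp

/-! #### Iteration -/

theorem size_of {f : α → β} (hf : PT f) : PT fun a => size (f a) := by
  refine PolyTime.comp (PolyTime.reindex (PolyTime.flatMap_encode fun _ => [true]) (fun a => a)
    (fun _ => rfl) fun a => ?_) hf
  change (bits a).flatMap (fun _ => [true]) = natBits (bits a).length
  rw [natBits]
  induction bits a with
  | nil => rfl
  | cons b l ih => rw [List.flatMap_cons, ih]; rfl

/-- The iterated machine sees only the current value, so the parameter `a` is carried along as the
first component of a pair. -/
theorem iterate {n : α → ℕ} {f : α → β} {s : α → β → β} (hn : PT n) (hf : PT f)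
    (hs : PT fun p : α × β => s p.1 p.2) {m : α → ℕ} (hm : SizeBdd m)
    (h : ∀ a, ∀ k ≤ n a, size ((s a)^[k] (f a)) ≤ m a) : PT fun a => (s a)^[n a] (f a) := by
  obtain ⟨q, hq⟩ := (((SizeBdd.const 2).mul (SizeBdd.self (α := α))).add (SizeBdd.const 1)).add hm
  let T : α × β → α × β := fun p => (p.1, s p.1 p.2)
  have hT : ∀ k a b, T^[k] (a, b) = (a, (s a)^[k] b) := by
    intro k a b
    induction k with
    | zero => rfl
    | succ k ih => rw [Function.iterate_succ_apply', Function.iterate_succ_apply', ih]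
  have h₁ : PT T := (PT.id.fst).pair hs
  have h₂ : PT fun a => T^[n a] (a, f a) := by
    refine PolyTime.iterate q (fun a k hk => ?_) hn (PT.id.pair hf) h₁
    change size (T^[k] (a, f a)) ≤ _
    rw [hT, size_pair]
    exact (Nat.add_le_add_left (h a k hk) _).trans (hq a)
  have h₃ := h₂.snd
  simpa only [hT] using h₃

/-! #### Natural numbers -/

/-- Numbers are encoded in unary, so successor and predecessor add and remove one symbol; addition,
subtraction and multiplication are iterations with polynomially bounded values. -/
theorem succ {f : α → ℕ} (hf : PT f) : PT fun a => f a + 1 :=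
  have h : PT fun n : ℕ => n + 1 :=
    PolyTime.reindex (PolyTime.cons_encode true) (fun a => a) (fun _ => rfl) fun _ => rfl
  h.comp hf

theorem pred {f : α → ℕ} (hf : PT f) : PT fun a => f a - 1 :=
  have h : PT fun n : ℕ => n - 1 :=
    PolyTime.reindex PolyTime.tail_encode (fun a => a) (fun _ => rfl) fun n => by cases n <;> rfl
  h.comp hf

theorem isZero {f : α → ℕ} (hf : PT f) : PT fun a => decide (f a = 0) := by
  have h : PT fun n : ℕ => !decide (n = 0) :=
    PolyTime.reindex (PolyTime.isEmpty_encode (ea := (bits : ℕ → List Bool))) (fun a => a)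
      (fun _ => rfl) fun n => by cases n <;> rfl
  simpa using (h.comp hf).not

theorem add {f g : α → ℕ} (hf : PT f) (hg : PT g) : PT fun a => f a + g a := by
  have h : ∀ k n, Nat.succ^[k] n = n + k := fun k n => by
    induction k with
    | zero => rfl
    | succ k ih => rw [Function.iterate_succ_apply', ih]; rfl
  have := iterate (s := fun _ => Nat.succ) hg hf (PT.id.snd.succ)
    (hf.sizeBdd_nat.add hg.sizeBdd_nat) fun a k hk => by rw [h, size_nat]; omega
  simpa only [h] using this

theorem sub {f g : α → ℕ} (hf : PT f) (hg : PT g) : PT fun a => f a - g a := by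
  have h : ∀ k n, Nat.pred^[k] n = n - k := fun k n => by
    induction k with
    | zero => rfl
    | succ k ih => rw [Function.iterate_succ_apply', ih]; rfl
  have := iterate (s := fun _ => Nat.pred) hg hf (PT.id.snd.pred)
    hf.sizeBdd_nat fun a k hk => by rw [h, size_nat]; omega
  simpa only [h] using this

theorem mul {f g : α → ℕ} (hf : PT f) (hg : PT g) : PT fun a => f a * g a := by
  have h : ∀ c k, (fun b : ℕ => b + c)^[k] 0 = c * k := fun c k => by
    induction k with
    | zero => rfl
    | succ k ih => rw [Function.iterate_succ_apply', ih]; rfl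
  have := iterate (s := fun a b => b + f a) hg (PT.const 0)
    (PT.id.snd.add (hf.comp PT.id.fst)) (hf.sizeBdd_nat.mul hg.sizeBdd_nat) fun a k hk => by
      rw [h, size_nat]
      exact Nat.mul_le_mul_left _ hk
  simpa only [h] using this

theorem le {f g : α → ℕ} (hf : PT f) (hg : PT g) : PT fun a => decide (f a ≤ g a) := by
  simpa only [Nat.sub_eq_zero_iff_le] using (hf.sub hg).isZero

theorem lt {f g : α → ℕ} (hf : PT f) (hg : PT g) : PT fun a => decide (f a < g a) :=
  hf.succ.le hg

theorem eq {f g : α → ℕ} (hf : PT f) (hg : PT g) : PT fun a => decide (f a = g a) := by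
  have h := (hf.le hg).and (hg.le hf)
  convert h using 2 with a
  rw [← Bool.decide_and]
  congr 1
  exact propext ⟨fun h => ⟨h.le, h.ge⟩, fun h => le_antisymm h.1 h.2⟩

/-! #### Lists -/

theorem cons {f : α → β} {l : α → List β} (hf : PT f) (hl : PT l) : PT fun a => f a :: l a :=
  (hf.pair hl).of_bits fun a => (bits_cons (f a) (l a)).symm

theorem singleton {f : α → β} (hf : PT f) : PT fun a => [f a] := hf.cons (PT.const [])

theorem isEmpty {l : α → List β} (hl : PT l) : PT fun a => (l a).isEmpty := by
  have h : PT fun l : List β => !l.isEmpty :=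
    PolyTime.reindex (PolyTime.isEmpty_encode (ea := (bits : List β → List Bool))) (fun a => a)
      (fun _ => rfl) fun l => by rw [isEmpty_bits]; rfl
  simpa using (h.comp hl).not

theorem headI [Inhabited β] {l : α → List β} (hl : PT l) : PT fun a => (l a).headI := by
  suffices h : PT fun l : List β => if l.isEmpty then default else l.headI by
    have h' : PT (fun l : List β => l.headI) := by
      convert h using 2 with l
      cases l <;> rfl
    exact h'.comp hl
  refine PolyTime.cond (isEmpty PT.id) (PolyTime.const default) ?_
  refine PolyTime.reindex (PolyTime.fst_join (eb := (bits : β → List Bool))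
    (ec := (bits : List β → List Bool))) (fun l => (l.1.headI, l.1.tail)) ?_ fun _ => rfl
  rintro ⟨l, h⟩
  cases l with
  | nil => simp at h
  | cons b l => exact (bits_cons b l).symm

theorem tail {l : α → List β} (hl : PT l) : PT fun a => (l a).tail := by
  suffices h : PT fun l : List β => if l.isEmpty then [] else l.tail by
    have h' : PT (fun l : List β => l.tail) := by
      convert h using 2 with l
      cases l <;> rfl
    exact h'.comp hl
  refine PolyTime.cond (isEmpty PT.id) (PolyTime.const []) ?_
  have := fun l : {l : List β // l.isEmpty = false} => l.1
  -- The head is represented by its encoding as a bit string, so that no default element of `β` is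
  -- needed.
  refine PolyTime.reindex (PolyTime.snd_join (β := List Bool) (eb := fun b => b)
    (ec := (bits : List β → List Bool)))
    (fun l => (l.1.head?.elim [] bits, l.1.tail)) ?_ fun _ => rfl
  rintro ⟨l, h⟩
  cases l with
  | nil => simp at h
  | cons b l => exact (bits_cons b l).symm

/-- A fold is an iteration on pairs of the remaining list and the accumulator. The accumulators that
occur are the folds over prefixes of the list, so their sizes are the ones to be bounded. -/
theorem foldl [Inhabited β] {l : α → List β} {f : α → γ → β → γ} {i : α → γ} (hl : PT l)
    (hi : PT i) (hf : PT fun p : α × γ × β => f p.1 p.2.1 p.2.2) {m : α → ℕ} (hm : SizeBdd m)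
    (h : ∀ a l', l' <+: l a → size (l'.foldl (f a) (i a)) ≤ m a) :
    PT fun a => (l a).foldl (f a) (i a) := by
  let s : α → List β × γ → List β × γ := fun a p =>
    if p.1.isEmpty then p else (p.1.tail, f a p.2 p.1.headI)
  have hs : PT fun p : α × (List β × γ) => s p.1 p.2 := by
    refine PT.ite_bool (isEmpty PT.id.snd.fst) PT.id.snd ?_
    exact (tail PT.id.snd.fst).pair
      (hf.comp (PT.id.fst.pair (PT.id.snd.snd.pair (headI PT.id.snd.fst))))
  have hk : ∀ a k l c, (s a)^[k] (l, c) = (l.drop k, (l.take k).foldl (f a) c) := by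
    intro a k
    induction k with
    | zero => intro l c; simp
    | succ k ih =>
      intro l c
      rw [Function.iterate_succ_apply]
      cases l with
      | nil =>
        rw [show s a ([], c) = ([], c) from rfl, ih]
        simp
      | cons b l =>
        rw [show s a (b :: l, c) = (l, f a c b) from rfl, ih]
        simp
  -- The size of the list serves as the number of iterations. It is at least the length, and the
  -- step does nothing on an empty list.
  have := iterate (s := s) hl.size_of (hl.pair hi) hs
    (((SizeBdd.const 2).mul hl.sizeBdd).add (SizeBdd.const 1) |>.add hm) fun a k _ => by
      rw [hk, size_pair]
      have h₁ := h a _ (List.take_prefix k (l a))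
      have h₂ : size ((l a).drop k) ≤ size (l a) := by
        conv_rhs => rw [← List.take_append_drop k (l a), size_append]
        omega
      omega
  have h₂ := this.snd
  simp only [hk] at h₂
  convert h₂ using 3 with a
  exact (List.take_of_length_le (length_le_size _)).symm

theorem drop {l : α → List β} {n : α → ℕ} (hl : PT l) (hn : PT n) :
    PT fun a => (l a).drop (n a) := by
  have h : ∀ k (l : List β), List.tail^[k] l = l.drop k := by
    intro k
    induction k with
    | zero => simp
    | succ k ih => intro l; rw [Function.iterate_succ_apply, ih]; simp
  have := iterate (s := fun _ => List.tail) hn hl (PT.id.snd.tail) hl.sizeBdd fun a k _ => by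
    rw [h]
    conv_rhs => rw [← List.take_append_drop k (l a), size_append]
    omega
  simpa only [h] using this

variable [Inhabited β]

theorem reverse {l : α → List β} (hl : PT l) : PT fun a => (l a).reverse := by
  have h : ∀ l : List β, l.foldl (fun c b => b :: c) [] = l.reverse := fun l => by simp
  have := foldl (f := fun _ c b => b :: c) hl (PT.const []) (PT.id.snd.snd.cons PT.id.snd.fst)
    hl.sizeBdd fun a l' hl' => by
      rw [h, size_reverse]
      exact size_le_of_prefix hl'
  simpa only [h] using this

theorem append {l m : α → List β} (hl : PT l) (hm : PT m) : PT fun a => l a ++ m a := by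
  have h : ∀ l m : List β, l.foldl (fun c b => b :: c) m = l.reverse ++ m := fun l m => by simp
  have := foldl (f := fun _ c b => b :: c) hl.reverse hm
    (PT.id.snd.snd.cons PT.id.snd.fst) (hl.sizeBdd.add hm.sizeBdd) fun a l' hl' => by
      have := size_le_of_prefix hl'
      rw [size_reverse] at this
      rw [h, size_append, size_reverse]
      omega
  simpa only [h, List.reverse_reverse] using this

theorem length {l : α → List β} (hl : PT l) : PT fun a => (l a).length := by
  have h : ∀ l : List β, l.foldl (fun c _ => c + 1) 0 = l.length := fun l => by simp
  have := foldl (f := fun _ c _ => c + 1) hl (PT.const 0) (PT.id.snd.fst.succ)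
    hl.sizeBdd fun a l' hl' => by
      rw [h, size_nat]
      exact (length_le_size l').trans (size_le_of_prefix hl')
  simpa only [h] using this

theorem flatMap [Inhabited γ] {l : α → List β} {f : α → β → List γ} (hl : PT l)
    (hf : PT fun p : α × β => f p.1 p.2) : PT fun a => (l a).flatMap (f a) := by
  have h : ∀ (f : β → List γ) (l : List β) c, l.foldl (fun c b => c ++ f b) c = c ++ l.flatMap f := by
    intro f l
    induction l with
    | nil => simp
    | cons b l ih => simp [ih]
  obtain ⟨p, hp⟩ := hf.exists_size_le
  have := foldl (f := fun a c b => c ++ f a b) hl (PT.const [])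
    (PT.id.snd.fst.append (hf.comp (PT.id.fst.pair PT.id.snd.snd)))
    (hl.sizeBdd.mul ((((SizeBdd.const 2).mul (SizeBdd.self (α := α))).add
      (SizeBdd.const 1)).add hl.sizeBdd |>.eval p)) fun a l' hl' => by
      rw [h, List.nil_append]
      have hb : ∀ b ∈ l', size (f a b) ≤ p.eval (2 * size a + 1 + size (l a)) := fun b hb =>
        (hp (a, b)).trans (p.eval_nat_mono (by
          have := size_le_of_mem (hl'.subset hb)
          rw [size_pair]
          omega))
      have : size (l'.flatMap (f a)) ≤ l'.length * p.eval (2 * size a + 1 + size (l a)) := by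
        clear hl'
        induction l' with
        | nil => simp
        | cons b l' ih =>
          rw [List.flatMap_cons, size_append, List.length_cons, Nat.succ_mul]
          have := ih fun b h => hb b (by simp [h])
          have := hb b (by simp)
          omega
      exact this.trans (Nat.mul_le_mul_right _
        ((length_le_size l').trans (size_le_of_prefix hl')))
  simpa only [h, List.nil_append] using this

theorem map [Inhabited γ] {l : α → List β} {f : α → β → γ} (hl : PT l)
    (hf : PT fun p : α × β => f p.1 p.2) : PT fun a => (l a).map (f a) := by
  have := flatMap (f := fun a b => [f a b]) hl hf.singleton
  convert this using 2 with a
  exact List.map_eq_flatMap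

theorem range {n : α → ℕ} (hn : PT n) : PT fun a => List.range (n a) := by
  have h : ∀ k, (fun l : List ℕ => l ++ [l.length])^[k] [] = List.range k := by
    intro k
    induction k with
    | zero => rfl
    | succ k ih => rw [Function.iterate_succ_apply', ih, List.range_succ]; simp
  have hr : ∀ k, size (List.range k) ≤ k * (2 * k + 1) := by
    intro k
    induction k with
    | zero => simp
    | succ k ih =>
      rw [List.range_succ, size_append]
      simp
      ring_nf at ih ⊢
      omega
  have := iterate (s := fun _ l => l ++ [l.length]) hn (PT.const [])
    (PT.id.snd.append (PT.id.snd.length.singleton))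
    (hn.sizeBdd_nat.mul (((SizeBdd.const 2).mul hn.sizeBdd_nat).add (SizeBdd.const 1)))
    fun a k hk => by
      rw [h]
      exact (hr k).trans (Nat.mul_le_mul hk (by omega))
  simpa only [h] using this

theorem getD {l : α → List β} {n : α → ℕ} {d : α → β} (hl : PT l) (hn : PT n) (hd : PT d) :
    PT fun a => (l a).getD (n a) (d a) := by
  have := (hl.drop hn).isEmpty.ite_bool hd (hl.drop hn).headI
  convert this using 2 with a
  by_cases h : n a < (l a).length
  · rw [List.drop_eq_getElem_cons h, List.getD_eq_getElem _ _ h]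
    rfl
  · simp [Nat.le_of_not_lt h]

end PT

/-! ### Gaussian elimination over the field with two elements -/

namespace Elimination

/-- The bits of `v` before position `b` are all zero. -/
def zer (v : ℕ → Bool) : ℕ → Bool
  | 0 => true
  | b + 1 => zer v b && !v b

/-- The bit of `w` at the first position before `b` where `v` is nonzero. -/
def sel (v w : ℕ → Bool) : ℕ → Bool
  | 0 => false
  | b + 1 => sel v w b || (zer v b && (v b && w b))

/-- The `j`-th of the vectors `c` of length `n` after the first `t` elimination steps; the step
number `t` clears the leading position of the vector number `t` in the other vectors. -/
def elim (n : ℕ) (c : ℕ → ℕ → Bool) : ℕ → ℕ → ℕ → Bool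
  | 0, j => c j
  | t + 1, j => fun b =>
    xor (elim n c t j b) (sel (elim n c t t) (elim n c t j) n && elim n c t t b)

theorem zer_eq_true {v : ℕ → Bool} {b : ℕ} : zer v b = true ↔ ∀ k < b, v k = false := by
  induction b with
  | zero => simp [zer]
  | succ b ih =>
    simp only [zer, Bool.and_eq_true, ih, Bool.not_eq_true', Nat.lt_succ_iff_lt_or_eq]
    exact ⟨fun h k hk => hk.elim (h.1 k) fun e => e ▸ h.2,
      fun h => ⟨fun k hk => h k (.inl hk), h b (.inr rfl)⟩⟩

theorem sel_eq {v w : ℕ → Bool} {p : ℕ} (hp : v p = true) (hz : ∀ k < p, v k = false) {n : ℕ} :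
    sel v w n = (decide (p < n) && w p) := by
  induction n with
  | zero => simp [sel]
  | succ n ih =>
    rw [sel, ih]
    rcases lt_trichotomy p n with h | rfl | h
    · have : zer v n = false := by
        rw [Bool.eq_false_iff, Ne, zer_eq_true]
        intro hv
        simp [hv p h] at hp
      simp [h, this, Nat.lt_succ_of_lt h]
    · simp [zer_eq_true.mpr hz, hp]
    · simp [hz n h, Nat.lt_asymm h, Nat.not_lt.mpr (Nat.succ_le_of_lt h)]

/-- The leading position `p` depends only on `v`, so for a nonzero pivot the coefficients of all
vectors are read at one place. -/
theorem exists_first {v : ℕ → Bool} {n : ℕ} (h : ∃ b < n, v b = true) :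
    ∃ p < n, v p = true ∧ ∀ w, sel v w n = w p := by
  classical
  have h' : ∃ b, v b = true := h.imp fun _ h => h.2
  obtain ⟨b, hb, hv⟩ := h
  have hp : Nat.find h' < n := (Nat.find_min' h' hv).trans_lt hb
  refine ⟨Nat.find h', hp, Nat.find_spec h', fun w => ?_⟩
  rw [sel_eq (Nat.find_spec h') fun k hk => by simpa using Nat.find_min h' hk]
  simp [hp]

/-- The first `t` steps act on a vector using only the vectors before `t`. In the predicate number
`t`, the vector of `a_j` can therefore stand at position `t + 1` instead of `j`. -/
theorem elim_congr {n : ℕ} {c d : ℕ → ℕ → Bool} {t j j' : ℕ} (h : ∀ k < t, c k = d k)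
    (hj : c j = d j') : elim n c t j = elim n d t j' := by
  induction t generalizing j j' with
  | zero => exact hj
  | succ t ih =>
    have h' := fun k hk => h k (Nat.lt_succ_of_lt hk)
    funext b
    simp only [elim, ih h' hj, ih h' (h t t.lt_succ_self)]

/-- Among `n + 1` vectors of length `n` there is a zero vector or two of them are equal, if every
elimination step treats all later vectors in the same way. -/
theorem not_injective {n : ℕ} {c : ℕ → ℕ → Bool} (h₀ : ∀ j ≤ n, ∃ b < n, c j b = true)
    (h₁ : ∀ j ≤ n, ∀ i < j, ∃ b < n, c i b ≠ c j b)
    (h₂ : ∀ t, t + 2 ≤ n → ∀ j k, t < j → j ≤ n → t < k → k ≤ n →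
      sel (elim n c t t) (elim n c t j) n = sel (elim n c t t) (elim n c t k) n) : False := by
  -- Invariant after `t` steps: the vectors from number `t` on are nonzero, pairwise distinct, and
  -- vanish on a set `S` of `t` positions.
  have key : ∀ t, t + 1 ≤ n →
      (∀ j ≤ n, t ≤ j → ∃ b < n, elim n c t j b = true) ∧
      (∀ j ≤ n, ∀ i < j, t ≤ i → ∃ b < n, elim n c t i b ≠ elim n c t j b) ∧
      ∃ S ⊆ Finset.range n, S.card = t ∧
        ∀ b ∈ S, ∀ j ≤ n, t ≤ j → elim n c t j b = false := by
    intro t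
    induction t with
    | zero => exact fun _ => ⟨fun j hj _ => h₀ j hj, fun j hj i hi _ => h₁ j hj i hi, ∅, by simp⟩
    | succ t ih =>
      intro ht
      obtain ⟨hn, hi, S, hS, hc, hz⟩ := ih (by omega)
      obtain ⟨p, hp, hpv, hs⟩ := exists_first (hn t (by omega) le_rfl)
      -- The coefficient is the same for all later vectors; vector number `n` serves as their
      -- representative.
      have hr : ∀ j, t < j → j ≤ n → elim n c t j p = elim n c t n p := fun j hj hj' => by
        rw [← hs (elim n c t j), ← hs (elim n c t n)]
        exact h₂ t ht j n hj hj' (by omega) le_rfl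
      have he : ∀ j, t < j → j ≤ n → ∀ b,
          elim n c (t + 1) j b = xor (elim n c t j b) (elim n c t n p && elim n c t t b) :=
        fun j hj hj' b => by rw [elim, hs, hr j hj hj']
      refine ⟨fun j hj hj' => ?_, fun j hj i hi' hi'' => ?_, insert p S, ?_, ?_, ?_⟩
      -- With coefficient 0 the vector does not change. With coefficient 1 the pivot is added, and
      -- the sum is nonzero because the vector was different from the pivot.
      · cases hb : elim n c t n p with
        | false =>
          obtain ⟨b, h, h'⟩ := hn j hj (by omega)
          exact ⟨b, h, by rw [he j hj' hj, hb, h']; rfl⟩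
        | true =>
          obtain ⟨b, h, h'⟩ := hi j hj t hj' le_rfl
          refine ⟨b, h, ?_⟩
          rw [he j hj' hj, hb]
          revert h'
          cases elim n c t j b <;> cases elim n c t t b <;> simp
      -- The same vector is added to both, so they still differ at `b`.
      · obtain ⟨b, h, h'⟩ := hi j hj i hi' (by omega)
        refine ⟨b, h, ?_⟩
        rw [he j (by omega) hj, he i (by omega) (by omega)]
        simpa using h'
      · exact Finset.insert_subset (by simpa using hp) hS
      -- The position `p` is new, since the pivot vanishes on `S` but not at `p`.
      · rw [Finset.card_insert_of_notMem, hc]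
        intro h
        simp [hz p h t (by omega) le_rfl] at hpv
      · intro b hb j hj hj'
        rw [he j hj' hj]
        -- At `p` the bit equals the coefficient and the pivot has a one, so the two cancel. On `S`
        -- both the vector and the pivot vanish.
        rcases Finset.mem_insert.mp hb with rfl | hb
        · rw [hr j hj' hj, hpv]
          simp
        · simp [hz b hb j hj (by omega), hz b hb t (by omega) le_rfl]
  -- This gives `0 < n`, which makes `n - 1` a genuine predecessor.
  obtain ⟨b, hb, -⟩ := h₀ 0 (Nat.zero_le n)
  obtain ⟨hn, hi, S, hS, hc, hz⟩ := key (n - 1) (by omega)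
  have hd : (Finset.range n \ S).card = 1 := by
    rw [Finset.card_sdiff_of_subset hS, hc, Finset.card_range]
    omega
  obtain ⟨d, hd⟩ := Finset.card_eq_one.mp hd
  have hd' : ∀ j ≤ n, n - 1 ≤ j → ∀ b < n, elim n c (n - 1) j b = true → b = d := by
    intro j hj hj' b hb h
    have : b ∈ Finset.range n \ S := by
      refine Finset.mem_sdiff.mpr ⟨by simpa using hb, fun hS => ?_⟩
      simp [hz b hS j hj hj'] at h
    simpa [hd] using this
  have ht : ∀ j ≤ n, n - 1 ≤ j → elim n c (n - 1) j d = true := fun j hj hj' => by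
    obtain ⟨b, hb, h⟩ := hn j hj hj'
    rwa [← hd' j hj hj' b hb h]
  -- The two remaining vectors both have a one at the single free position `d`. Where they differ,
  -- one of them has a one, so this position is `d` again.
  obtain ⟨e, he, h⟩ := hi n le_rfl (n - 1) (by omega) le_rfl
  cases h₁ : elim n c (n - 1) (n - 1) e <;> cases h₂ : elim n c (n - 1) n e
  · simp [h₁, h₂] at h
  · have := hd' n le_rfl (by omega) e he h₂
    subst this
    simp [ht (n - 1) (by omega) le_rfl] at h₁
  · have := hd' (n - 1) (by omega) le_rfl e he h₁
    subst this
    simp [ht n le_rfl (by omega)] at h₂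
  · simp [h₁, h₂] at h

end Elimination

/-! ### Evaluation of circuits -/

namespace BoolGate

variable {n : ℕ}

/-- The gate described by a tag and two arguments. -/
def ofCode (n : ℕ) (c : ℕ × ℕ × ℕ) : BoolGate n :=
  match c with
  | (0, i, _) => if h : i < n then input ⟨i, h⟩ else const false
  | (1, b, _) => const (decide (b ≠ 0))
  | (2, j, _) => not j
  | (3, j, k) => and j k
  | (_, j, k) => or j k

/-- The tag and the two arguments that describe a gate. -/
def toCode : BoolGate n → ℕ × ℕ × ℕ
  | input i => (0, i, 0)
  | const b => (1, b.toNat, 0)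
  | not j => (2, j, 0)
  | and j k => (3, j, k)
  | or j k => (4, j, k)

theorem toNats_eq (g : BoolGate n) : g.toNats = [g.toCode.1, g.toCode.2.1, g.toCode.2.2] := by
  cases g <;> rfl

/-- The value of a gate only depends on the values that it reads. -/
theorem eval_congr {x : Fin n → Bool} {v w : List Bool} {g : BoolGate n}
    (h : ∀ r ∈ g.refs, v.getD r false = w.getD r false) : g.eval x v = g.eval x w := by
  cases g <;> simp_all [refs, eval]

end BoolGate

namespace BoolCircuit

variable {n m : ℕ}

theorem length_foldl_eval (x : Fin n → Bool) (l : List (BoolGate n)) :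
    (l.foldl (fun v g => v ++ [g.eval x v]) []).length = l.length := by
  induction l using List.reverseRecOn with
  | nil => rfl
  | append_singleton l g ih => simp [ih]

/-- Values are only appended and gates read only earlier positions, so the complete list of values
satisfies the equation of every gate. Later arguments about circuits use these equations by
induction on positions and never return to the fold. -/
theorem getD_foldl_eval (x : Fin n → Bool) (l : List (BoolGate n))
    (h : ∀ (k : ℕ) (hk : k < l.length), ∀ r ∈ l[k].refs, r < k) (k : ℕ) (hk : k < l.length) :
    (l.foldl (fun v g => v ++ [g.eval x v]) []).getD k false =
      l[k].eval x (l.foldl (fun v g => v ++ [g.eval x v]) []) := by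
  induction l using List.reverseRecOn with
  | nil => simp at hk
  | append_singleton l g ih =>
    simp only [List.foldl_append, List.foldl_cons, List.foldl_nil]
    have hl := length_foldl_eval x l
    generalize l.foldl (fun v g => v ++ [g.eval x v]) [] = v at ih hl ⊢
    have hv : ∀ r < l.length, (v ++ [g.eval x v]).getD r false = v.getD r false := fun r hr => by
      rw [List.getD_append _ _ _ _ (by omega)]
    have hc : (l ++ [g])[k].eval x (v ++ [g.eval x v]) = (l ++ [g])[k].eval x v := by
      refine BoolGate.eval_congr fun r hr => hv r ?_
      have := h k hk r hr
      simp at hk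
      omega
    rw [hc]
    rcases Nat.lt_or_ge k l.length with hk' | hk'
    · rw [hv k hk', ih (fun k hk r hr => h k (by simp; omega) r
        (by rwa [List.getElem_append_left hk])) hk', List.getElem_append_left hk']
    · obtain rfl : k = l.length := by
        simp at hk
        omega
      rw [List.getElem_concat_length, ← hl, List.getD_append_right _ _ _ _ le_rfl]
      · simp
      · rfl

/-- The value of a gate of a circuit in terms of the values of all gates. -/
theorem getD_values (C : BoolCircuit n m) (x : Fin n → Bool) (k : ℕ) (hk : k < C.gates.length) :
    (C.values x).getD k false = C.gates[k].eval x (C.values x) :=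
  getD_foldl_eval x C.gates C.refs_lt k hk

end BoolCircuit

/-! ### A circuit for the elimination -/

namespace Elimination

theorem mul_add_div {m c : ℕ} (a : ℕ) (h : c < m) : (a * m + c) / m = a := by
  rw [Nat.add_comm, Nat.add_mul_div_right _ _ (by omega), Nat.div_eq_of_lt h, Nat.zero_add]

theorem mul_add_mod {m c : ℕ} (a : ℕ) (h : c < m) : (a * m + c) % m = c := by
  rw [Nat.add_comm, Nat.add_mul_mod_self_right, Nat.mod_eq_of_lt h]

/-- The position of the first of the twelve gates for step `t`, vector `j` and bit `b`, where `J`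
copies of a circuit of size `s` come first. -/
def cell (n s J t j b : ℕ) : ℕ := J * s + ((t * J + j) * n + b) * 12

/-- The number of gates for the elimination of `J` vectors of length `n`. -/
def total (n s J : ℕ) : ℕ := J * s + J * J * n * 12

/-- The gate for the bit of the vector before the step. -/
def oldRef (o : List ℕ) (n s J t j b : ℕ) : ℕ :=
  if t = 0 then j * s + o.getD b 0 else cell n s J (t - 1) j b + 6

/-- The gate that decides if the pivot vector is added. -/
def factorRef (n s J t j b : ℕ) : ℕ :=
  if t = 0 then cell n s J t j b + 1 else cell n s J (t - 1) j (n - 1) + 11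

/-- The gate for the bit of the pivot vector. -/
def pivotRef (n s J t j b : ℕ) : ℕ :=
  if t = 0 then cell n s J t j b + 1 else cell n s J (t - 1) (t - 1) b + 6

/-- The gate that tells if the earlier bits of the next pivot vector are zero. -/
def zerRef (n s J t j b : ℕ) : ℕ :=
  if b = 0 then cell n s J t j b else cell n s J t j (b - 1) + 8

/-- The gate that selects among the earlier bits. -/
def selRef (n s J t j b : ℕ) : ℕ :=
  if b = 0 then cell n s J t j b + 1 else cell n s J t j (b - 1) + 11

/-- The description of gate `r` of a cell. -/
def cellCode (o : List ℕ) (n s J t j b r : ℕ) : ℕ × ℕ × ℕ :=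
  if t ≤ j then
    [(1, 1, 0), (1, 0, 0),
      (3, factorRef n s J t j b, pivotRef n s J t j b),
      (4, oldRef o n s J t j b, cell n s J t j b + 2),
      (3, oldRef o n s J t j b, cell n s J t j b + 2),
      (2, cell n s J t j b + 4, 0),
      (3, cell n s J t j b + 3, cell n s J t j b + 5),
      (2, cell n s J t t b + 6, 0),
      (3, zerRef n s J t j b, cell n s J t j b + 7),
      (3, cell n s J t t b + 6, cell n s J t j b + 6),
      (3, zerRef n s J t j b, cell n s J t j b + 9),
      (4, selRef n s J t j b, cell n s J t j b + 10)].getD r (1, 0, 0)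
  else (1, 0, 0)

/-- The description of a gate of the `j`-th copy of a circuit with `n` inputs and `s` gates. -/
def shiftCode (n s j : ℕ) (c : ℕ × ℕ × ℕ) : ℕ × ℕ × ℕ :=
  if c.1 = 0 then (0, j * n + c.2.1, 0)
  else if c.1 = 1 then c
  else if c.1 = 2 then (2, j * s + c.2.1, 0)
  else (c.1, j * s + c.2.1, j * s + c.2.2)

/-- The description of gate `k`. -/
def code (n : ℕ) (g : List (ℕ × ℕ × ℕ)) (o : List ℕ) (J k : ℕ) : ℕ × ℕ × ℕ :=
  if k < J * g.length then shiftCode n g.length (k / g.length) (g.getD (k % g.length) (1, 0, 0))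
  else cellCode o n g.length J ((k - J * g.length) / 12 / n / J) ((k - J * g.length) / 12 / n % J)
    ((k - J * g.length) / 12 % n) ((k - J * g.length) % 12)

/-! ### Layout of the gates -/

section layout

variable {n s J t j b t' j' b' : ℕ}

/-- Cells are ordered lexicographically by step, vector and bit, with the pair of step and vector
numbered by `t * J + j`. -/
theorem cell_add_le (h : t * J + j < t' * J + j') (hb : b < n) :
    cell n s J t j b + 12 ≤ cell n s J t' j' b' := by
  have := Nat.mul_le_mul_right n (Nat.succ_le_of_lt h)
  rw [Nat.succ_mul] at this
  unfold cell
  omega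

theorem cell_add_le_of_step (h : t < t') (hj : j < J) (hb : b < n) :
    cell n s J t j b + 12 ≤ cell n s J t' j' b' := by
  refine cell_add_le ?_ hb
  have := Nat.mul_le_mul_right J (Nat.succ_le_of_lt h)
  rw [Nat.succ_mul] at this
  omega

theorem cell_add_le_of_bit (h : b < b') : cell n s J t j b + 12 ≤ cell n s J t j b' := by
  unfold cell
  omega

theorem cell_add_le_total (ht : t < J) (hj : j < J) (hb : b < n) :
    cell n s J t j b + 12 ≤ total n s J := by
  refine (cell_add_le_of_step (t' := J) (j' := 0) (b' := 0) ht hj hb).trans ?_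
  simp [cell, total]

theorem exists_cell {k : ℕ} (h : J * s ≤ k) (h' : k < total n s J) :
    ∃ t < J, ∃ j < J, ∃ b < n, ∃ r < 12, k = cell n s J t j b + r := by
  obtain ⟨k, rfl⟩ := Nat.exists_eq_add_of_le h
  have hk : k / 12 < J * J * n := Nat.div_lt_of_lt_mul (by unfold total at h'; omega)
  have hn : 0 < n := Nat.pos_of_ne_zero fun h => by simp [h] at hk
  have hJ : 0 < J := Nat.pos_of_ne_zero fun h => by simp [h] at hk
  refine ⟨k / 12 / n / J, ?_, k / 12 / n % J, Nat.mod_lt _ hJ, k / 12 % n, Nat.mod_lt _ hn,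
    k % 12, Nat.mod_lt _ (by omega), ?_⟩
  · exact Nat.div_lt_of_lt_mul (Nat.div_lt_of_lt_mul (by rwa [mul_comm n]))
  · rw [cell, mul_comm _ J, Nat.div_add_mod, mul_comm _ n, Nat.div_add_mod]
    omega

theorem code_cell {g : List (ℕ × ℕ × ℕ)} {o : List ℕ} {r : ℕ} (hj : j < J) (hb : b < n)
    (hr : r < 12) :
    code n g o J (cell n g.length J t j b + r) = cellCode o n g.length J t j b r := by
  have h : cell n g.length J t j b + r - J * g.length = ((t * J + j) * n + b) * 12 + r := by
    unfold cell
    omega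
  have h₁ : (((t * J + j) * n + b) * 12 + r) / 12 = (t * J + j) * n + b := by omega
  have h₂ : (((t * J + j) * n + b) * 12 + r) % 12 = r := by omega
  rw [code, if_neg (by unfold cell; omega), h, h₁, h₂, mul_add_div _ hb, mul_add_mod _ hb,
    mul_add_div _ hj, mul_add_mod _ hj]

theorem code_copy {g : List (ℕ × ℕ × ℕ)} {o : List ℕ} {k : ℕ} (hj : j < J) (hk : k < g.length) :
    code n g o J (j * g.length + k) = shiftCode n g.length j (g.getD k (1, 0, 0)) := by
  have := Nat.mul_le_mul_right g.length (Nat.succ_le_of_lt hj)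
  rw [Nat.succ_mul] at this
  rw [code, if_pos (by omega), mul_add_div _ hk, mul_add_mod _ hk]

theorem refs_cellCode {o : List ℕ} (ho : ∀ b < n, o.getD b 0 < s) (hj : j < J) (hb : b < n)
    {d r : ℕ} (hr : r < 12) :
    ∀ q ∈ (BoolGate.ofCode d (cellCode o n s J t j b r)).refs, q < cell n s J t j b + r := by
  unfold cellCode
  split_ifs with h
  swap
  · simp [BoolGate.ofCode, BoolGate.refs]
  have h₁ : oldRef o n s J t j b < cell n s J t j b := by
    unfold oldRef
    split_ifs with h0
    · have := Nat.mul_le_mul_right s (Nat.succ_le_of_lt hj)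
      rw [Nat.succ_mul] at this
      have := ho b hb
      unfold cell
      omega
    · have := cell_add_le_of_step (s := s) (t := t - 1) (t' := t) (j := j) (j' := j)
        (b := b) (b' := b) (by omega) hj hb
      omega
  -- For `t = 0` the reference is to the constant at gate 1. The first gate that reads it is gate 2,
  -- so this weaker bound suffices.
  have h₂ : factorRef n s J t j b < cell n s J t j b + 2 := by
    unfold factorRef
    split_ifs with h0
    · omega
    · have := cell_add_le_of_step (n := n) (s := s) (J := J) (t := t - 1) (t' := t) (b := n - 1)
        (j' := j) (b' := b) (by omega) hj (by omega)
      omega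
  have h₃ : pivotRef n s J t j b < cell n s J t j b + 2 := by
    unfold pivotRef
    split_ifs with h0
    · omega
    · have := cell_add_le_of_step (s := s) (t := t - 1) (t' := t) (j := t - 1) (j' := j) (b' := b)
        (J := J) (by omega) (by omega) hb
      omega
  have h₄ : zerRef n s J t j b < cell n s J t j b + 1 := by
    unfold zerRef
    split_ifs with h0
    · omega
    · have := cell_add_le_of_bit (n := n) (s := s) (J := J) (t := t) (j := j) (b := b - 1)
        (b' := b) (by omega)
      omega
  have h₅ : selRef n s J t j b < cell n s J t j b + 2 := by
    unfold selRef
    split_ifs with h0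
    · omega
    · have := cell_add_le_of_bit (n := n) (s := s) (J := J) (t := t) (j := j) (b := b - 1)
        (b' := b) (by omega)
      omega
  -- The cell of the pivot comes earlier or, for `t = j`, is the current cell, whose gate 6 still
  -- precedes its readers, gates 7 and 9.
  have h₆ : cell n s J t t b ≤ cell n s J t j b := by
    rcases h.eq_or_lt with rfl | h
    · exact le_rfl
    · have := cell_add_le (s := s) (b' := b) (Nat.add_lt_add_left h (t * J)) hb
      omega
  interval_cases r <;>
    simp only [List.getD_cons_zero, List.getD_cons_succ, BoolGate.ofCode, BoolGate.refs,
      List.mem_cons, List.not_mem_nil, or_false, false_imp_iff, implies_true, forall_eq_or_imp,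
      forall_eq] <;> omega

end layout

theorem refs_shiftCode {n s j d : ℕ} (g : BoolGate n) :
    ∀ q ∈ (BoolGate.ofCode d (shiftCode n s j g.toCode)).refs, ∃ r ∈ g.refs, q = j * s + r := by
  cases g <;> simp [BoolGate.toCode, shiftCode, BoolGate.ofCode, BoolGate.refs]
  split_ifs <;> simp

theorem eval_shiftCode {n s j d : ℕ} (hd : ∀ b < n, j * n + b < d) (x : Fin d → Bool)
    {v w : List Bool} (g : BoolGate n) (h : ∀ r ∈ g.refs, v.getD (j * s + r) false = w.getD r false) :
    (BoolGate.ofCode d (shiftCode n s j g.toCode)).eval x v =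
      g.eval (fun b => x ⟨j * n + b, hd b b.2⟩) w := by
  rcases g with i | b | _ | _ | _
  · simp [BoolGate.toCode, shiftCode, BoolGate.ofCode, BoolGate.eval, hd]
  · cases b <;> simp [BoolGate.toCode, shiftCode, BoolGate.ofCode, BoolGate.eval]
  all_goals
    simp only [BoolGate.refs, List.mem_cons, List.not_mem_nil, or_false, forall_eq_or_imp,
      forall_eq] at h
    simp [BoolGate.toCode, shiftCode, BoolGate.ofCode, BoolGate.eval] at h ⊢
    simp [h]

/-! ### The circuits of the predicates and their correctness -/

section circuit

variable {n : ℕ} (C : BoolCircuit n n)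

theorem getD_out {m : ℕ} (C : BoolCircuit n m) {b : ℕ} (hb : b < m) :
    (List.ofFn C.out).getD b 0 = C.out ⟨b, hb⟩ := by
  rw [List.getD_eq_getElem _ _ (by simpa using hb), List.getElem_ofFn]

theorem getD_map_toCode {l : List (BoolGate n)} {k : ℕ} (hk : k < l.length) :
    (l.map BoolGate.toCode).getD k (1, 0, 0) = l[k].toCode := by
  rw [List.getD_eq_getElem _ _ (by simpa using hk), List.getElem_map]

/-- The circuit that eliminates with the values of `C` at `i + 2` arguments, and computes the
coefficient of the pivot vector number `i` for the last vector. -/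
def circuit (i : Fin (n - 1)) : BoolCircuit ((i.val + 2) * n) 1 where
  gates := (List.range (total n C.gates.length (i + 2))).map fun k =>
    BoolGate.ofCode _ (code n (C.gates.map BoolGate.toCode) (List.ofFn C.out) (i + 2) k)
  -- Gate 11 at the last bit `n - 1` holds the selection over all `n` bits.
  out _ := cell n C.gates.length (i + 2) i (i + 1) (n - 1) + 11
  refs_lt k hk q hq := by
    have hs : (C.gates.map BoolGate.toCode).length = C.gates.length := List.length_map _
    simp only [List.length_map, List.length_range] at hk
    simp only [List.getElem_map, List.getElem_range] at hq
    rcases Nat.lt_or_ge k ((i + 2) * C.gates.length) with h | h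
    · have h0 : 0 < C.gates.length := Nat.pos_of_ne_zero fun h0 => by simp [h0] at h
      have hk' := Nat.mod_lt k h0
      have hd := Nat.div_add_mod' k C.gates.length
      rw [← hd, ← hs, code_copy (by rw [hs]; exact Nat.div_lt_of_lt_mul (by rwa [mul_comm]))
        (by rwa [hs]), hs, getD_map_toCode hk'] at hq
      obtain ⟨r, hr, rfl⟩ := refs_shiftCode _ q hq
      have := C.refs_lt _ hk' r hr
      omega
    · obtain ⟨t, -, j, hj, b, hb, r, hr, rfl⟩ := exists_cell h hk
      rw [← hs, code_cell hj hb hr, hs] at hq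
      refine refs_cellCode (fun b hb => ?_) hj hb hr q hq
      rw [getD_out C hb]
      exact C.out_lt _
  out_lt _ := by
    have hi := i.2
    have := cell_add_le_total (n := n) (s := C.gates.length) (J := i.val + 2) (t := i.val)
      (j := i.val + 1) (b := n - 1) (by omega) (by omega) (by omega)
    simp only [List.length_map, List.length_range]
    omega

theorem size_circuit (i : Fin (n - 1)) :
    (circuit C i).size = (i + 2) * C.size + (i + 2) * (i + 2) * n * 12 := by
  simp [BoolCircuit.size, circuit, total]

variable (i : Fin (n - 1)) (x : Fin ((i.val + 2) * n) → Bool)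

theorem index_lt {j : ℕ} (hj : j < i.val + 2) (b : ℕ) (hb : b < n) :
    j * n + b < (i.val + 2) * n := by
  have := Nat.mul_le_mul_right n (Nat.succ_le_of_lt hj)
  rw [Nat.succ_mul] at this
  omega

theorem values_circuit {k : ℕ} (hk : k < total n C.gates.length (i + 2)) :
    ((circuit C i).values x).getD k false =
      (BoolGate.ofCode _ (code n (C.gates.map BoolGate.toCode) (List.ofFn C.out) (i + 2) k)).eval x
        ((circuit C i).values x) := by
  rw [BoolCircuit.getD_values _ _ k (by simpa [circuit] using hk)]
  simp [circuit]

theorem values_copy {j : ℕ} (hj : j < i.val + 2) (k : ℕ) (hk : k < C.gates.length) :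
    ((circuit C i).values x).getD (j * C.gates.length + k) false =
      (C.values fun b => x ⟨j * n + b, index_lt i hj b b.2⟩).getD k false := by
  have hs : (C.gates.map BoolGate.toCode).length = C.gates.length := List.length_map _
  induction k using Nat.strong_induction_on with
  | _ k ih =>
    have := Nat.mul_le_mul_right C.gates.length (Nat.succ_le_of_lt hj)
    rw [Nat.succ_mul] at this
    rw [values_circuit C i x (by unfold total; omega), ← hs, code_copy hj (by rwa [hs]), hs,
      getD_map_toCode hk, eval_shiftCode (index_lt i hj) x, C.getD_values _ k hk]
    intro r hr
    have := C.refs_lt k hk r hr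
    exact ih r this (by omega)

/-- The bits of a string, padded with zeros. -/
def bitsFrom (y : Fin n → Bool) (b : ℕ) : Bool := if h : b < n then y ⟨b, h⟩ else false

/-- Gates 2 to 6 add the pivot of the preceding step, with the bit of the new vector in gate 6.
Gates 7 to 11 scan for the leading position of the current pivot, passing gates 8 and 11 on from bit
to bit. Accordingly the induction is on `t`, with an inner induction on `b`; the next step reads the
coefficient at the last bit. -/
theorem values_cell (c : ℕ → ℕ → Bool)
    (hc : ∀ (j : ℕ) (hj : j < i.val + 2),
      c j = bitsFrom (C.eval fun b => x ⟨j * n + b, index_lt i hj b b.2⟩)) (t : ℕ) :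
    (∀ j b, t ≤ j → j < i.val + 2 → b < n →
      ((circuit C i).values x).getD (cell n C.gates.length (i + 2) t j b + 6) false =
        elim n c t j b) ∧
    ∀ j b, t ≤ j → j < i.val + 2 → b < n →
      ((circuit C i).values x).getD (cell n C.gates.length (i + 2) t j b + 8) false =
        zer (elim n c t t) (b + 1) ∧
      ((circuit C i).values x).getD (cell n C.gates.length (i + 2) t j b + 11) false =
        sel (elim n c t t) (elim n c t j) (b + 1) := by
  have hs : (C.gates.map BoolGate.toCode).length = C.gates.length := List.length_map _
  have hv : ∀ t j b r, t ≤ j → j < i.val + 2 → b < n → r < 12 →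
      ((circuit C i).values x).getD (cell n C.gates.length (i + 2) t j b + r) false =
        (BoolGate.ofCode _ (cellCode (List.ofFn C.out) n C.gates.length (i + 2) t j b r)).eval x
          ((circuit C i).values x) := fun t j b r ht hj hb hr => by
    have := cell_add_le_total (s := C.gates.length) (ht.trans_lt hj) hj hb
    rw [values_circuit C i x (by omega), ← hs, code_cell hj hb hr, hs]
  have hout : ∀ j b, j < i.val + 2 → b < n →
      ((circuit C i).values x).getD (j * C.gates.length + (List.ofFn C.out).getD b 0) false =
        c j b := fun j b hj hb => by
    rw [getD_out C hb, values_copy C i x hj _ (C.out_lt _), hc j hj, bitsFrom, dif_pos hb]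
    rfl
  generalize (circuit C i).values x = v at *
  -- Exclusive or is realised as `(p ∨ q) ∧ ¬(p ∧ q)`.
  have h₁ : ∀ t j b, t ≤ j → j < i.val + 2 → b < n →
      v.getD (cell n C.gates.length (i + 2) t j b + 6) false =
        xor (v.getD (oldRef (List.ofFn C.out) n C.gates.length (i + 2) t j b) false)
          (v.getD (factorRef n C.gates.length (i + 2) t j b) false &&
            v.getD (pivotRef n C.gates.length (i + 2) t j b) false) := fun t j b ht hj hb => by
    rw [hv t j b 6 ht hj hb (by omega)]
    simp only [cellCode, if_pos ht, List.getD_cons_zero, List.getD_cons_succ, BoolGate.ofCode,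
      BoolGate.eval]
    rw [hv t j b 3 ht hj hb (by omega), hv t j b 5 ht hj hb (by omega)]
    simp only [cellCode, if_pos ht, List.getD_cons_zero, List.getD_cons_succ, BoolGate.ofCode,
      BoolGate.eval]
    rw [hv t j b 4 ht hj hb (by omega)]
    simp only [cellCode, if_pos ht, List.getD_cons_zero, List.getD_cons_succ, BoolGate.ofCode,
      BoolGate.eval]
    rw [hv t j b 2 ht hj hb (by omega)]
    simp only [cellCode, if_pos ht, List.getD_cons_zero, List.getD_cons_succ, BoolGate.ofCode,
      BoolGate.eval]
    generalize v.getD (oldRef _ _ _ _ _ _ _) false = p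
    generalize (v.getD (factorRef _ _ _ _ _ _) false && _) = q
    cases p <;> cases q <;> rfl
  have h₂ : ∀ t j b, t ≤ j → j < i.val + 2 → b < n →
      v.getD (cell n C.gates.length (i + 2) t j b + 8) false =
        (v.getD (zerRef n C.gates.length (i + 2) t j b) false &&
          !v.getD (cell n C.gates.length (i + 2) t t b + 6) false) := fun t j b ht hj hb => by
    rw [hv t j b 8 ht hj hb (by omega)]
    simp only [cellCode, if_pos ht, List.getD_cons_zero, List.getD_cons_succ, BoolGate.ofCode,
      BoolGate.eval]
    rw [hv t j b 7 ht hj hb (by omega)]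
    simp only [cellCode, if_pos ht, List.getD_cons_zero, List.getD_cons_succ, BoolGate.ofCode,
      BoolGate.eval]
  have h₃ : ∀ t j b, t ≤ j → j < i.val + 2 → b < n →
      v.getD (cell n C.gates.length (i + 2) t j b + 11) false =
        (v.getD (selRef n C.gates.length (i + 2) t j b) false ||
          (v.getD (zerRef n C.gates.length (i + 2) t j b) false &&
            (v.getD (cell n C.gates.length (i + 2) t t b + 6) false &&
              v.getD (cell n C.gates.length (i + 2) t j b + 6) false))) :=
    fun t j b ht hj hb => by
    rw [hv t j b 11 ht hj hb (by omega)]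
    simp only [cellCode, if_pos ht, List.getD_cons_zero, List.getD_cons_succ, BoolGate.ofCode,
      BoolGate.eval]
    rw [hv t j b 10 ht hj hb (by omega)]
    simp only [cellCode, if_pos ht, List.getD_cons_zero, List.getD_cons_succ, BoolGate.ofCode,
      BoolGate.eval]
    rw [hv t j b 9 ht hj hb (by omega)]
    simp only [cellCode, if_pos ht, List.getD_cons_zero, List.getD_cons_succ, BoolGate.ofCode,
      BoolGate.eval]
  have hT : ∀ t j b, t ≤ j → j < i.val + 2 → b < n →
      v.getD (cell n C.gates.length (i + 2) t j b) false = true := fun t j b ht hj hb => by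
    have := hv t j b 0 ht hj hb (by omega)
    rw [Nat.add_zero] at this
    rw [this]
    simp only [cellCode, if_pos ht, List.getD_cons_zero, BoolGate.ofCode, BoolGate.eval]
    rfl
  have hF : ∀ t j b, t ≤ j → j < i.val + 2 → b < n →
      v.getD (cell n C.gates.length (i + 2) t j b + 1) false = false := fun t j b ht hj hb => by
    rw [hv t j b 1 ht hj hb (by omega)]
    simp only [cellCode, if_pos ht, List.getD_cons_zero, List.getD_cons_succ, BoolGate.ofCode,
      BoolGate.eval]
    rfl
  clear hv hs
  have step : ∀ t, (∀ j b, t ≤ j → j < i.val + 2 → b < n →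
      v.getD (cell n C.gates.length (i + 2) t j b + 6) false = elim n c t j b) →
      ∀ j b, t ≤ j → j < i.val + 2 → b < n →
      v.getD (cell n C.gates.length (i + 2) t j b + 8) false = zer (elim n c t t) (b + 1) ∧
      v.getD (cell n C.gates.length (i + 2) t j b + 11) false =
        sel (elim n c t t) (elim n c t j) (b + 1) := by
    intro t ht j b hj hj' hb
    induction b with
    | zero =>
      rw [h₂ t j 0 hj hj' hb, h₃ t j 0 hj hj' hb, zerRef, selRef, if_pos rfl, if_pos rfl,
        hT t j 0 hj hj' hb, hF t j 0 hj hj' hb, ht t 0 le_rfl (by omega) hb, ht j 0 hj hj' hb]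
      exact ⟨rfl, rfl⟩
    | succ b ih =>
      obtain ⟨ih₁, ih₂⟩ := ih (by omega)
      rw [h₂ t j _ hj hj' hb, h₃ t j _ hj hj' hb, zerRef, selRef, if_neg (Nat.succ_ne_zero b),
        if_neg (Nat.succ_ne_zero b), Nat.add_sub_cancel, ih₁, ih₂,
        ht t _ le_rfl (by omega) hb, ht j _ hj hj' hb]
      exact ⟨rfl, rfl⟩
  induction t with
  | zero =>
    -- In step 0 the coefficient refers to the constant `false`, so the outputs of the copies of `C`
    -- pass unchanged.
    have : ∀ j b, 0 ≤ j → j < i.val + 2 → b < n →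
        v.getD (cell n C.gates.length (i + 2) 0 j b + 6) false = elim n c 0 j b := by
      intro j b hj hj' hb
      rw [h₁ 0 j b hj hj' hb, oldRef, factorRef, if_pos rfl, if_pos rfl, hF 0 j b hj hj' hb,
        hout j b hj' hb]
      simp [elim]
    exact ⟨this, step 0 this⟩
  | succ t ih =>
    have : ∀ j b, t + 1 ≤ j → j < i.val + 2 → b < n →
        v.getD (cell n C.gates.length (i + 2) (t + 1) j b + 6) false = elim n c (t + 1) j b := by
      intro j b hj hj' hb
      have hn : n - 1 + 1 = n := by omega
      rw [h₁ _ j b hj hj' hb, oldRef, factorRef, pivotRef, if_neg (Nat.succ_ne_zero t),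
        if_neg (Nat.succ_ne_zero t), if_neg (Nat.succ_ne_zero t), Nat.add_sub_cancel,
        ih.1 j b (by omega) hj' hb, ih.1 t b le_rfl (by omega) hb,
        (ih.2 j (n - 1) (by omega) hj' (by omega)).2, hn]
      rfl
    exact ⟨this, step _ this⟩

theorem pred_circuit (w : Fin (i.val + 2) → Fin n → Bool) (c : ℕ → ℕ → Bool)
    (hc : ∀ (j : ℕ) (hj : j < i.val + 2), c j = bitsFrom (C.eval (w ⟨j, hj⟩))) :
    LongChoiceInstance.pred (circuit C) i w = sel (elim n c i i) (elim n c i (i + 1)) n := by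
  have hi := i.2
  have h := ((values_cell C i (fun t => w t.divNat t.modNat) c (fun j hj => ?_) i).2 (i + 1) (n - 1)
    (by omega) (by omega) (by omega)).2
  · rw [Nat.sub_add_cancel (by omega)] at h
    exact h
  · rw [hc j hj]
    congr 3
    funext b
    congr 1
    · exact Fin.ext (mul_add_div _ b.2).symm
    · exact Fin.ext (mul_add_mod _ b.2).symm

/-- Without a zero and a collision, the vectors `C(a_j)` satisfy the hypotheses of `not_injective`;
the certificate condition is its hypothesis about equal coefficients. -/
theorem exists_collision_of_isCertificate {a : Fin (n + 1) → Fin n → Bool}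
    (ha : LongChoiceInstance.IsCertificate (circuit C) a) :
    (∃ i j, i < j ∧ C.eval (a i) = C.eval (a j)) ∨ ∃ i, C.eval (a i) = fun _ => false := by
  by_contra! hne
  obtain ⟨h₁, h₀⟩ := hne
  have key : ∀ y z : Fin n → Bool, y ≠ z → ∃ b < n, bitsFrom y b ≠ bitsFrom z b := by
    intro y z h
    obtain ⟨b, hb⟩ := Function.ne_iff.mp h
    exact ⟨b, b.2, by simpa [bitsFrom] using hb⟩
  let c : ℕ → ℕ → Bool := fun j =>
    if h : j < n + 1 then bitsFrom (C.eval (a ⟨j, h⟩)) else fun _ => false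
  have hc : ∀ j (h : j < n + 1), c j = bitsFrom (C.eval (a ⟨j, h⟩)) := fun j h => dif_pos h
  refine not_injective (n := n) (c := c) (fun j hj => ?_) (fun j hj i hi => ?_)
    fun t ht j k hj hj' hk hk' => ?_
  · obtain ⟨b, hb, h⟩ := key _ _ (h₀ ⟨j, by omega⟩)
    refine ⟨b, hb, ?_⟩
    rw [hc j (by omega)]
    simpa [bitsFrom, hb] using h
  · rw [hc j (by omega), hc i (by omega)]
    exact key _ _ (h₁ _ _ (by simpa using hi))
  · have hp : ∀ j (hj : t < j) (hj' : j ≤ n),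
        LongChoiceInstance.pred (circuit C) ⟨t, by omega⟩
          (LongChoiceInstance.args a ⟨t, by omega⟩ ⟨j, by omega⟩) =
          sel (elim n c t t) (elim n c t j) n := by
      intro j hj hj'
      -- The arguments of the predicate are `a_0, …, a_t, a_j`, so the vector `c j` stands at
      -- position `t + 1`. The congruence below moves it back to position `j`.
      rw [pred_circuit C ⟨t, by omega⟩ _ (fun k => if k ≤ t then c k else c j)]
      · have hl : ∀ k < t, (if k ≤ t then c k else c j) = c k := fun k hk => if_pos hk.le
        congr 1
        · exact elim_congr hl (if_pos le_rfl)
        · exact elim_congr hl (if_neg (by simp))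
      · intro k hk
        rcases Nat.lt_or_ge t k with h | h
        · obtain rfl : k = t + 1 := by
            change k < t + 2 at hk
            omega
          rw [if_neg (by omega), hc j (by omega)]
          congr 2
          exact (Fin.snoc_last (α := fun _ => Fin n → Bool) (n := t + 1) _ _).symm
        · rw [if_pos h, hc k (by omega)]
          congr 2
          exact (Fin.snoc_castSucc (α := fun _ => Fin n → Bool) (n := t + 1) (a ⟨j, by omega⟩)
            (fun k : Fin (t + 1) => a ⟨k.val, by omega⟩) ⟨k, by omega⟩).symm
    rw [← hp j hj hj', ← hp k hk hk']
    exact ha.2 ⟨t, by omega⟩ _ _ hj hk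

end circuit

end Elimination

/-! ### Words, numbers and pairs of words -/

namespace PT

variable {α β γ : Type} [Enc α] [Enc β] [Enc γ]

/-- For `n > 0`, the quotient `m / n` is the number of `k < m` with `(k + 1) * n ≤ m`, counted by
the length of a list. Division by zero is treated separately. -/
theorem div {f g : α → ℕ} (hf : PT f) (hg : PT g) : PT fun a => f a / g a := by
  have h : ∀ m n : ℕ, 0 < n →
      ((List.range m).flatMap fun k => if (k + 1) * n ≤ m then [()] else []).length = m / n := by
    intro m n hn
    have : ∀ k, k ≤ m →
        ((List.range k).flatMap fun k => if (k + 1) * n ≤ m then [()] else []).length =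
          min k (m / n) := by
      intro k hk
      induction k with
      | zero => simp
      | succ k ih =>
        rw [List.range_succ, List.flatMap_append, List.length_append, ih (by omega),
          List.flatMap_singleton]
        simp only [← Nat.le_div_iff_mul_le hn]
        split_ifs with h <;> simp <;> omega
    rw [this m le_rfl, min_eq_right (Nat.div_le_self _ _)]
  let _ : Enc Unit := ⟨fun _ => []⟩
  have h₁ := ((range hf).flatMap (f := fun a k => if (k + 1) * g a ≤ f a then [()] else [])
    (ite (((id.snd.succ).mul (hg.comp id.fst)).le (hf.comp id.fst)) (const [()])
      (const []))).length
  refine Eq.mp ?_ (ite (hg.eq (const 0)) (const 0) h₁)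
  congr 1
  funext a
  split_ifs with h0
  · simp [h0]
  · exact h _ _ (Nat.pos_of_ne_zero h0)

theorem mod {f g : α → ℕ} (hf : PT f) (hg : PT g) : PT fun a => f a % g a := by
  simpa only [Nat.mod_eq_sub] using hf.sub (hg.mul (hf.div hg))

theorem all [Inhabited β] {l : α → List β} {c : α → β → Bool} (hl : PT l)
    (hc : PT fun p : α × β => c p.1 p.2) : PT fun a => (l a).all (c a) := by
  let _ : Enc Unit := ⟨fun _ => []⟩
  refine Eq.mp ?_ (hl.flatMap (f := fun a b => if c a b then [] else [()])
    (hc.ite_bool (const []) (const [()]))).isEmpty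
  congr 1
  funext a
  induction l a with
  | nil => rfl
  | cons b l ih =>
    rw [List.flatMap_cons, List.all_cons, ← ih]
    cases c a b <;> rfl

end PT

theorem Enc.size_bools_le (l : List Bool) : size l ≤ 3 * l.length := by
  induction l with
  | nil => simp
  | cons b l ih =>
    have := size_bool_le b
    rw [size_cons, List.length_cons]
    omega

/-- A bit string that is its own encoding. -/
structure Word where
  word : List Bool

instance : Enc Word := ⟨Word.word⟩

namespace PolyTime

variable {α : Type} {u v : α → List Bool}

theorem fst_pairBits : PolyTime (fun a => pairBits (u a) (v a)) u fun a => a := by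
  refine reindex (flatMap_encode (Sum.elim (fun b => [b]) fun _ => ([] : List Bool)))
    (fun a => a) (fun _ => rfl) fun a => ?_
  simp [pairBits, List.flatMap_map]

theorem snd_pairBits : PolyTime (fun a => pairBits (u a) (v a)) v fun a => a := by
  refine reindex (flatMap_encode (Sum.elim (fun _ => ([] : List Bool)) fun b => [b]))
    (fun a => a) (fun _ => rfl) fun a => ?_
  simp [pairBits, List.flatMap_map]

theorem pairBits_joinBits : PolyTime (fun a => joinBits (u a) (v a))
    (fun a => pairBits (u a) (v a)) fun a => a := by
  refine reindex (flatMap_join (eb := fun w => w) (ec := fun w => w)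
    (fun b => [(Sum.inl b : Bool ⊕ Bool)]) fun b => [Sum.inr b])
    (fun a => (u a, v a)) (fun _ => rfl) fun a => ?_
  simp [pairBits, List.map_eq_flatMap]

/-- Both encodings are unary and differ only by the markers inside numbers, so a homomorphism of
free monoids translates one into the other. -/
theorem nats_of_word {f : α → List ℕ} : PolyTime (fun a => natsToBits (f a)) bits f := by
  refine reindex (f := fun a => a) (flatMap_encode (fun b : Bool => if b then [true, true] else [false]))
    (fun a => a) (fun _ => rfl) fun a => ?_
  induction f a with
  | nil => rfl
  | cons n l ih =>
    rw [bits_cons, ← ih, natsToBits, List.map_cons, List.flatten_cons, List.flatMap_append,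
      List.flatMap_append, joinBits]
    simp only [bits, natBits, natsToBits, List.flatMap_replicate]
    simp

theorem bools_of_word {f : α → List Bool} : PolyTime f bits f := by
  refine reindex (f := fun a => a)
    (flatMap_encode (fun b : Bool => if b then [true, true, false] else [false]))
    (fun a => a) (fun _ => rfl) fun a => ?_
  induction f a with
  | nil => rfl
  | cons b w ih =>
    rw [bits_cons, ← ih]
    cases b <;> rfl

/-- In this direction the code has to be parsed: a fold over the reversed list collects the bits in
a `Word`, which is its own encoding. -/
theorem word_of_bools : PolyTime bits (fun w : List Bool => w) fun w => w := by
  have hc : PT fun p : List Bool × Word × Bool =>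
      if p.2.2 then Word.mk (true :: p.2.1.word) else Word.mk (false :: p.2.1.word) := by
    have h : ∀ b, PT fun w : Word => Word.mk (b :: w.word) := fun b =>
      reindex (cons_encode b) (fun a => a) (fun _ => rfl) fun _ => rfl
    exact PT.id.snd.snd.ite_bool ((h true).comp PT.id.snd.fst) ((h false).comp PT.id.snd.fst)
  have h : ∀ (l : List Bool) c, (l.foldl (fun (w : Word) b =>
      if b then Word.mk (true :: w.word) else Word.mk (false :: w.word)) c).word =
        l.reverse ++ c.word := by
    intro l
    induction l with
    | nil => simp
    | cons b l ih =>
      intro c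
      rw [List.foldl_cons, ih]
      cases b <;> simp
  have := PT.foldl (f := fun (_ : List Bool) (w : Word) b =>
      if b then Word.mk (true :: w.word) else Word.mk (false :: w.word))
    (PT.reverse PT.id) (PT.const (Word.mk [])) hc (SizeBdd.self (α := List Bool)) fun l l' hl => by
      change (Word.word (l'.foldl _ _)).length ≤ _
      rw [h]
      have := hl.length_le
      simp only [List.length_append, List.length_reverse, List.length_nil] at this ⊢
      exact this.trans (length_le_size l)
  refine reindex this (fun a => a) (fun _ => rfl) fun w => ?_
  change Word.word (w.reverse.foldl _ _) = _
  rw [h]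
  simp

theorem word_of_nats {f : α → List ℕ} : PolyTime (fun a => bits (f a)) (fun a => natsToBits (f a))
    fun a => a := by
  have h : PT natsToBits := by
    have := (PT.id (α := List ℕ)).flatMap
      (f := fun _ k => (List.range k).map (fun _ => true) ++ [false])
      (((PT.range PT.id.snd).map (f := fun _ _ => true) (PT.const true)).append (PT.const [false]))
    refine Eq.mp ?_ this
    congr 1
    funext l
    simp [natsToBits, List.flatMap_def]
  exact reindex (comp word_of_bools h) f (fun _ => rfl) fun _ => rfl

end PolyTime

/-! ### The elimination circuit in polynomial time -/

namespace Elimination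

section polytime

variable {α : Type} [Enc α] {n s J t j b r k : α → ℕ} {o : α → List ℕ} {c : α → ℕ × ℕ × ℕ}
  {g : α → List (ℕ × ℕ × ℕ)}

theorem pt_cell (hn : PT n) (hs : PT s) (hJ : PT J) (ht : PT t) (hj : PT j) (hb : PT b) :
    PT fun a => cell (n a) (s a) (J a) (t a) (j a) (b a) :=
  (hJ.mul hs).add ((((((ht.mul hJ).add hj).mul hn).add hb)).mul (PT.const 12))

theorem pt_total (hn : PT n) (hs : PT s) (hJ : PT J) :
    PT fun a => total (n a) (s a) (J a) :=
  (hJ.mul hs).add (((hJ.mul hJ).mul hn).mul (PT.const 12))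

theorem pt_triple {x y z : α → ℕ} (hx : PT x) (hy : PT y) (hz : PT z) :
    PT fun a => (x a, y a, z a) := hx.pair (hy.pair hz)

theorem pt_cellCode (ho : PT o) (hn : PT n) (hs : PT s) (hJ : PT J) (ht : PT t) (hj : PT j)
    (hb : PT b) (hr : PT r) :
    PT fun a => cellCode (o a) (n a) (s a) (J a) (t a) (j a) (b a) (r a) := by
  have h := pt_cell hn hs hJ ht hj hb
  have hh := fun d => h.add (PT.const d)
  have ht₁ := ht.sub (PT.const 1)
  have ht₀ := ht.eq (PT.const 0)
  have hb₁ := hb.sub (PT.const 1)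
  have hb₀ := hb.eq (PT.const 0)
  have h6 := (pt_cell hn hs hJ ht ht hb).add (PT.const 6)
  have hX : PT fun a => oldRef (o a) (n a) (s a) (J a) (t a) (j a) (b a) :=
    PT.ite ht₀ ((hj.mul hs).add (ho.getD hb (PT.const 0)))
      ((pt_cell hn hs hJ ht₁ hj hb).add (PT.const 6))
  have hD : PT fun a => factorRef (n a) (s a) (J a) (t a) (j a) (b a) :=
    PT.ite ht₀ (hh 1) ((pt_cell hn hs hJ ht₁ hj (hn.sub (PT.const 1))).add (PT.const 11))
  have hV : PT fun a => pivotRef (n a) (s a) (J a) (t a) (j a) (b a) :=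
    PT.ite ht₀ (hh 1) ((pt_cell hn hs hJ ht₁ ht₁ hb).add (PT.const 6))
  have hZ : PT fun a => zerRef (n a) (s a) (J a) (t a) (j a) (b a) :=
    PT.ite hb₀ h ((pt_cell hn hs hJ ht hj hb₁).add (PT.const 8))
  have hS : PT fun a => selRef (n a) (s a) (J a) (t a) (j a) (b a) :=
    PT.ite hb₀ (hh 1) ((pt_cell hn hs hJ ht hj hb₁).add (PT.const 11))
  have tr := @pt_triple α _
  have k := fun m => PT.const (α := α) (β := ℕ) m
  refine PT.ite (ht.le hj) (PT.getD ?_ hr (PT.const (1, 0, 0))) (PT.const (1, 0, 0))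
  exact PT.cons (PT.const (1, 1, 0)) <| PT.cons (PT.const (1, 0, 0)) <|
    PT.cons (tr (k 3) hD hV) <| PT.cons (tr (k 4) hX (hh 2)) <| PT.cons (tr (k 3) hX (hh 2)) <|
    PT.cons (tr (k 2) (hh 4) (k 0)) <| PT.cons (tr (k 3) (hh 3) (hh 5)) <|
    PT.cons (tr (k 2) h6 (k 0)) <| PT.cons (tr (k 3) hZ (hh 7)) <| PT.cons (tr (k 3) h6 (hh 6)) <|
    PT.cons (tr (k 3) hZ (hh 9)) <| PT.cons (tr (k 4) hS (hh 10)) <| PT.const []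

theorem pt_shiftCode (hn : PT n) (hs : PT s) (hj : PT j) (hc : PT c) :
    PT fun a => shiftCode (n a) (s a) (j a) (c a) := by
  have e := fun m => hc.fst.eq (PT.const m)
  have h := (hj.mul hs).add hc.snd.fst
  exact PT.ite (e 0) (pt_triple (PT.const 0) ((hj.mul hn).add hc.snd.fst) (PT.const 0)) <|
    PT.ite (e 1) hc <| PT.ite (e 2) (pt_triple (PT.const 2) h (PT.const 0)) <|
    pt_triple hc.fst h ((hj.mul hs).add hc.snd.snd)

theorem pt_code (hn : PT n) (hg : PT g) (ho : PT o) (hJ : PT J) (hk : PT k) :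
    PT fun a => code (n a) (g a) (o a) (J a) (k a) := by
  have hs := hg.length
  have hk' := hk.sub (hJ.mul hs)
  have h12 := hk'.div (PT.const 12)
  exact PT.ite (hk.lt (hJ.mul hs))
    (pt_shiftCode hn hs (hk.div hs) (hg.getD (hk.mod hs) (PT.const (1, 0, 0))))
    (pt_cellCode ho hn hs hJ ((h12.div hn).div hJ) ((h12.div hn).mod hJ) (h12.mod hn)
      (hk'.mod (PT.const 12)))

end polytime

/-- The numbers that describe the elimination circuits. -/
def instanceNats (n : ℕ) (g : List (ℕ × ℕ × ℕ)) (o : List ℕ) : List ℕ :=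
  n :: (List.range (n - 1)).flatMap fun i =>
    total n g.length (i + 2) :: ((List.range (total n g.length (i + 2))).flatMap (fun k =>
      [(code n g o (i + 2) k).1, (code n g o (i + 2) k).2.1, (code n g o (i + 2) k).2.2]) ++
      [cell n g.length (i + 2) i (i + 1) (n - 1) + 11])

theorem pt_instanceNats {α : Type} [Enc α] {n : α → ℕ} {g : α → List (ℕ × ℕ × ℕ)}
    {o : α → List ℕ} (hn : PT n) (hg : PT g) (ho : PT o) :
    PT fun a => instanceNats (n a) (g a) (o a) := by
  refine hn.cons (PT.flatMap (PT.range hn.pred) (f := fun a i =>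
    total (n a) (g a).length (i + 2) :: ((List.range (total (n a) (g a).length (i + 2))).flatMap
      (fun k => [(code (n a) (g a) (o a) (i + 2) k).1, (code (n a) (g a) (o a) (i + 2) k).2.1,
        (code (n a) (g a) (o a) (i + 2) k).2.2]) ++
      [cell (n a) (g a).length (i + 2) i (i + 1) (n a - 1) + 11])) ?_)
  have hn' : PT fun p : α × ℕ => n p.1 := hn.comp PT.id.fst
  have hs' : PT fun p : α × ℕ => (g p.1).length := hg.length.comp PT.id.fst
  have hi : PT fun p : α × ℕ => p.2 := PT.id.snd
  have hT := pt_total hn' hs' hi.succ.succ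
  refine hT.cons (PT.append (PT.flatMap (PT.range hT) (f := fun (p : α × ℕ) k =>
    [(code (n p.1) (g p.1) (o p.1) (p.2 + 2) k).1, (code (n p.1) (g p.1) (o p.1) (p.2 + 2) k).2.1,
      (code (n p.1) (g p.1) (o p.1) (p.2 + 2) k).2.2]) ?_)
    (PT.singleton ((pt_cell hn' hs' hi.succ.succ hi hi.succ hn'.pred).add (PT.const 11))))
  have hc : PT fun p : (α × ℕ) × ℕ =>
      code (n p.1.1) (g p.1.1) (o p.1.1) (p.1.2 + 2) p.2 :=
    pt_code (hn.comp PT.id.fst.fst) (hg.comp PT.id.fst.fst) (ho.comp PT.id.fst.fst)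
      PT.id.fst.snd.succ.succ PT.id.snd
  exact hc.fst.cons (hc.snd.fst.cons hc.snd.snd.singleton)

theorem ofFn_val {β : Type} (m : ℕ) (f : ℕ → β) :
    (List.ofFn fun i : Fin m => f i) = (List.range m).map f := by
  refine List.ext_getElem (by simp) fun k _ _ => by simp

/-- `ofCode` turns input gates out of range into constants. The bound on the shifted indices ensures
that the description survives. -/
theorem toNats_ofCode_shiftCode {n s j d : ℕ} (hd : ∀ b < n, j * n + b < d) (g : BoolGate n) :
    (BoolGate.ofCode d (shiftCode n s j g.toCode)).toNats =
      [(shiftCode n s j g.toCode).1, (shiftCode n s j g.toCode).2.1,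
        (shiftCode n s j g.toCode).2.2] := by
  rcases g with i | b | _ | _ | _
  · simp [BoolGate.toCode, shiftCode, BoolGate.ofCode, BoolGate.toNats, hd]
  · cases b <;> rfl
  all_goals rfl

theorem toNats_ofCode_cellCode {o : List ℕ} {n s J t j b r d : ℕ} (hr : r < 12) :
    (BoolGate.ofCode d (cellCode o n s J t j b r)).toNats =
      [(cellCode o n s J t j b r).1, (cellCode o n s J t j b r).2.1,
        (cellCode o n s J t j b r).2.2] := by
  unfold cellCode
  split_ifs
  · interval_cases r <;> rfl
  · rfl

/-- The encoded instance is expressed by lists of numbers alone, without dependent types, so that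
its computation can be treated with `PT`. -/
theorem encode_circuit {n : ℕ} (C : BoolCircuit n n) :
    longChoice.encode ⟨n, circuit C⟩ =
      natsToBits (instanceNats n (C.gates.map BoolGate.toCode) (List.ofFn C.out)) := by
  have hs : (C.gates.map BoolGate.toCode).length = C.gates.length := List.length_map _
  have h : ∀ i : Fin (n - 1), (circuit C i).toNats =
      (fun i => total n (C.gates.map BoolGate.toCode).length (i + 2) ::
        ((List.range (total n (C.gates.map BoolGate.toCode).length (i + 2))).flatMap (fun k =>
          [(code n (C.gates.map BoolGate.toCode) (List.ofFn C.out) (i + 2) k).1,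
            (code n (C.gates.map BoolGate.toCode) (List.ofFn C.out) (i + 2) k).2.1,
            (code n (C.gates.map BoolGate.toCode) (List.ofFn C.out) (i + 2) k).2.2]) ++
        [cell n (C.gates.map BoolGate.toCode).length (i + 2) i (i + 1) (n - 1) + 11]))
        (i : ℕ) := by
    intro i
    simp only [BoolCircuit.toNats, circuit, List.length_map, List.length_range, List.map_map,
      List.flatMap_def]
    congr 2
    congr 1
    refine List.map_congr_left fun k hk => ?_
    rw [List.mem_range] at hk
    simp only [Function.comp_apply]
    rcases Nat.lt_or_ge k ((i + 2) * C.gates.length) with h | h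
    · have h0 : 0 < C.gates.length := Nat.pos_of_ne_zero fun h0 => by simp [h0] at h
      have hk' := Nat.mod_lt k h0
      have hj : k / C.gates.length < i + 2 := Nat.div_lt_of_lt_mul (by rwa [mul_comm])
      have hd := Nat.div_add_mod' k C.gates.length
      rw [← hd, ← hs, code_copy (by rwa [hs]) (by rwa [hs]), hs, getD_map_toCode hk']
      exact toNats_ofCode_shiftCode (fun b hb => index_lt i hj b hb) _
    · obtain ⟨t, -, j, hj, b, hb, r, hr, rfl⟩ := exists_cell h hk
      rw [← hs, code_cell hj hb hr]
      exact toNats_ofCode_cellCode hr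
  change natsToBits (n :: (List.ofFn fun i => (circuit C i).toNats).flatten) = _
  rw [instanceNats, List.flatMap_def, ← ofFn_val, funext h]

end Elimination

/-! ### Collisions from certificates -/

namespace Elimination

/-- The value of the gate with the description `c`. -/
def codeValue (x v : List Bool) (c : ℕ × ℕ × ℕ) : Bool :=
  if c.1 = 0 then x.getD c.2.1 false
  else if c.1 = 1 then !decide (c.2.1 = 0)
  else if c.1 = 2 then !v.getD c.2.1 false
  else if c.1 = 3 then v.getD c.2.1 false && v.getD c.2.2 false
  else v.getD c.2.1 false || v.getD c.2.2 false

/-- The values of the gates with the descriptions `g`. -/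
def codeValues (g : List (ℕ × ℕ × ℕ)) (x : List Bool) : List Bool :=
  g.foldl (fun v c => v ++ [codeValue x v c]) []

theorem codeValues_map {n m : ℕ} (C : BoolCircuit n m) (x : Fin n → Bool) :
    codeValues (C.gates.map BoolGate.toCode) (List.ofFn x) = C.values x := by
  rw [codeValues, List.foldl_map, BoolCircuit.values]
  congr 1
  funext v g
  congr 2
  rcases g with i | b | _ | _ | _
  · simp [codeValue, BoolGate.toCode, BoolGate.eval]
  · cases b <;> rfl
  all_goals rfl

/-- The first `m` bits of block number `i`, where blocks have `n` bits. -/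
def block (n m : ℕ) (y : List Bool) (i : ℕ) : List Bool :=
  (List.range m).map fun b => y.getD (i * n + b) false

/-- The output bit `b` for the input in block number `i`. -/
def outBit (n : ℕ) (g : List (ℕ × ℕ × ℕ)) (o : List ℕ) (y : List Bool) (i b : ℕ) : Bool :=
  (codeValues g (block n n y i)).getD (o.getD b 0) false

/-- Block number `i` is mapped to the zero string. -/
def isZeroAt (n : ℕ) (g : List (ℕ × ℕ × ℕ)) (o : List ℕ) (y : List Bool) (i : ℕ) : Bool :=
  (List.range n).all fun b => !outBit n g o y i b

/-- The blocks number `i` and `j` are mapped to the same string. -/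
def isEqualAt (n : ℕ) (g : List (ℕ × ℕ × ℕ)) (o : List ℕ) (y : List Bool) (i j : ℕ) : Bool :=
  (List.range n).all fun b => outBit n g o y i b == outBit n g o y j b

/-- The zeros and collisions among the blocks of `y`, where only the first `m` bits of every
block are listed. -/
def candidates (n : ℕ) (g : List (ℕ × ℕ × ℕ)) (o : List ℕ) (m : ℕ) (y : List Bool) :
    List (List Bool) :=
  (List.range (n + 1)).flatMap fun i =>
    (if isZeroAt n g o y i then [block n m y i] else []) ++
    (List.range (n + 1)).flatMap fun j =>
      if decide (i < j) && isEqualAt n g o y i j then [block n m y i ++ block n m y j] else []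

section polytime

variable {α : Type} [Enc α] {n m i b : α → ℕ} {o : α → List ℕ} {c : α → ℕ × ℕ × ℕ}
  {g : α → List (ℕ × ℕ × ℕ)} {x v y : α → List Bool}

theorem pt_codeValue (hx : PT x) (hv : PT v) (hc : PT c) :
    PT fun a => codeValue (x a) (v a) (c a) := by
  have e := fun k => hc.fst.eq (PT.const k)
  have h₁ := hv.getD hc.snd.fst (PT.const false)
  have h₂ := hv.getD hc.snd.snd (PT.const false)
  exact PT.ite (e 0) (hx.getD hc.snd.fst (PT.const false)) <|
    PT.ite (e 1) (hc.snd.fst.eq (PT.const 0)).not <| PT.ite (e 2) h₁.not <|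
    PT.ite (e 3) (h₁.and h₂) (h₁.or h₂)

/-- There is one value per gate, and a truth value in a list costs at most three bits; hence the
bound on the intermediate lists. -/
theorem pt_codeValues (hg : PT g) (hx : PT x) : PT fun a => codeValues (g a) (x a) := by
  refine PT.foldl (f := fun a v c => v ++ [codeValue (x a) v c]) hg (PT.const [])
    (PT.id.snd.fst.append
      (pt_codeValue (hx.comp PT.id.fst) PT.id.snd.fst PT.id.snd.snd).singleton)
    ((SizeBdd.const 3).mul hg.sizeBdd) fun a l hl => (size_bools_le _).trans ?_
  refine Nat.mul_le_mul_left 3 (le_trans ?_ ((length_le_size l).trans (size_le_of_prefix hl)))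
  clear hl
  induction l using List.reverseRecOn with
  | nil => simp
  | append_singleton l c ih => simpa using ih

theorem pt_block (hn : PT n) (hm : PT m) (hy : PT y) (hi : PT i) :
    PT fun a => block (n a) (m a) (y a) (i a) :=
  hm.range.map (f := fun a b => (y a).getD (i a * n a + b) false)
    ((hy.comp PT.id.fst).getD (((hi.comp PT.id.fst).mul (hn.comp PT.id.fst)).add PT.id.snd)
      (PT.const false))

theorem pt_outBit (hn : PT n) (hg : PT g) (ho : PT o) (hy : PT y) (hi : PT i) (hb : PT b) :
    PT fun a => outBit (n a) (g a) (o a) (y a) (i a) (b a) :=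
  (pt_codeValues hg (pt_block hn hn hy hi)).getD (ho.getD hb (PT.const 0)) (PT.const false)

theorem pt_isZeroAt (hn : PT n) (hg : PT g) (ho : PT o) (hy : PT y) (hi : PT i) :
    PT fun a => isZeroAt (n a) (g a) (o a) (y a) (i a) :=
  hn.range.all (c := fun a b => !outBit (n a) (g a) (o a) (y a) (i a) b)
    (pt_outBit (hn.comp PT.id.fst) (hg.comp PT.id.fst) (ho.comp PT.id.fst) (hy.comp PT.id.fst)
      (hi.comp PT.id.fst) PT.id.snd).not

theorem pt_isEqualAt (hn : PT n) (hg : PT g) (ho : PT o) (hy : PT y) (hi : PT i) (hb : PT b) :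
    PT fun a => isEqualAt (n a) (g a) (o a) (y a) (i a) (b a) := by
  have h : ∀ {i : α → ℕ}, PT i →
      PT fun p : α × ℕ => outBit (n p.1) (g p.1) (o p.1) (y p.1) (i p.1) p.2 := fun hi =>
    pt_outBit (hn.comp PT.id.fst) (hg.comp PT.id.fst) (ho.comp PT.id.fst) (hy.comp PT.id.fst)
      (hi.comp PT.id.fst) PT.id.snd
  exact hn.range.all (c := fun a k => outBit (n a) (g a) (o a) (y a) (i a) k ==
    outBit (n a) (g a) (o a) (y a) (b a) k) ((h hi).beq (h hb))

theorem pt_candidates (hn : PT n) (hg : PT g) (ho : PT o) (hm : PT m) (hy : PT y) :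
    PT fun a => candidates (n a) (g a) (o a) (m a) (y a) := by
  have hb : PT fun p : α × ℕ => block (n p.1) (m p.1) (y p.1) p.2 :=
    pt_block (hn.comp PT.id.fst) (hm.comp PT.id.fst) (hy.comp PT.id.fst) PT.id.snd
  have h₁ : PT fun p : α × ℕ => isZeroAt (n p.1) (g p.1) (o p.1) (y p.1) p.2 :=
    pt_isZeroAt (hn.comp PT.id.fst) (hg.comp PT.id.fst) (ho.comp PT.id.fst) (hy.comp PT.id.fst)
      PT.id.snd
  have h₂ : PT fun p : (α × ℕ) × ℕ =>
      isEqualAt (n p.1.1) (g p.1.1) (o p.1.1) (y p.1.1) p.1.2 p.2 :=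
    pt_isEqualAt (hn.comp PT.id.fst.fst) (hg.comp PT.id.fst.fst) (ho.comp PT.id.fst.fst)
      (hy.comp PT.id.fst.fst) PT.id.fst.snd PT.id.snd
  have h₃ : PT fun p : (α × ℕ) × ℕ =>
      [block (n p.1.1) (m p.1.1) (y p.1.1) p.1.2 ++ block (n p.1.1) (m p.1.1) (y p.1.1) p.2] :=
    ((hb.comp (β := α × ℕ) PT.id.fst).append
      (hb.comp (f := fun p : (α × ℕ) × ℕ => (p.1.1, p.2)) (PT.id.fst.fst.pair PT.id.snd))).singleton
  have h₄ : PT fun p : α × ℕ => (List.range (n p.1 + 1)).flatMap fun j =>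
      if decide (p.2 < j) && isEqualAt (n p.1) (g p.1) (o p.1) (y p.1) p.2 j then
        [block (n p.1) (m p.1) (y p.1) p.2 ++ block (n p.1) (m p.1) (y p.1) j] else [] :=
    PT.flatMap (f := fun (p : α × ℕ) j =>
      if decide (p.2 < j) && isEqualAt (n p.1) (g p.1) (o p.1) (y p.1) p.2 j then
        [block (n p.1) (m p.1) (y p.1) p.2 ++ block (n p.1) (m p.1) (y p.1) j] else [])
      (hn.succ.comp PT.id.fst).range
      (((PT.id.fst.snd.lt PT.id.snd).and h₂).ite_bool h₃ (PT.const []))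
  exact PT.flatMap (f := fun a i =>
    (if isZeroAt (n a) (g a) (o a) (y a) i then [block (n a) (m a) (y a) i] else []) ++
    (List.range (n a + 1)).flatMap fun j =>
      if decide (i < j) && isEqualAt (n a) (g a) (o a) (y a) i j
      then [block (n a) (m a) (y a) i ++ block (n a) (m a) (y a) j] else []) hn.succ.range
    ((h₁.ite_bool hb.singleton (PT.const [])).append h₄)

end polytime

/-! ### Collisions found in a certificate -/

section certificate

variable {n m : ℕ} (a : Fin (n + 1) → Fin n → Bool)

/-- Cutting the blocks to `m` bits serves the padded circuits, where only the inputs of the original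
circuit are to be returned. -/
theorem block_flatten (hm : m ≤ n) (i : Fin (n + 1)) :
    block n m (List.ofFn fun i => List.ofFn (a i)).flatten i =
      List.ofFn fun b : Fin m => a i (b.castLE hm) := by
  have h : (List.ofFn fun i => List.ofFn (a i)).flatten =
      List.ofFn fun t : Fin ((n + 1) * n) => a t.divNat t.modNat := by
    rw [List.ofFn_mul]
    congr 2
    funext i
    congr 1
    funext b
    congr 1
    · exact Fin.ext (mul_add_div _ b.2).symm
    · exact Fin.ext (mul_add_mod _ b.2).symm
  rw [block, h]
  refine List.ext_getElem (by simp) fun b hb _ => ?_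
  simp only [List.length_map, List.length_range] at hb
  have hi := Nat.mul_le_mul_right n (Nat.succ_le_of_lt i.2)
  rw [Nat.succ_mul] at hi
  simp only [List.getElem_map, List.getElem_range, List.getElem_ofFn]
  rw [List.getD_eq_getElem _ _ (by rw [List.length_ofFn]; omega), List.getElem_ofFn]
  congr 1
  · exact Fin.ext (mul_add_div _ (hb.trans_le hm))
  · exact Fin.ext (mul_add_mod _ (hb.trans_le hm))

theorem outBit_flatten (C : BoolCircuit n n) (i : Fin (n + 1)) (b : Fin n) :
    outBit n (C.gates.map BoolGate.toCode) (List.ofFn C.out)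
      (List.ofFn fun i => List.ofFn (a i)).flatten i b = C.eval (a i) b := by
  rw [outBit, block_flatten a le_rfl i, getD_out C b.2]
  exact congrArg (fun l => List.getD l _ false) (codeValues_map C (a i))

/-- The first zero or collision that is found in a certificate. -/
theorem headI_candidates (C : BoolCircuit n n) (hm : m ≤ n)
    (ha : LongChoiceInstance.IsCertificate (circuit C) a) :
    (∃ i, (C.eval (a i) = fun _ => false) ∧
      (candidates n (C.gates.map BoolGate.toCode) (List.ofFn C.out) m
        (List.ofFn fun i => List.ofFn (a i)).flatten).headI =
        List.ofFn fun b : Fin m => a i (b.castLE hm)) ∨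
    ∃ i j, a i ≠ a j ∧ C.eval (a i) = C.eval (a j) ∧
      (candidates n (C.gates.map BoolGate.toCode) (List.ofFn C.out) m
        (List.ofFn fun i => List.ofFn (a i)).flatten).headI =
        (List.ofFn fun b : Fin m => a i (b.castLE hm)) ++
          List.ofFn fun b : Fin m => a j (b.castLE hm) := by
  set l := candidates n (C.gates.map BoolGate.toCode) (List.ofFn C.out) m
    (List.ofFn fun i => List.ofFn (a i)).flatten with hl
  have hz : ∀ i : Fin (n + 1), isZeroAt n (C.gates.map BoolGate.toCode) (List.ofFn C.out)
        (List.ofFn fun i => List.ofFn (a i)).flatten i = true ↔ C.eval (a i) = fun _ => false := by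
    intro i
    rw [isZeroAt, List.all_eq_true, funext_iff]
    refine ⟨fun h b => ?_, fun h b hb => ?_⟩
    · have := h b (by simp)
      rwa [outBit_flatten, Bool.not_eq_true'] at this
    · rw [List.mem_range] at hb
      have := outBit_flatten a C i ⟨b, hb⟩
      dsimp only at this
      rw [this, h]
      rfl
  have he : ∀ i j : Fin (n + 1), isEqualAt n (C.gates.map BoolGate.toCode) (List.ofFn C.out)
        (List.ofFn fun i => List.ofFn (a i)).flatten i j = true ↔
      C.eval (a i) = C.eval (a j) := by
    intro i j
    rw [isEqualAt, List.all_eq_true, funext_iff]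
    refine ⟨fun h b => ?_, fun h b hb => ?_⟩
    · have := h b (by simp)
      rwa [outBit_flatten, outBit_flatten, beq_iff_eq] at this
    · rw [List.mem_range] at hb
      have h₁ := outBit_flatten a C i ⟨b, hb⟩
      have h₂ := outBit_flatten a C j ⟨b, hb⟩
      dsimp only at h₁ h₂
      rw [h₁, h₂, h, beq_iff_eq]
  have hmem : ∀ r, r ∈ l ↔
      (∃ i, (C.eval (a i) = fun _ => false) ∧ r = List.ofFn fun b : Fin m => a i (b.castLE hm)) ∨
      ∃ i j, i < j ∧ C.eval (a i) = C.eval (a j) ∧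
        r = (List.ofFn fun b : Fin m => a i (b.castLE hm)) ++
          List.ofFn fun b : Fin m => a j (b.castLE hm) := by
    intro r
    rw [hl, candidates]
    simp only [List.mem_flatMap, List.mem_append, List.mem_range, List.mem_ite_nil_right,
      List.mem_singleton, Bool.and_eq_true, decide_eq_true_eq]
    constructor
    · rintro ⟨i, hi, h | ⟨j, hj, ⟨hij, h⟩, hr⟩⟩
      · rw [hz ⟨i, hi⟩, block_flatten a hm ⟨i, hi⟩] at h
        exact .inl ⟨_, h⟩
      · rw [he ⟨i, hi⟩ ⟨j, hj⟩] at h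
        rw [block_flatten a hm ⟨i, hi⟩, block_flatten a hm ⟨j, hj⟩] at hr
        exact .inr ⟨_, _, hij, h, hr⟩
    · rintro (⟨i, h, hr⟩ | ⟨i, j, hij, h, hr⟩)
      · exact ⟨i, i.2, .inl ⟨(hz i).mpr h, by rw [block_flatten a hm i, hr]⟩⟩
      · exact ⟨i, i.2, .inr ⟨j, j.2, ⟨hij, (he i j).mpr h⟩,
          by rw [block_flatten a hm i, block_flatten a hm j, hr]⟩⟩
  -- The elimination argument enters here: it guarantees that the search succeeds.
  have hne : l ≠ [] := by
    rcases exists_collision_of_isCertificate C ha with ⟨i, j, hij, h⟩ | ⟨i, h⟩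
    · exact List.ne_nil_of_mem ((hmem _).mpr (.inr ⟨i, j, hij, h, rfl⟩))
    · exact List.ne_nil_of_mem ((hmem _).mpr (.inl ⟨i, h, rfl⟩))
  have hh : l.headI ∈ l := by
    cases hl' : l with
    | nil => exact absurd hl' hne
    | cons r l' => simp
  -- Different positions carry different elements, because the elements of a certificate are
  -- distinct.
  exact ((hmem _).mp hh).imp_right fun ⟨i, j, hij, h⟩ => ⟨i, j, ha.1.ne hij.ne, h⟩

end certificate

/-! ### Padding the inputs of a circuit -/

/-- The gates `g` together with input gates for as many further inputs. -/
def padGates (n : ℕ) (g : List (ℕ × ℕ × ℕ)) : List (ℕ × ℕ × ℕ) :=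
  g ++ (List.range g.length).map fun b => (0, n + b, 0)

/-- The outputs `o` together with `s` further gates. -/
def padOuts (s : ℕ) (o : List ℕ) : List ℕ := o ++ (List.range s).map fun b => s + b

section padding

variable {n : ℕ}

/-- This makes `C` its own copy number 0, so the lemmas about shifted copies apply to the padded
circuit. -/
theorem shiftCode_zero {s : ℕ} (g : BoolGate n) : shiftCode n s 0 g.toCode = g.toCode := by
  cases g <;> simp [BoolGate.toCode, shiftCode]

variable (C : BoolCircuit n n)

theorem getD_padGates {k : ℕ} (hk : k < C.gates.length) :
    (padGates n (C.gates.map BoolGate.toCode)).getD k (1, 0, 0) = C.gates[k].toCode := by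
  rw [padGates, List.getD_append _ _ _ _ (by simpa using hk), getD_map_toCode hk]

theorem getD_padGates_right {b : ℕ} (hb : b < C.gates.length) :
    (padGates n (C.gates.map BoolGate.toCode)).getD (C.gates.length + b) (1, 0, 0) =
      (0, n + b, 0) := by
  rw [padGates, List.getD_append_right _ _ _ _ (by simp), List.getD_eq_getElem _ _ (by simpa)]
  simp

theorem length_padGates :
    (padGates n (C.gates.map BoolGate.toCode)).length = C.gates.length + C.gates.length := by
  simp [padGates]

theorem getD_padOuts {o : ℕ} (ho : o < n) :
    (padOuts C.gates.length (List.ofFn C.out)).getD o 0 = C.out ⟨o, ho⟩ := by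
  rw [padOuts, List.getD_append _ _ _ _ (by simpa using ho), getD_out C ho]

theorem getD_padOuts_right {b : ℕ} (hb : b < C.gates.length) :
    (padOuts C.gates.length (List.ofFn C.out)).getD (n + b) 0 = C.gates.length + b := by
  rw [padOuts, List.getD_append_right _ _ _ _ (by simp), List.getD_eq_getElem _ _ (by simpa)]
  simp

/-- The circuit that applies `C` to the first inputs and returns the further inputs unchanged. -/
def padCircuit : BoolCircuit (n + C.gates.length) (n + C.gates.length) where
  gates := (padGates n (C.gates.map BoolGate.toCode)).map (BoolGate.ofCode _)
  out o := (padOuts C.gates.length (List.ofFn C.out)).getD o 0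
  refs_lt k hk q hq := by
    simp only [List.length_map, length_padGates] at hk
    rw [List.getElem_map, ← List.getD_eq_getElem _ (1, 0, 0)] at hq
    rcases Nat.lt_or_ge k C.gates.length with h | h
    · rw [getD_padGates C h, ← shiftCode_zero (s := 0)] at hq
      obtain ⟨r, hr, rfl⟩ := refs_shiftCode _ q hq
      simpa using C.refs_lt k h r hr
    · obtain ⟨b, rfl⟩ := Nat.exists_eq_add_of_le h
      rw [getD_padGates_right C (by omega)] at hq
      have : n + b < n + C.gates.length := by omega
      simp [BoolGate.ofCode, this, BoolGate.refs] at hq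
  out_lt o := by
    rw [List.length_map, length_padGates]
    rcases Nat.lt_or_ge o.val n with h | h
    · rw [getD_padOuts C h]
      have := C.out_lt ⟨o, h⟩
      omega
    · obtain ⟨b, hb⟩ := Nat.exists_eq_add_of_le h
      rw [hb, getD_padOuts_right C (by omega)]
      omega

theorem map_toCode_padCircuit :
    (padCircuit C).gates.map BoolGate.toCode = padGates n (C.gates.map BoolGate.toCode) := by
  rw [padCircuit, List.map_map]
  refine (List.map_congr_left fun c hc => ?_).trans (List.map_id _)
  rw [padGates, List.mem_append] at hc
  rcases hc with hc | hc
  · obtain ⟨g, -, rfl⟩ := List.mem_map.mp hc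
    rcases g with i | b | _ | _ | _
    · have : i.val < n + C.gates.length := by omega
      simp [BoolGate.toCode, BoolGate.ofCode, this]
    · cases b <;> rfl
    all_goals rfl
  · obtain ⟨b, hb, rfl⟩ := List.mem_map.mp hc
    have : n + b < n + C.gates.length := by simpa using hb
    simp [BoolGate.toCode, BoolGate.ofCode, this]

theorem ofFn_out_padCircuit :
    List.ofFn (padCircuit C).out = padOuts C.gates.length (List.ofFn C.out) := by
  refine List.ext_getElem (by simp [padOuts]) fun k _ hk => ?_
  rw [List.getElem_ofFn]
  exact List.getD_eq_getElem _ _ hk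

theorem values_padCircuit (z : Fin (n + C.gates.length) → Bool) (k : ℕ) (hk : k < C.gates.length) :
    ((padCircuit C).values z).getD k false =
      (C.values fun b => z (b.castAdd _)).getD k false := by
  induction k using Nat.strong_induction_on with
  | _ k ih =>
    rw [BoolCircuit.getD_values _ _ k (by simp [padCircuit, length_padGates]; omega)]
    simp only [padCircuit, List.getElem_map]
    rw [← List.getD_eq_getElem _ (1, 0, 0), getD_padGates C hk, ← shiftCode_zero (s := 0),
      eval_shiftCode (w := C.values fun b => z (b.castAdd _)) (fun b hb => by omega),
      C.getD_values _ k hk]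
    · congr 1
      funext b
      congr 1
      ext
      simp
    · intro r hr
      have := C.refs_lt k hk r hr
      rw [Nat.zero_mul, Nat.zero_add]
      exact ih r this (by omega)

theorem eval_padCircuit_left (z : Fin (n + C.gates.length) → Bool) (i : Fin n) :
    (padCircuit C).eval z (i.castAdd _) = C.eval (fun b => z (b.castAdd _)) i := by
  have : (padCircuit C).out (i.castAdd _) = C.out i := getD_padOuts C i.2
  rw [BoolCircuit.eval, this, values_padCircuit C z _ (C.out_lt i)]
  rfl

theorem eval_padCircuit_right (z : Fin (n + C.gates.length) → Bool) (b : Fin C.gates.length) :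
    (padCircuit C).eval z (b.natAdd n) = z (b.natAdd n) := by
  have : (padCircuit C).out (b.natAdd n) = C.gates.length + b := getD_padOuts_right C b.2
  rw [BoolCircuit.eval, this,
    BoolCircuit.getD_values _ _ _ (by simp [padCircuit, length_padGates])]
  simp only [padCircuit, List.getElem_map]
  rw [← List.getD_eq_getElem _ (1, 0, 0), getD_padGates_right C b.2]
  simp [BoolGate.ofCode, BoolGate.eval, Fin.natAdd]

theorem eval_eq_of_padCircuit {z z' : Fin (n + C.gates.length) → Bool}
    (h : (padCircuit C).eval z = (padCircuit C).eval z') :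
    (C.eval fun b => z (b.castAdd _)) = C.eval fun b => z' (b.castAdd _) := by
  funext i
  rw [← eval_padCircuit_left, ← eval_padCircuit_left, h]

/-- The further bits are among the outputs, so colliding inputs agree on them and must differ on the
first `n` bits. -/
theorem ne_of_padCircuit {z z' : Fin (n + C.gates.length) → Bool} (hz : z ≠ z')
    (h : (padCircuit C).eval z = (padCircuit C).eval z') :
    (fun b : Fin n => z (b.castAdd _)) ≠ fun b => z' (b.castAdd _) := by
  intro he
  refine hz (funext fun i => ?_)
  refine Fin.addCases (fun i => congrFun he i) (fun b => ?_) i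
  rw [← eval_padCircuit_right C z, ← eval_padCircuit_right C z', h]

end padding

/-! ### Reading the description of a circuit -/

/-- The descriptions of the gates in the description of an instance of Collision. -/
def natsGates (l : List ℕ) : List (ℕ × ℕ × ℕ) :=
  (List.range (l.getD 1 0)).map fun k =>
    (l.getD (2 + 3 * k) 0, l.getD (2 + 3 * k + 1) 0, l.getD (2 + 3 * k + 2) 0)

/-- The outputs in the description of an instance of Collision. -/
def natsOuts (l : List ℕ) : List ℕ := l.drop (2 + 3 * l.getD 1 0)

theorem getD_flatten_toNats {n : ℕ} (g : List (BoolGate n)) (t : List ℕ) {k r : ℕ}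
    (hk : k < g.length) (hr : r < 3) :
    ((g.map BoolGate.toNats).flatten ++ t).getD (3 * k + r) 0 = g[k].toNats.getD r 0 := by
  induction g generalizing k with
  | nil => simp at hk
  | cons a g ih =>
    rw [List.map_cons, List.flatten_cons, List.append_assoc]
    cases k with
    | zero =>
      rw [List.getD_append _ _ _ _ (by rw [BoolGate.length_toNats]; omega)]
      simp
    | succ k =>
      rw [List.getD_append_right _ _ _ _ (by rw [BoolGate.length_toNats]; omega),
        BoolGate.length_toNats, show 3 * (k + 1) + r - 3 = 3 * k + r by omega,
        ih (by simpa using hk)]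
      rfl

/-- The offset 2 skips the number of inputs and the number of gates; each gate occupies three
numbers. -/
theorem natsGates_toNats {n m : ℕ} (C : BoolCircuit n m) :
    natsGates (n :: C.toNats) = C.gates.map BoolGate.toCode := by
  refine List.ext_getElem (by simp [natsGates, BoolCircuit.toNats]) fun k hk hk' => ?_
  rw [List.length_map] at hk'
  have h : ∀ r < 3, (n :: C.toNats).getD (2 + 3 * k + r) 0 = C.gates[k].toNats.getD r 0 :=
    fun r hr => by
    rw [show 2 + 3 * k + r = 3 * k + r + 1 + 1 by omega, BoolCircuit.toNats, List.getD_cons_succ,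
      List.getD_cons_succ, getD_flatten_toNats _ _ hk' hr]
  simp only [natsGates, List.getElem_map, List.getElem_range]
  rw [h 1 (by omega), h 2 (by omega), ← Nat.add_zero (2 + 3 * k), h 0 (by omega),
    BoolGate.toNats_eq]
  rfl

theorem natsOuts_toNats {n m : ℕ} (C : BoolCircuit n m) :
    natsOuts (n :: C.toNats) = List.ofFn C.out := by
  have h : (C.gates.map BoolGate.toNats).flatten.length = 3 * C.gates.length := by
    induction C.gates with
    | nil => rfl
    | cons g l ih =>
      rw [List.map_cons, List.flatten_cons, List.length_append, ih, BoolGate.length_toNats,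
        List.length_cons]
      omega
  rw [natsOuts, BoolCircuit.toNats, List.getD_cons_succ, List.getD_cons_zero, Nat.add_comm,
    List.drop_succ_cons, List.drop_succ_cons, ← h, List.drop_left]

section polytime

variable {α : Type} [Enc α] {n s : α → ℕ} {l o : α → List ℕ} {g : α → List (ℕ × ℕ × ℕ)}

theorem pt_natsGates (hl : PT l) : PT fun a => natsGates (l a) := by
  have h : ∀ d, PT fun p : α × ℕ => (l p.1).getD (2 + 3 * p.2 + d) 0 := fun d =>
    (hl.comp PT.id.fst).getD (((PT.const 2).add ((PT.const 3).mul PT.id.snd)).add (PT.const d))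
      (PT.const 0)
  exact (hl.getD (PT.const 1) (PT.const 0)).range.map (f := fun a k =>
    ((l a).getD (2 + 3 * k) 0, (l a).getD (2 + 3 * k + 1) 0, (l a).getD (2 + 3 * k + 2) 0))
    ((h 0).pair ((h 1).pair (h 2)))

theorem pt_natsOuts (hl : PT l) : PT fun a => natsOuts (l a) :=
  hl.drop ((PT.const 2).add ((PT.const 3).mul (hl.getD (PT.const 1) (PT.const 0))))

theorem pt_padGates (hn : PT n) (hg : PT g) : PT fun a => padGates (n a) (g a) :=
  hg.append (hg.length.range.map (f := fun a b => (0, n a + b, 0))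
    ((PT.const 0).pair (((hn.comp PT.id.fst).add PT.id.snd).pair (PT.const 0))))

theorem pt_padOuts (hs : PT s) (ho : PT o) : PT fun a => padOuts (s a) (o a) :=
  ho.append (hs.range.map (f := fun a b => s a + b) ((hs.comp PT.id.fst).add PT.id.snd))

end polytime

end Elimination

/-! ### The reductions -/

namespace Elimination

/-- The numbers that describe an instance of Collision. -/
def circuitNats (C : collision.Inst) : List ℕ := C.1 :: C.2.toNats

theorem natsGates_circuitNats (C : collision.Inst) :
    natsGates (circuitNats C) = C.2.gates.map BoolGate.toCode := natsGates_toNats C.2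

theorem natsOuts_circuitNats (C : collision.Inst) :
    natsOuts (circuitNats C) = List.ofFn C.2.out := natsOuts_toNats C.2

theorem getD_circuitNats (C : collision.Inst) : (circuitNats C).getD 0 0 = C.1 := rfl

theorem polyTime_circuitNats : PolyTime collision.encode bits circuitNats :=
  PolyTime.nats_of_word (f := circuitNats)

theorem polyTime_circuit :
    PolyTime collision.encode longChoice.encode fun C => ⟨C.1, circuit C.2⟩ := by
  have h : PT fun l : List ℕ => instanceNats (l.getD 0 0) (natsGates l) (natsOuts l) :=
    pt_instanceNats (PT.id.getD (PT.const 0) (PT.const 0)) (pt_natsGates PT.id)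
      (pt_natsOuts PT.id)
  refine PolyTime.reindex (PolyTime.comp (PolyTime.word_of_nats (f := fun l : List ℕ => l))
    (PolyTime.comp h polyTime_circuitNats)) (fun C => C) (fun _ => rfl) fun C => ?_
  rw [encode_circuit, natsGates_circuitNats, natsOuts_circuitNats]
  rfl

theorem polyTime_circuit_padCircuit :
    PolyTime collision.encode longChoice.encode
      fun C => ⟨C.1 + C.2.gates.length, circuit (padCircuit C.2)⟩ := by
  have hn : PT fun l : List ℕ => l.getD 0 0 := PT.id.getD (PT.const 0) (PT.const 0)
  have hg := pt_natsGates (PT.id (α := List ℕ))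
  have h : PT fun l : List ℕ => instanceNats (l.getD 0 0 + (natsGates l).length)
      (padGates (l.getD 0 0) (natsGates l)) (padOuts (natsGates l).length (natsOuts l)) :=
    pt_instanceNats (hn.add hg.length) (pt_padGates hn hg)
      (pt_padOuts hg.length (pt_natsOuts PT.id))
  refine PolyTime.reindex (PolyTime.comp (PolyTime.word_of_nats (f := fun l : List ℕ => l))
    (PolyTime.comp h polyTime_circuitNats)) (fun C => C) (fun _ => rfl) fun C => ?_
  rw [encode_circuit, natsGates_circuitNats, natsOuts_circuitNats, map_toCode_padCircuit,
    ofFn_out_padCircuit, List.length_map]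
  rfl

/-- The solution of an instance of Collision that is found in a certificate for its elimination
circuits. -/
def solution (l : List ℕ) (y : List Bool) : List Bool :=
  (candidates (l.getD 0 0) (natsGates l) (natsOuts l) (l.getD 0 0) y).headI

/-- The solution of an instance of Collision that is found in a certificate for the elimination
circuits of its padding. -/
def padSolution (l : List ℕ) (y : List Bool) : List Bool :=
  (candidates (l.getD 0 0 + (natsGates l).length) (padGates (l.getD 0 0) (natsGates l))
    (padOuts (natsGates l).length (natsOuts l)) (l.getD 0 0) y).headI

theorem pt_solution : PT fun p : List ℕ × List Bool => solution p.1 p.2 := by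
  have hn : PT fun p : List ℕ × List Bool => p.1.getD 0 0 :=
    PT.id.fst.getD (PT.const 0) (PT.const 0)
  exact (pt_candidates hn (pt_natsGates PT.id.fst) (pt_natsOuts PT.id.fst) hn PT.id.snd).headI

theorem pt_padSolution : PT fun p : List ℕ × List Bool => padSolution p.1 p.2 := by
  have hn : PT fun p : List ℕ × List Bool => p.1.getD 0 0 :=
    PT.id.fst.getD (PT.const 0) (PT.const 0)
  have hg : PT fun p : List ℕ × List Bool => natsGates p.1 := pt_natsGates PT.id.fst
  exact (pt_candidates (hn.add hg.length) (pt_padGates hn hg)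
    (pt_padOuts hg.length (pt_natsOuts PT.id.fst)) hn PT.id.snd).headI

theorem isSol_solution (C : collision.Inst) {y : List Bool}
    (hy : longChoice.IsSol ⟨C.1, circuit C.2⟩ y) :
    collision.IsSol C (solution (circuitNats C) y) := by
  obtain ⟨a, ha, rfl⟩ := hy
  rw [solution, natsGates_circuitNats, natsOuts_circuitNats, getD_circuitNats]
  rcases headI_candidates a C.2 le_rfl ha with ⟨i, h, hs⟩ | ⟨i, j, hij, h, hs⟩
  · exact .inl ⟨a i, h, hs⟩
  · exact .inr ⟨a i, a j, hij, h, hs⟩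

theorem isSol_padSolution (C : collision.Inst) {y : List Bool}
    (hy : longChoice.IsSol ⟨C.1 + C.2.gates.length, circuit (padCircuit C.2)⟩ y) :
    collision.IsSol C (padSolution (circuitNats C) y) := by
  obtain ⟨a, ha, rfl⟩ := hy
  rw [padSolution, natsGates_circuitNats, natsOuts_circuitNats, getD_circuitNats,
    List.length_map, ← map_toCode_padCircuit, ← ofFn_out_padCircuit]
  rcases headI_candidates a (padCircuit C.2) (Nat.le_add_right _ _) ha with
    ⟨i, h, hs⟩ | ⟨i, j, hij, h, hs⟩
  · refine .inl ⟨fun b => a i (b.castAdd _), ?_, hs⟩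
    funext b
    rw [← eval_padCircuit_left, h]
  · exact .inr ⟨fun b => a i (b.castAdd _), fun b => a j (b.castAdd _),
      ne_of_padCircuit C.2 hij h, eval_eq_of_padCircuit C.2 h, hs⟩

theorem sizeLE_circuit {n : ℕ} (C : BoolCircuit n n) :
    LongChoiceInstance.SizeLE (circuit C) (n * C.size + 12 * n ^ 3) := by
  intro i
  have hi : i.val + 2 ≤ n := by omega
  rw [size_circuit]
  calc (i.val + 2) * C.size + (i + 2) * (i + 2) * n * 12 ≤ n * C.size + n * n * n * 12 := by gcongr
    _ = n * C.size + 12 * n ^ 3 := by ring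

/-! ### Maps on pairs of an instance and a solution -/

section pairs

variable {S : Type} {u v : S → List Bool} {C : S → collision.Inst}

theorem polyTime_pairBits {h : List ℕ → List Bool → List Bool}
    (hh : PT fun q : List ℕ × List Bool => h q.1 q.2) (hC : PolyTime u collision.encode C) :
    PolyTime (fun p => pairBits (u p) (v p)) (fun w => w) fun p => h (circuitNats (C p)) (v p) := by
  have h₁ : PolyTime (fun p => pairBits (u p) (v p)) bits fun p => circuitNats (C p) :=
    PolyTime.comp polyTime_circuitNats (PolyTime.comp hC PolyTime.fst_pairBits)
  have h₂ : PolyTime (fun p => pairBits (u p) (v p)) bits v :=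
    PolyTime.comp (f := fun p => p) PolyTime.bools_of_word PolyTime.snd_pairBits
  exact PolyTime.comp (g := fun w => w) PolyTime.word_of_bools
    (PolyTime.comp (g := fun q : List ℕ × List Bool => h q.1 q.2) hh (PolyTime.join h₁ h₂))

/-- The instance is kept next to the computed solution, because the second map of a further
reduction needs both. -/
theorem polyTime_pairBits_pair {h : S → List Bool}
    (hh : PolyTime (fun p => pairBits (u p) (v p)) (fun w => w) h) :
    PolyTime (fun p => pairBits (u p) (v p)) (fun q : List Bool × List Bool => pairBits q.1 q.2)
      fun p => (u p, h p) := by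
  have h₁ : PolyTime (fun p => pairBits (u p) (v p)) (fun w => w) u :=
    PolyTime.reindex PolyTime.fst_pairBits (fun p => p) (fun _ => rfl) fun _ => rfl
  exact PolyTime.comp (PolyTime.pairBits_joinBits (u := Prod.fst) (v := Prod.snd))
    (PolyTime.join h₁ hh)

end pairs

theorem collision_reducesVia : collision.ReducesVia longChoice fun C => ⟨C.1, circuit C.2⟩ :=
  ⟨polyTime_circuit, fun C y => solution (circuitNats C) y,
    polyTime_pairBits pt_solution (PolyTime.reindex ⟨Turing.idComputableInPolyTime _⟩
      (fun p => p.1.1) (fun _ => rfl) fun _ => rfl),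
    fun C _ hy => isSol_solution C hy⟩

/-- With `N = n + C.gates.length` inputs, the padded circuit has at most `2 * N` gates. The
elimination then needs at most `N * (2 * N) + 12 * N ^ 3` gates, a bound in `N` alone. -/
theorem sizeLE_circuit_padCircuit {n : ℕ} (C : BoolCircuit n n) :
    LongChoiceInstance.SizeLE (circuit (padCircuit C))
      ((2 * Polynomial.X ^ 2 + 12 * Polynomial.X ^ 3 : Polynomial ℕ).eval
        (n + C.gates.length)) := by
  intro i
  refine (sizeLE_circuit (padCircuit C) i).trans ?_
  have h : (padCircuit C).size ≤ 2 * (n + C.gates.length) := by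
    rw [BoolCircuit.size, padCircuit, List.length_map, length_padGates]
    omega
  have := Nat.mul_le_mul_left (n + C.gates.length) h
  simp only [Polynomial.eval_add, Polynomial.eval_mul, Polynomial.eval_pow, Polynomial.eval_X,
    Polynomial.eval_ofNat]
  nlinarith

/-- The given reduction to Collision is followed by padding and elimination; a certificate is turned
into a solution of Collision and then passed to `g`. -/
theorem pppHard_longChoiceOfSize :
    PPPHard (longChoiceOfSize (2 * Polynomial.X ^ 2 + 12 * Polynomial.X ^ 3)) := by
  rintro R ⟨-, f, hf, g, hg, hsol⟩
  let F : List Bool → longChoice.Inst := fun x =>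
    ⟨(f x).1 + (f x).2.gates.length, circuit (padCircuit (f x).2)⟩
  refine ⟨fun x => ⟨F x, sizeLE_circuit_padCircuit (f x).2⟩,
    PolyTime.reindex (PolyTime.comp polyTime_circuit_padCircuit hf) (fun x => x) (fun _ => rfl)
      fun _ => rfl, fun x y => g x (padSolution (circuitNats (f x)) y), ?_,
    fun x y hy => hsol x _ (isSol_padSolution (f x) hy)⟩
  have h₁ : PolyTime (fun p : {p : List Bool × List Bool // longChoice.IsSol (F p.1) p.2} => p.1.1)
      collision.encode fun p => f p.1.1 :=
    PolyTime.reindex hf (fun p => p.1.1) (fun _ => rfl) fun _ => rfl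
  have h₂ := polyTime_pairBits_pair (polyTime_pairBits
    (v := fun p : {p : List Bool × List Bool // longChoice.IsSol (F p.1) p.2} => p.1.2)
    pt_padSolution h₁)
  -- `g` is computable in polynomial time only on pairs whose second entry solves the instance of
  -- Collision, so the computed pairs are regarded as elements of that subtype.
  have h₃ := PolyTime.reindex (eb' := fun q : {p : List Bool × List Bool //
      collision.IsSol (f p.1) p.2} => pairBits q.1.1 q.1.2)
    (f' := fun p => ⟨_, isSol_padSolution (f p.1.1) p.2⟩) h₂ (fun p => p) (fun _ => rfl)
      fun _ => rfl
  exact PolyTime.comp hg h₃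

end Elimination

/-! ### The main theorem -/

theorem theorem2 :
    (∃ q : Polynomial ℕ, PPPHard (longChoiceOfSize q)) ∧
    ∃ f : (n : ℕ) → BoolCircuit n n → LongChoiceInstance n,
      collision.ReducesVia longChoice (fun C => ⟨C.1, f C.1 C.2⟩) ∧
      (∃ q : Polynomial ℕ, ∀ (n : ℕ) (C : BoolCircuit n n),
        (f n C).SizeLE (q.eval (n + C.size))) ∧
      ∀ (n : ℕ) (C : BoolCircuit n n) (a : Fin (n + 1) → Fin n → Bool),
        (f n C).IsCertificate a →
          (∃ i j, i ≠ j ∧ C.eval (a i) = C.eval (a j)) ∨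
          ∃ i, C.eval (a i) = fun _ => false := by
  refine ⟨⟨_, Elimination.pppHard_longChoiceOfSize⟩, fun _ C => Elimination.circuit C,
    Elimination.collision_reducesVia,
    ⟨Polynomial.X ^ 2 + 12 * Polynomial.X ^ 3, fun n C i => ?_⟩, fun n C a ha => ?_⟩
  · refine (Elimination.sizeLE_circuit C i).trans ?_
    simp only [Polynomial.eval_add, Polynomial.eval_mul, Polynomial.eval_pow, Polynomial.eval_X,
      Polynomial.eval_ofNat]
    have : n * C.size ≤ (n + C.size) ^ 2 := by nlinarith
    gcongr
    omega
  · exact (Elimination.exists_collision_of_isCertificate C ha).imp_left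
      fun ⟨i, j, hij, h⟩ => ⟨i, j, hij.ne, h⟩
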